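/- **Theorem 1.3.** Let $k$ be a field, $Q$ a finite quiver with path algebra $kQ$ (paths read from left to right, graded by path length), and $I\subseteq kQ$ a two-sided ideal generated by elements of $kQ_2$, so that $kQ/I$ is quadratic. Let $(kQ/I)^!=kQ^{\mathrm{op}}/I_{\mathrm{op}}^\perp$ be its quadratic dual: for $f=\sum_i\alpha_i a_i\in kQ$ put $f^*=\sum_i\alpha_i a_i^*\in kQ^{\mathrm{op}}$, where $a^*$ is the reversed path of $a$; then $I_{\mathrm{op}}^\perp$ is the ideal of $kQ^{\mathrm{op}}$ generated by the orthogonal complement in $kQ^{\mathrm{op}}_2$ of $\{f^*\mid f\in I\cap kQ_2\}$, with respect to the bilinear form for which the paths are orthonormal. *Definitions.* A weak bialgebra is an algebra and coalgebra $H$ with $\Delta(ab)=\Delta(a)\Delta(b)$, $\varepsilon(abc)=\varepsilon(ab_1)\varepsilon(b_2c)=\varepsilon(ab_2)\varepsilon(b_1c)$ and $\Delta^2(1)=(\Delta(1)\otimes1)(1\otimes\Delta(1))=(1\otimes\Delta(1))(\Delta(1)\otimes1)$. A map of weak bialgebras is a unital algebra map that is a coalgebra map. The counital subalgebras of $H$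 are $H_s=\{1_1\varepsilon(x1_2)\mid x\in H\}$ and $H_t=\{\varepsilon(1_1x)1_2\mid x\in H\}$. Let $A=\bigoplus_n A_n$ be $kQ/I$ or $(kQ/I)^!$ with the grading induced by path length. A linear left coaction of $H$ on $A$ is a left comodule structure $\lambda:A\to H\otimes A$ with $\lambda(ab)=\lambda(a)\lambda(b)$, $\lambda(1)\in H_s\otimes A$ and $\lambda(A_n)\subseteq H\otimes A_n$ for all $n$; it is base preserving if $A_0\cong H_t$ as algebras and left $H$-comodules, where $H_t$ is a comodule through $\Delta$. A linear right coaction is a right comodule structure $\rho:A\to A\otimes H$ with $\rho(ab)=\rho(a)\rho(b)$, $\rho(1)\in A\otimes H_t$ and $\rho(A_n)\subseteq A_n\otimes H$; it is base preserving if $A_0\cong H_s$ as algebras and right $H$-comodules. Such $\lambda$ and $\rho$ are transposed if for each $n$ there are $z_{a,b}\in H$, indexed by pairs of paths of length $n$, with $\lambda(\bar a)=\sum_b z_{a,b}\otimes\bar b$ and $\rho(\bar a)=\sum_b\bar b\otimes z_{b,a}$ for all paths $a$ of length $n$, where $\bar a\in A$ is the class of $a$. (For $n=0,1$ these classes are a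 basis of $A_n$, and the conditions for $n\ge2$ follow from those for $n=0,1$.) The left universal quantum linear semigroupoid $\mathcal O^{\mathrm{left}}(A)$ is a weak bialgebra with a base preserving linear left coaction $\lambda^{\mathcal O}$ on $A$, such that for every weak bialgebra $H$ with a base preserving linear left coaction $\lambda^H$ on $A$ there is a unique weak bialgebra map $\pi:\mathcal O^{\mathrm{left}}(A)\to H$ with $\lambda^H=(\pi\otimes\mathrm{id})\lambda^{\mathcal O}$. $\mathcal O^{\mathrm{right}}(A)$ is defined in the same way with right coactions and $\rho^H=(\mathrm{id}\otimes\pi)\rho^{\mathcal O}$, and $\mathcal O^{\mathrm{trans}}(A)$ with pairs of transposed base preserving linear coactions $(\lambda,\rho)$ and both equations for $\pi$. $H^{\mathrm{op}}$ has the opposite multiplication and $H^{\mathrm{cop}}$ the opposite comultiplication. *Claim.* The weak bialgebras $\mathcal O^{\mathrm{left}}(A)$, $\mathcal O^{\mathrm{right}}(A)$, $\mathcal O^{\mathrm{trans}}(A)$ exist for $A=kQ/I$ and for $A=(kQ/I)^!$, and there are isomorphisms of weak bialgebras (a) $\mathcal O^{\mathrm{left}}(kQ/I)\cong\mathcal O^{\mathrm{right}}((kQ/I)^!)^{\mathrm{op}}$,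 (b) $\mathcal O^{\mathrm{right}}(kQ/I)\cong\mathcal O^{\mathrm{left}}((kQ/I)^!)^{\mathrm{op}}$, (c) $\mathcal O^{\mathrm{left}}(kQ/I)\cong\mathcal O^{\mathrm{right}}(kQ/I)^{\mathrm{cop}}$, (d) $\mathcal O^{\mathrm{trans}}(kQ/I)\cong\mathcal O^{\mathrm{trans}}((kQ/I)^!)^{\mathrm{op}}$. -/

import Mathlib

open scoped TensorProduct
open Coalgebra

universe u v w x

noncomputable section

/-! ### Weak bialgebras -/

/-- A weak bialgebra over a field `k`: an algebra and a coalgebra `H` with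
`Δ(ab) = Δ(a)Δ(b)`, `ε(abc) = ε(ab₁)ε(b₂c) = ε(ab₂)ε(b₁c)` and
`Δ²(1) = (Δ(1) ⊗ 1)(1 ⊗ Δ(1)) = (1 ⊗ Δ(1))(Δ(1) ⊗ 1)`. -/
class WeakBialgebra (k : Type*) (H : Type*) [Field k] [Ring H] [Algebra k H] extends
    Coalgebra k H where
  comul_mul : ∀ a b : H, comul (a * b) = comul a * comul b
  counit_mul_mul : ∀ a b c : H, counit (a * b * c) =
    LinearMap.mul' k k (TensorProduct.map (counit ∘ₗ LinearMap.mulLeft k a)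
      (counit ∘ₗ LinearMap.mulRight k c) (comul b))
  counit_mul_mul' : ∀ a b c : H, counit (a * b * c) =
    LinearMap.mul' k k (TensorProduct.map (counit ∘ₗ LinearMap.mulRight k c)
      (counit ∘ₗ LinearMap.mulLeft k a) (comul b))
  comul_comul_one : comul.rTensor H (comul 1) =
    (comul 1 ⊗ₜ[k] (1 : H)) * (TensorProduct.assoc k H H H).symm ((1 : H) ⊗ₜ[k] comul 1)
  comul_comul_one' : comul.rTensor H (comul 1) =
    (TensorProduct.assoc k H H H).symm ((1 : H) ⊗ₜ[k] comul 1) * (comul 1 ⊗ₜ[k] (1 : H))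

section Counital

variable (k : Type*) (H : Type*) [Field k] [Ring H] [Algebra k H] [WeakBialgebra k H]

/-- The source counital map `ε_s(x) = 1₁ ε(x 1₂)`. -/
def sourceCounital : H →ₗ[k] H where
  toFun x := TensorProduct.rid k H ((counit ∘ₗ LinearMap.mulLeft k x).lTensor H (comul (1 : H)))
  map_add' x y := by
    have : LinearMap.mulLeft k (x + y) = LinearMap.mulLeft k x + LinearMap.mulLeft k y := by
      ext; simp [add_mul]
    simp [this, LinearMap.comp_add, LinearMap.lTensor_add]
  map_smul' c x := by
    have : LinearMap.mulLeft k (c • x) = c • LinearMap.mulLeft k x := by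
      ext; simp
    simp [this, LinearMap.comp_smul, LinearMap.lTensor_smul]

/-- The target counital map `ε_t(x) = ε(1₁ x) 1₂`. -/
def targetCounital : H →ₗ[k] H where
  toFun x := TensorProduct.lid k H ((counit ∘ₗ LinearMap.mulRight k x).rTensor H (comul (1 : H)))
  map_add' x y := by
    have : LinearMap.mulRight k (x + y) = LinearMap.mulRight k x + LinearMap.mulRight k y := by
      ext; simp [mul_add]
    simp [this, LinearMap.comp_add, LinearMap.rTensor_add]
  map_smul' c x := by
    have : LinearMap.mulRight k (c • x) = c • LinearMap.mulRight k x := by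
      ext; simp
    simp [this, LinearMap.comp_smul, LinearMap.rTensor_smul]

/-- The source counital subalgebra `H_s = ε_s(H)`, as a subspace of `H`. -/
def sourceCounitalSub : Submodule k H := LinearMap.range (sourceCounital k H)

/-- The target counital subalgebra `H_t = ε_t(H)`, as a subspace of `H`. -/
def targetCounitalSub : Submodule k H := LinearMap.range (targetCounital k H)

end Counital

/-! ### Opposite and co-opposite weak bialgebras -/

/-- A weak bialgebra structure transported along an anti-multiplicative coalgebra isomorphism. -/
@[reducible] def WeakBialgebra.ofAntiEquiv (k : Type*) (H B : Type*) [Field k] [Ring H] [Algebra k H]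
    [WeakBialgebra k H] [Ring B] [Algebra k B] [Coalgebra k B] (φ : H ≃ₗ[k] B)
    (hmul : ∀ x y : H, φ (x * y) = φ y * φ x) (hone : φ 1 = 1)
    (com : ∀ x : H, comul (R := k) (φ x) =
      TensorProduct.map φ.toLinearMap φ.toLinearMap (comul (R := k) x))
    (cou : ∀ x : H, counit (R := k) (φ x) = counit (R := k) x) : WeakBialgebra k B :=
  have key : ∀ x y : H ⊗[k] H,
      TensorProduct.map φ.toLinearMap
        φ.toLinearMap (x * y) =
      TensorProduct.map φ.toLinearMap
        φ.toLinearMap y *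
      TensorProduct.map φ.toLinearMap
        φ.toLinearMap x := fun x y => by
    induction x with
    | zero => simp
    | add x x' hx hx' => simp only [add_mul, mul_add, map_add, hx, hx']
    | tmul a b =>
      induction y with
      | zero => simp
      | add y y' hy hy' => simp only [add_mul, mul_add, map_add, hy, hy']
      | tmul c d => simp [hmul]
  have key3 : ∀ x y : (H ⊗[k] H) ⊗[k] H,
      TensorProduct.map (TensorProduct.map φ.toLinearMap
        φ.toLinearMap) φ.toLinearMap
        (x * y) =
      TensorProduct.map (TensorProduct.map φ.toLinearMap
        φ.toLinearMap) φ.toLinearMap y *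
      TensorProduct.map (TensorProduct.map φ.toLinearMap
        φ.toLinearMap) φ.toLinearMap x :=
    fun x y => by
    induction x with
    | zero => simp
    | add x x' hx hx' => simp only [add_mul, mul_add, map_add, hx, hx']
    | tmul a b =>
      induction y with
      | zero => simp
      | add y y' hy hy' => simp only [add_mul, mul_add, map_add, hy, hy']
      | tmul c d => simp [key, hmul]
  have com3 : ∀ z : H ⊗[k] H, (comul (R := k) (A := B)).rTensor B
      (TensorProduct.map φ.toLinearMap
        φ.toLinearMap z) =
      TensorProduct.map (TensorProduct.map φ.toLinearMap
        φ.toLinearMap) φ.toLinearMap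
        ((comul (R := k) (A := H)).rTensor H z) := fun z => by
    induction z with
    | zero => simp
    | add x y hx hy => simp only [map_add, hx, hy]
    | tmul a b => simp [com]
  have ass : ∀ z : H ⊗[k] H, (TensorProduct.assoc k B B B).symm
      ((1 : B) ⊗ₜ[k] TensorProduct.map φ.toLinearMap
        φ.toLinearMap z) =
      TensorProduct.map (TensorProduct.map φ.toLinearMap
        φ.toLinearMap) φ.toLinearMap
        ((TensorProduct.assoc k H H H).symm ((1 : H) ⊗ₜ[k] z)) := fun z => by
    induction z with
    | zero => simp
    | add x y hx hy => simp only [map_add, TensorProduct.tmul_add, hx, hy]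
    | tmul a b => simp [hone]
  have one : ∀ z : H ⊗[k] H, (TensorProduct.map φ.toLinearMap
        φ.toLinearMap z) ⊗ₜ[k] (1 : B) =
      TensorProduct.map (TensorProduct.map φ.toLinearMap
        φ.toLinearMap) φ.toLinearMap
        (z ⊗ₜ[k] (1 : H)) := fun z => by simp [hone]
  have eps : ∀ (f g : B →ₗ[k] k) (f' g' : H →ₗ[k] k) (z : H ⊗[k] H),
      (∀ x, f (φ x) = f' x) → (∀ x, g (φ x) = g' x) →
      TensorProduct.map f g (TensorProduct.map φ.toLinearMap
        φ.toLinearMap z) = TensorProduct.map f' g' z :=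
      fun f g f' g' z hf hg => by
    induction z with
    | zero => simp
    | add x y hx hy => simp only [map_add, hx, hy]
    | tmul a b => simp [hf, hg]
  { comul_mul := fun a b => by
      obtain ⟨a, rfl⟩ := φ.surjective a
      obtain ⟨b, rfl⟩ := φ.surjective b
      rw [← hmul, com, com, com, WeakBialgebra.comul_mul, key]
    counit_mul_mul := fun a b c => by
      obtain ⟨a, rfl⟩ := φ.surjective a
      obtain ⟨b, rfl⟩ := φ.surjective b
      obtain ⟨c, rfl⟩ := φ.surjective c
      rw [com, eps _ _ (counit ∘ₗ LinearMap.mulRight k a) (counit ∘ₗ LinearMap.mulLeft k c)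
        _ (fun x => by simp [← hmul, cou]) (fun x => by simp [← hmul, cou]),
        ← WeakBialgebra.counit_mul_mul', ← cou, mul_assoc, hmul, hmul]
    counit_mul_mul' := fun a b c => by
      obtain ⟨a, rfl⟩ := φ.surjective a
      obtain ⟨b, rfl⟩ := φ.surjective b
      obtain ⟨c, rfl⟩ := φ.surjective c
      rw [com, eps _ _ (counit ∘ₗ LinearMap.mulLeft k c) (counit ∘ₗ LinearMap.mulRight k a)
        _ (fun x => by simp [← hmul, cou]) (fun x => by simp [← hmul, cou]),
        ← WeakBialgebra.counit_mul_mul, ← cou, mul_assoc, hmul, hmul]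
    comul_comul_one := by
      rw [← hone, com, com3, hone, ass, one, ← key3, WeakBialgebra.comul_comul_one']
    comul_comul_one' := by
      rw [← hone, com, com3, hone, ass, one, ← key3, WeakBialgebra.comul_comul_one] }

/-- The opposite weak bialgebra: opposite multiplication, same comultiplication and counit. -/
instance MulOpposite.instWeakBialgebra (k : Type*) (H : Type*) [Field k] [Ring H] [Algebra k H]
    [WeakBialgebra k H] : WeakBialgebra k Hᵐᵒᵖ :=
  WeakBialgebra.ofAntiEquiv k H Hᵐᵒᵖ (MulOpposite.opLinearEquiv k) (fun _ _ => rfl) rfl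
    (fun _ => rfl) (fun _ => rfl)

/-- The underlying type of the co-opposite `H^cop`; its algebra structure is that of `H`. -/
def CoOpposite (H : Type*) : Type _ := H

namespace CoOpposite

variable (k : Type*) (H : Type*) [Field k] [Ring H] [Algebra k H]

instance instRing : Ring (CoOpposite H) := inferInstanceAs (Ring H)

instance instAlgebra : Algebra k (CoOpposite H) := inferInstanceAs (Algebra k H)

/-- The co-opposite coalgebra: `Δ^cop(h) = h₂ ⊗ h₁`, same counit. -/
instance instCoalgebra [Coalgebra k H] : Coalgebra k (CoOpposite H) where
  comul := (TensorProduct.comm k H H).toLinearMap ∘ₗ (comul : H →ₗ[k] H ⊗[k] H)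
  counit := (counit : H →ₗ[k] k)
  coassoc := by
    refine LinearMap.ext fun x => ?_
    have flip3 : ∀ z : H ⊗[k] H, TensorProduct.assoc k H H H
        (((TensorProduct.comm k H H).toLinearMap ∘ₗ (comul : H →ₗ[k] H ⊗[k] H)).rTensor H
          (TensorProduct.comm k H H z)) =
        (TensorProduct.comm k H H).toLinearMap.lTensor H (TensorProduct.comm k (H ⊗[k] H) H
          ((TensorProduct.assoc k H H H).symm ((comul : H →ₗ[k] H ⊗[k] H).lTensor H z))) := by
      intro z
      induction z with
      | zero => simp
      | add x y hx hy => simp only [map_add, hx, hy]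
      | tmul a b =>
        simp only [TensorProduct.comm_tmul, LinearMap.rTensor_tmul, LinearMap.lTensor_tmul,
          LinearMap.comp_apply, LinearEquiv.coe_coe]
        generalize (comul : H →ₗ[k] H ⊗[k] H) b = y
        induction y with
        | zero => simp
        | add x y hx hy => simp only [map_add, TensorProduct.add_tmul, TensorProduct.tmul_add, hx, hy]
        | tmul c d => simp
    have flip3' : ∀ z : H ⊗[k] H,
        ((TensorProduct.comm k H H).toLinearMap ∘ₗ (comul : H →ₗ[k] H ⊗[k] H)).lTensor H
          (TensorProduct.comm k H H z) =
        (TensorProduct.comm k H H).toLinearMap.lTensor H (TensorProduct.comm k (H ⊗[k] H) H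
          ((comul : H →ₗ[k] H ⊗[k] H).rTensor H z)) := by
      intro z
      induction z with
      | zero => simp
      | add x y hx hy => simp only [map_add, hx, hy]
      | tmul a b => simp
    have h := Coalgebra.coassoc_symm_apply (R := k) (A := H) x
    change TensorProduct.assoc k H H H
        (((TensorProduct.comm k H H).toLinearMap ∘ₗ (comul : H →ₗ[k] H ⊗[k] H)).rTensor H
          (TensorProduct.comm k H H ((comul : H →ₗ[k] H ⊗[k] H) x))) =
        ((TensorProduct.comm k H H).toLinearMap ∘ₗ (comul : H →ₗ[k] H ⊗[k] H)).lTensor H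
          (TensorProduct.comm k H H ((comul : H →ₗ[k] H ⊗[k] H) x))
    rw [flip3, flip3', h]
  rTensor_counit_comp_comul := by
    refine LinearMap.ext fun x => ?_
    have e : ∀ z : H ⊗[k] H, (counit : H →ₗ[k] k).rTensor H (TensorProduct.comm k H H z) =
        TensorProduct.comm k H k ((counit : H →ₗ[k] k).lTensor H z) := by
      intro z
      induction z with
      | zero => simp
      | add x y hx hy => simp only [map_add, hx, hy]
      | tmul a b => simp
    change (counit : H →ₗ[k] k).rTensor H (TensorProduct.comm k H H
      ((comul : H →ₗ[k] H ⊗[k] H) x)) = (1 : k) ⊗ₜ[k] x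
    exact (e _).trans ((congrArg (TensorProduct.comm k H k)
      (Coalgebra.lTensor_counit_comul (R := k) (A := H) x)).trans (TensorProduct.comm_tmul k H k _ _))
  lTensor_counit_comp_comul := by
    refine LinearMap.ext fun x => ?_
    have e : ∀ z : H ⊗[k] H, (counit : H →ₗ[k] k).lTensor H (TensorProduct.comm k H H z) =
        TensorProduct.comm k k H ((counit : H →ₗ[k] k).rTensor H z) := by
      intro z
      induction z with
      | zero => simp
      | add x y hx hy => simp only [map_add, hx, hy]
      | tmul a b => simp
    change (counit : H →ₗ[k] k).lTensor H (TensorProduct.comm k H H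
      ((comul : H →ₗ[k] H ⊗[k] H) x)) = x ⊗ₜ[k] (1 : k)
    exact (e _).trans ((congrArg (TensorProduct.comm k k H)
      (Coalgebra.rTensor_counit_comul (R := k) (A := H) x)).trans (TensorProduct.comm_tmul k k H _ _))

/-- The co-opposite weak bialgebra. -/
instance instWeakBialgebra [WeakBialgebra k H] : WeakBialgebra k (CoOpposite H) :=
  have key : ∀ x y : H ⊗[k] H, TensorProduct.comm k H H (x * y) =
      TensorProduct.comm k H H x * TensorProduct.comm k H H y := fun x y => by
    induction x with
    | zero => simp
    | add x x' hx hx' => simp only [add_mul, map_add, hx, hx']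
    | tmul a b =>
      induction y with
      | zero => simp
      | add y y' hy hy' => simp only [mul_add, map_add, hy, hy']
      | tmul c d => simp
  have key3 : ∀ x y : H ⊗[k] (H ⊗[k] H),
      (TensorProduct.comm k H H).toLinearMap.rTensor H (TensorProduct.comm k H (H ⊗[k] H) (x * y)) =
      (TensorProduct.comm k H H).toLinearMap.rTensor H (TensorProduct.comm k H (H ⊗[k] H) x) *
      (TensorProduct.comm k H H).toLinearMap.rTensor H (TensorProduct.comm k H (H ⊗[k] H) y) :=
    fun x y => by
    induction x with
    | zero => simp
    | add x x' hx hx' => simp only [add_mul, map_add, hx, hx']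
    | tmul a b =>
      induction y with
      | zero => simp
      | add y y' hy hy' => simp only [mul_add, map_add, hy, hy']
      | tmul c d => simp [key]
  have ass : ∀ x y : (H ⊗[k] H) ⊗[k] H, TensorProduct.assoc k H H H (x * y) =
      TensorProduct.assoc k H H H x * TensorProduct.assoc k H H H y := fun x y =>
    map_mul (Algebra.TensorProduct.assoc k k k H H H) x y
  have com3 : ∀ z : H ⊗[k] H,
      ((TensorProduct.comm k H H).toLinearMap ∘ₗ (comul : H →ₗ[k] H ⊗[k] H)).rTensor H
        (TensorProduct.comm k H H z) =
      (TensorProduct.comm k H H).toLinearMap.rTensor H (TensorProduct.comm k H (H ⊗[k] H)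
        ((comul : H →ₗ[k] H ⊗[k] H).lTensor H z)) := fun z => by
    induction z with
    | zero => simp
    | add x y hx hy => simp only [map_add, hx, hy]
    | tmul a b => simp
  have l1 : ∀ z : H ⊗[k] H, (TensorProduct.comm k H H).toLinearMap.rTensor H
      (TensorProduct.comm k H (H ⊗[k] H) ((1 : H) ⊗ₜ[k] z)) =
      (TensorProduct.comm k H H z) ⊗ₜ[k] (1 : H) := fun z => by simp
  have l2 : ∀ z : H ⊗[k] H, (TensorProduct.comm k H H).toLinearMap.rTensor H
      (TensorProduct.comm k H (H ⊗[k] H) (TensorProduct.assoc k H H H (z ⊗ₜ[k] (1 : H)))) =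
      (TensorProduct.assoc k H H H).symm ((1 : H) ⊗ₜ[k] TensorProduct.comm k H H z) := fun z => by
    induction z with
    | zero => simp
    | add x y hx hy => simp only [map_add, TensorProduct.add_tmul, TensorProduct.tmul_add, hx, hy]
    | tmul a b => simp
  have eps : ∀ (f g : H →ₗ[k] k) (z : H ⊗[k] H),
      LinearMap.mul' k k (TensorProduct.map f g (TensorProduct.comm k H H z)) =
      LinearMap.mul' k k (TensorProduct.map g f z) := fun f g z => by
    induction z with
    | zero => simp
    | add x y hx hy => simp only [map_add, hx, hy]
    | tmul a b => simp [mul_comm]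
  { comul_mul := fun a b =>
      (congrArg (TensorProduct.comm k H H) (WeakBialgebra.comul_mul (k := k) (H := H) a b)).trans
        (key _ _)
    counit_mul_mul := fun a b c =>
      (WeakBialgebra.counit_mul_mul' (k := k) (H := H) a b c).trans (eps _ _ _).symm
    counit_mul_mul' := fun a b c =>
      (WeakBialgebra.counit_mul_mul (k := k) (H := H) a b c).trans (eps _ _ _).symm
    comul_comul_one := by
      have h := congrArg (TensorProduct.assoc k H H H)
        (WeakBialgebra.comul_comul_one' (k := k) (H := H))
      rw [Coalgebra.coassoc_apply, ass, LinearEquiv.apply_symm_apply] at h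
      have h' := com3 (comul (1 : H))
      rw [h, key3, l1, l2] at h'
      exact h'
    comul_comul_one' := by
      have h := congrArg (TensorProduct.assoc k H H H)
        (WeakBialgebra.comul_comul_one (k := k) (H := H))
      rw [Coalgebra.coassoc_apply, ass, LinearEquiv.apply_symm_apply] at h
      have h' := com3 (comul (1 : H))
      rw [h, key3, l1, l2] at h'
      exact h' }

end CoOpposite

/-! ### Linear coactions on graded algebras -/

section Coactions

variable {k : Type*} {A H : Type*} [Field k] [Ring A] [Algebra k A] [Ring H] [Algebra k H]
  [WeakBialgebra k H]

/-- `lam : A → H ⊗ A` makes the graded algebra `A = ⨁ 𝒜 n` a left `H`-comodule algebra, and the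
coaction is linear: each `𝒜 n` is a subcomodule. -/
structure IsLeftCoaction (𝒜 : ℕ → Submodule k A) (lam : A →ₗ[k] H ⊗[k] A) : Prop where
  coassoc : (TensorProduct.assoc k H H A).toLinearMap ∘ₗ (comul.rTensor A) ∘ₗ lam =
    (lam.lTensor H) ∘ₗ lam
  counit : (TensorProduct.lid k A).toLinearMap ∘ₗ (counit.rTensor A) ∘ₗ lam = LinearMap.id
  map_mul : ∀ a b : A, lam (a * b) = lam a * lam b
  map_one : lam 1 ∈ LinearMap.range ((sourceCounitalSub k H).subtype.rTensor A)
  linear : ∀ n, ∀ a ∈ 𝒜 n, lam a ∈ LinearMap.range ((𝒜 n).subtype.lTensor H)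

/-- `rho : A → A ⊗ H` makes the graded algebra `A = ⨁ 𝒜 n` a right `H`-comodule algebra, and the
coaction is linear: each `𝒜 n` is a subcomodule. -/
structure IsRightCoaction (𝒜 : ℕ → Submodule k A) (rho : A →ₗ[k] A ⊗[k] H) : Prop where
  coassoc : (TensorProduct.assoc k A H H).toLinearMap ∘ₗ (rho.rTensor H) ∘ₗ rho =
    (comul.lTensor A) ∘ₗ rho
  counit : (TensorProduct.rid k A).toLinearMap ∘ₗ (counit.lTensor A) ∘ₗ rho = LinearMap.id
  map_mul : ∀ a b : A, rho (a * b) = rho a * rho b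
  map_one : rho 1 ∈ LinearMap.range ((targetCounitalSub k H).subtype.lTensor A)
  linear : ∀ n, ∀ a ∈ 𝒜 n, rho a ∈ LinearMap.range ((𝒜 n).subtype.rTensor H)

/-- `𝒜 0 ≅ H_t` as left `H`-comodule algebras: an injective algebra map `ψ : 𝒜 0 → H` with
image `H_t` that satisfies `Δ ∘ ψ = (id ⊗ ψ) ∘ lam₀`, where `lam₀ : 𝒜 0 → H ⊗ 𝒜 0` is the
restriction of `lam` (`H_t` is a left comodule through `Δ`). -/
def IsLeftBasePreserving (𝒜 : ℕ → Submodule k A) [SetLike.GradedMonoid 𝒜]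
    (lam : A →ₗ[k] H ⊗[k] A) : Prop :=
  ∃ ψ : 𝒜 0 →ₐ[k] H, Function.Injective ψ ∧
    LinearMap.range ψ.toLinearMap = targetCounitalSub k H ∧
    ∀ a : 𝒜 0, ∃ y : H ⊗[k] 𝒜 0, (𝒜 0).subtype.lTensor H y = lam a ∧
      ψ.toLinearMap.lTensor H y = comul (R := k) (ψ a)

/-- `𝒜 0 ≅ H_s` as right `H`-comodule algebras. -/
def IsRightBasePreserving (𝒜 : ℕ → Submodule k A) [SetLike.GradedMonoid 𝒜]
    (rho : A →ₗ[k] A ⊗[k] H) : Prop :=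
  ∃ ψ : 𝒜 0 →ₐ[k] H, Function.Injective ψ ∧
    LinearMap.range ψ.toLinearMap = sourceCounitalSub k H ∧
    ∀ a : 𝒜 0, ∃ y : 𝒜 0 ⊗[k] H, (𝒜 0).subtype.rTensor H y = rho a ∧
      ψ.toLinearMap.rTensor H y = comul (R := k) (ψ a)

/-- The coactions `lam` and `rho` are transposed with respect to the finite families
`vec n : ι n → A` of homogeneous elements: in each degree they have the form
`lam (v j) = ∑ i, z j i ⊗ v i` and `rho (v j) = ∑ i, v i ⊗ z i j` with the same `z`.
The family is used for the classes of the paths in `kQ/I`, a spanning set in each degree. -/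
def AreTransposed {ι : ℕ → Type*} [∀ n, Fintype (ι n)] (vec : ∀ n, ι n → A)
    (lam : A →ₗ[k] H ⊗[k] A) (rho : A →ₗ[k] A ⊗[k] H) : Prop :=
  ∀ n, ∃ z : ι n → ι n → H, ∀ j,
    lam (vec n j) = ∑ i, z j i ⊗ₜ[k] vec n i ∧ rho (vec n j) = ∑ i, vec n i ⊗ₜ[k] z i j

end Coactions

/-! ### Universal quantum linear semigroupoids -/

section UQSGd

variable {k : Type u} {A : Type v} [Field k] [Ring A] [Algebra k A]
  (𝒜 : ℕ → Submodule k A) [SetLike.GradedMonoid 𝒜]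

/-- A left universal quantum linear semigroupoid of the graded algebra `A`; the universal
property is with respect to weak bialgebras in `Type x`. -/
structure LeftUQSGd where
  carrier : Type x
  [ring : Ring carrier]
  [algebra : Algebra k carrier]
  [weakBialgebra : WeakBialgebra k carrier]
  coact : A →ₗ[k] carrier ⊗[k] A
  isCoaction : IsLeftCoaction 𝒜 coact
  basePreserving : IsLeftBasePreserving 𝒜 coact
  universal : ∀ (H : Type x) [Ring H] [Algebra k H] [WeakBialgebra k H] (lam : A →ₗ[k] H ⊗[k] A),
    IsLeftCoaction 𝒜 lam → IsLeftBasePreserving 𝒜 lam →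
    ∃! π : carrier →ₐc[k] H, (π : carrier →ₗ[k] H).rTensor A ∘ₗ coact = lam

/-- A right universal quantum linear semigroupoid of the graded algebra `A`. -/
structure RightUQSGd where
  carrier : Type x
  [ring : Ring carrier]
  [algebra : Algebra k carrier]
  [weakBialgebra : WeakBialgebra k carrier]
  coact : A →ₗ[k] A ⊗[k] carrier
  isCoaction : IsRightCoaction 𝒜 coact
  basePreserving : IsRightBasePreserving 𝒜 coact
  universal : ∀ (H : Type x) [Ring H] [Algebra k H] [WeakBialgebra k H] (rho : A →ₗ[k] A ⊗[k] H),
    IsRightCoaction 𝒜 rho → IsRightBasePreserving 𝒜 rho →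
    ∃! π : carrier →ₐc[k] H, (π : carrier →ₗ[k] H).lTensor A ∘ₗ coact = rho

/-- A transposed universal quantum linear semigroupoid of the graded algebra `A`, where
transposition is taken with respect to the families `vec n` of elements of degree `n`. -/
structure TransUQSGd {ι : ℕ → Type w} [∀ n, Fintype (ι n)] (vec : ∀ n, ι n → A) where
  carrier : Type x
  [ring : Ring carrier]
  [algebra : Algebra k carrier]
  [weakBialgebra : WeakBialgebra k carrier]
  leftCoact : A →ₗ[k] carrier ⊗[k] A
  rightCoact : A →ₗ[k] A ⊗[k] carrier
  isLeftCoaction : IsLeftCoaction 𝒜 leftCoact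
  isRightCoaction : IsRightCoaction 𝒜 rightCoact
  transposed : AreTransposed vec leftCoact rightCoact
  leftBasePreserving : IsLeftBasePreserving 𝒜 leftCoact
  rightBasePreserving : IsRightBasePreserving 𝒜 rightCoact
  universal : ∀ (H : Type x) [Ring H] [Algebra k H] [WeakBialgebra k H]
    (lam : A →ₗ[k] H ⊗[k] A) (rho : A →ₗ[k] A ⊗[k] H),
    IsLeftCoaction 𝒜 lam → IsRightCoaction 𝒜 rho → AreTransposed vec lam rho →
    IsLeftBasePreserving 𝒜 lam → IsRightBasePreserving 𝒜 rho →
    ∃! π : carrier →ₐc[k] H, (π : carrier →ₗ[k] H).rTensor A ∘ₗ leftCoact = lam ∧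
      (π : carrier →ₗ[k] H).lTensor A ∘ₗ rightCoact = rho

end UQSGd

attribute [instance] LeftUQSGd.ring LeftUQSGd.algebra LeftUQSGd.weakBialgebra
  RightUQSGd.ring RightUQSGd.algebra RightUQSGd.weakBialgebra
  TransUQSGd.ring TransUQSGd.algebra TransUQSGd.weakBialgebra

/-! ### Path algebras of finite quivers -/

/-- A path of a quiver, together with its source and its target. -/
structure QuiverPath (Q : Type v) [Quiver.{w} Q] where
  src : Q
  tgt : Q
  path : Quiver.Path src tgt

namespace QuiverPath

variable {Q : Type v} [Quiver.{w} Q]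

/-- The number of arrows of a path. -/
def length (a : QuiverPath Q) : ℕ := a.path.length

/-- The trivial path at a vertex. -/
def nil (i : Q) : QuiverPath Q := ⟨i, i, Quiver.Path.nil⟩

/-- The concatenation `ab` of composable paths, read from left to right. -/
def comp (a b : QuiverPath Q) (h : a.tgt = b.src) : QuiverPath Q :=
  ⟨a.src, b.tgt, a.path.comp (b.path.cast h.symm rfl)⟩

/-- The reversed path in the opposite quiver: `(p₁ ⋯ pₗ)* = pₗ* ⋯ p₁*`. -/
def opPath {i : Q} : ∀ {j : Q}, Quiver.Path i j → Quiver.Path (Opposite.op j) (Opposite.op i)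
  | _, Quiver.Path.nil => Quiver.Path.nil
  | _, Quiver.Path.cons a p => p.op.toPath.comp (opPath a)

/-- The path `a*` of the opposite quiver, for a path `a`. -/
def star (a : QuiverPath Q) : QuiverPath Qᵒᵖ := ⟨Opposite.op a.tgt, Opposite.op a.src, opPath a.path⟩

theorem finite_length [Finite Q] [∀ i j : Q, Finite (i ⟶ j)] (n : ℕ) :
    Finite {a : QuiverPath Q // a.length = n} := by
  induction n with
  | zero =>
    refine Finite.of_surjective (fun i : Q => ⟨nil i, rfl⟩) ?_
    rintro ⟨⟨i, j, a⟩, h⟩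
    cases a with
    | nil => exact ⟨i, rfl⟩
    | cons a e => exact absurd h (Nat.succ_ne_zero _)
  | succ n ih =>
    refine Finite.of_surjective
      (fun x : (Σ a : {a : QuiverPath Q // a.length = n}, Σ j : Q, (a.1.tgt ⟶ j)) =>
        (⟨⟨x.1.1.src, x.2.1, x.1.1.path.cons x.2.2⟩, congrArg Nat.succ x.1.2⟩ :
          {a : QuiverPath Q // a.length = n + 1})) ?_
    rintro ⟨⟨i, j, a⟩, h⟩
    cases a with
    | nil => exact absurd h.symm (Nat.succ_ne_zero _)
    | cons a e => exact ⟨⟨⟨⟨i, _, a⟩, Nat.succ.inj h⟩, ⟨j, e⟩⟩, rfl⟩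

instance instFintypeLength [Finite Q] [∀ i j : Q, Finite (i ⟶ j)] (n : ℕ) :
    Fintype {a : QuiverPath Q // a.length = n} :=
  haveI := finite_length (Q := Q) n
  Fintype.ofFinite _

end QuiverPath

/-- The opposite quiver of a finite quiver is finite. -/
instance Opposite.instFintypeVertices (Q : Type v) [Fintype Q] : Fintype Qᵒᵖ :=
  Fintype.ofEquiv Q Opposite.equivToOpposite

instance Opposite.instFiniteArrows (Q : Type v) [Quiver.{w} Q] [∀ i j : Q, Finite (i ⟶ j)]
    (i j : Qᵒᵖ) : Finite (i ⟶ j) :=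
  Finite.of_equiv (j.unop ⟶ i.unop) Quiver.Hom.opEquiv

/-- The path algebra `kQ`: formal `k`-linear combinations of paths. -/
def PathAlgebra (k : Type u) (Q : Type v) [Field k] [Quiver.{w} Q] : Type (max u v w) :=
  QuiverPath Q →₀ k

namespace PathAlgebra

variable (k : Type u) (Q : Type v) [Field k] [Quiver.{w} Q]

instance instAddCommGroup : AddCommGroup (PathAlgebra k Q) :=
  inferInstanceAs (AddCommGroup (QuiverPath Q →₀ k))

instance instModule : Module k (PathAlgebra k Q) :=
  inferInstanceAs (Module k (QuiverPath Q →₀ k))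

variable {Q} in
/-- The basis element of `kQ` given by a path. -/
def ofPath (a : QuiverPath Q) : PathAlgebra k Q := Finsupp.single a 1

open Classical in
variable {Q} in
/-- The product of two paths: their concatenation if they are composable, and `0` otherwise. -/
def pathMul (a b : QuiverPath Q) : PathAlgebra k Q :=
  if h : a.tgt = b.src then ofPath k (a.comp b h) else 0

/-- The multiplication of `kQ`: the bilinear extension of the product of paths. -/
def mulMap : PathAlgebra k Q →ₗ[k] PathAlgebra k Q →ₗ[k] PathAlgebra k Q :=
  Finsupp.lift (PathAlgebra k Q →ₗ[k] PathAlgebra k Q) k (QuiverPath Q) fun a =>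
    Finsupp.lift (PathAlgebra k Q) k (QuiverPath Q) fun b => pathMul k a b

theorem mulMap_ofPath (a b : QuiverPath Q) :
    mulMap k Q (ofPath k a) (ofPath k b) = pathMul k a b := by
  have h : ∀ (M : Type (max u v w)) [AddCommGroup M] [Module k M] (f : QuiverPath Q → M) (c : QuiverPath Q),
      Finsupp.lift M k (QuiverPath Q) f (Finsupp.single c 1) = f c := fun M _ _ f c => by simp
  exact (LinearMap.congr_fun (h _ _ a) _).trans (h _ _ b)

variable {k Q} in
theorem induction_on {p : PathAlgebra k Q → Prop} (f : PathAlgebra k Q) (zero : p 0)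
    (add : ∀ f g, p f → p g → p (f + g)) (smul : ∀ (c : k) f, p f → p (c • f))
    (path : ∀ a, p (ofPath k a)) : p f :=
  Finsupp.induction_linear f zero add fun a c => by
    have h := smul c _ (path a)
    have e : c • ofPath k a = (Finsupp.single a c : QuiverPath Q →₀ k) := by
      change c • (Finsupp.single a 1 : QuiverPath Q →₀ k) = _
      simp
    rwa [e] at h

theorem mulMap_assoc (f g h : PathAlgebra k Q) :
    mulMap k Q (mulMap k Q f g) h = mulMap k Q f (mulMap k Q g h) := by
  induction f using induction_on with
  | zero => simp
  | add f f' hf hf' => simp only [map_add, LinearMap.add_apply, hf, hf']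
  | smul c f hf => simp only [map_smul, LinearMap.smul_apply, hf]
  | path a =>
  induction g using induction_on with
  | zero => simp
  | add f f' hf hf' => simp only [map_add, LinearMap.add_apply, hf, hf']
  | smul c f hf => simp only [map_smul, LinearMap.smul_apply, hf]
  | path b =>
  induction h using induction_on with
  | zero => simp
  | add f f' hf hf' => simp only [map_add, hf, hf']
  | smul c f hf => simp only [map_smul, hf]
  | path c =>
  obtain ⟨i, j, a⟩ := a
  obtain ⟨i', j', b⟩ := b
  obtain ⟨i'', j'', c⟩ := c
  rw [mulMap_ofPath, mulMap_ofPath]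
  by_cases h : j = i'
  · subst h
    by_cases h' : j' = i''
    · subst h'
      simp [pathMul, mulMap_ofPath, QuiverPath.comp, Quiver.Path.cast_rfl_rfl]
    · simp [pathMul, mulMap_ofPath, QuiverPath.comp, h']
  · by_cases h' : j' = i''
    · subst h'
      simp [pathMul, mulMap_ofPath, QuiverPath.comp, h]
    · simp [pathMul, h, h']

variable [Fintype Q]

theorem one_mulMap (f : PathAlgebra k Q) :
    mulMap k Q (∑ i : Q, ofPath k (QuiverPath.nil i)) f = f := by
  classical
  induction f using induction_on with
  | zero => simp
  | add f f' hf hf' => simp only [map_add, hf, hf']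
  | smul c f hf => simp only [map_smul, hf]
  | path a =>
  obtain ⟨i, j, a⟩ := a
  rw [map_sum, LinearMap.sum_apply, Finset.sum_eq_single i]
  · simp [mulMap_ofPath, pathMul, QuiverPath.nil, QuiverPath.comp, Quiver.Path.cast_rfl_rfl]
  · intro l _ hl
    simp [mulMap_ofPath, pathMul, QuiverPath.nil, hl]
  · simp

theorem mulMap_one (f : PathAlgebra k Q) :
    mulMap k Q f (∑ i : Q, ofPath k (QuiverPath.nil i)) = f := by
  classical
  induction f using induction_on with
  | zero => simp
  | add f f' hf hf' => simp only [map_add, LinearMap.add_apply, hf, hf']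
  | smul c f hf => simp only [map_smul, LinearMap.smul_apply, hf]
  | path a =>
  obtain ⟨i, j, a⟩ := a
  rw [map_sum, Finset.sum_eq_single j]
  · simp [mulMap_ofPath, pathMul, QuiverPath.nil, QuiverPath.comp, Quiver.Path.cast_rfl_rfl]
  · intro l _ hl
    simp [mulMap_ofPath, pathMul, QuiverPath.nil, Ne.symm hl]
  · simp

instance instRing : Ring (PathAlgebra k Q) :=
  { instAddCommGroup k Q with
    mul := fun f g => mulMap k Q f g
    one := ∑ i : Q, ofPath k (QuiverPath.nil i)
    left_distrib := fun f g h => (mulMap k Q f).map_add g h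
    right_distrib := fun f g h => by
      change mulMap k Q (f + g) h = mulMap k Q f h + mulMap k Q g h
      rw [map_add, LinearMap.add_apply]
    zero_mul := fun f => by
      change mulMap k Q 0 f = 0
      rw [map_zero, LinearMap.zero_apply]
    mul_zero := fun f => (mulMap k Q f).map_zero
    mul_assoc := mulMap_assoc k Q
    one_mul := one_mulMap k Q
    mul_one := mulMap_one k Q }

instance instAlgebra : Algebra k (PathAlgebra k Q) :=
  Algebra.ofModule
    (fun c f g => by
      change mulMap k Q (c • f) g = c • mulMap k Q f g
      rw [map_smul, LinearMap.smul_apply])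
    (fun c f g => (mulMap k Q f).map_smul c g)

variable {Q} in
/-- The component `kQ_n` of `kQ`, spanned by the paths of length `n`. -/
def grading (n : ℕ) : Submodule k (PathAlgebra k Q) :=
  Submodule.span k {f | ∃ a : QuiverPath Q, a.length = n ∧ f = ofPath k a}

variable {k Q}

theorem one_mem_grading : (1 : PathAlgebra k Q) ∈ grading (Q := Q) k 0 :=
  Submodule.sum_mem _ fun i _ => Submodule.subset_span ⟨QuiverPath.nil i, rfl, rfl⟩

theorem mul_mem_grading {m n : ℕ} {f g : PathAlgebra k Q} (hf : f ∈ grading k m)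
    (hg : g ∈ grading k n) : f * g ∈ grading k (m + n) := by
  change mulMap k Q f g ∈ grading k (m + n)
  induction hf using Submodule.span_induction with
  | zero => simp
  | add f f' _ _ hf hf' =>
    rw [map_add, LinearMap.add_apply]
    exact Submodule.add_mem _ hf hf'
  | smul c f _ hf =>
    rw [map_smul, LinearMap.smul_apply]
    exact Submodule.smul_mem _ c hf
  | mem f hf =>
  obtain ⟨a, rfl, rfl⟩ := hf
  induction hg using Submodule.span_induction with
  | zero => simp
  | add f f' _ _ hf hf' =>
    rw [map_add]
    exact Submodule.add_mem _ hf hf'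
  | smul c f _ hf =>
    rw [map_smul]
    exact Submodule.smul_mem _ c hf
  | mem f hf =>
  obtain ⟨b, rfl, rfl⟩ := hf
  rw [mulMap_ofPath]
  obtain ⟨i, j, a⟩ := a
  obtain ⟨i', j', b⟩ := b
  by_cases h : j = i'
  · subst h
    refine Submodule.subset_span ⟨⟨i, j', a.comp b⟩, ?_, ?_⟩
    · simp [QuiverPath.length]
    · simp [pathMul, QuiverPath.comp, Quiver.Path.cast_rfl_rfl]
  · simp [pathMul, h]

/-- The quotient algebra `kQ/I` by a two-sided ideal. -/
abbrev Quot (I : TwoSidedIdeal (PathAlgebra k Q)) : Type (max u v w) :=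
  PathAlgebra k Q ⧸ I.asIdeal

/-- The component of degree `n` of `kQ/I`: the image of `kQ_n`. -/
def quotGrading (I : TwoSidedIdeal (PathAlgebra k Q)) (n : ℕ) : Submodule k (Quot I) :=
  (grading k n).map (Ideal.Quotient.mkₐ k I.asIdeal).toLinearMap

instance instGradedMonoid (I : TwoSidedIdeal (PathAlgebra k Q)) :
    SetLike.GradedMonoid (quotGrading I) where
  one_mem := ⟨1, one_mem_grading, map_one (Ideal.Quotient.mkₐ k I.asIdeal)⟩
  mul_mem := by
    rintro m n _ _ ⟨f, hf, rfl⟩ ⟨g, hg, rfl⟩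
    exact ⟨f * g, mul_mem_grading hf hg, map_mul (Ideal.Quotient.mkₐ k I.asIdeal) f g⟩

/-- The classes in `kQ/I` of the paths of length `n`; these are the standard bases of vertices and
of arrows for `n = 0` and `n = 1` if `I` is generated in degree `2` or greater. -/
def quotPath (I : TwoSidedIdeal (PathAlgebra k Q)) (n : ℕ)
    (a : {a : QuiverPath Q // a.length = n}) : Quot I :=
  Ideal.Quotient.mkₐ k I.asIdeal (ofPath k a.1)

/-- `kQ/I` is quadratic: the two-sided ideal `I` is generated by elements of `kQ_2`. -/
def IsQuadratic (I : TwoSidedIdeal (PathAlgebra k Q)) : Prop :=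
  ∃ S : Set (PathAlgebra k Q), (∀ f ∈ S, f ∈ grading k 2) ∧ I = TwoSidedIdeal.span S

/-- The linear map `f ↦ f*` from `kQ` to `kQ^op` that sends a path `a` to `a*`. -/
def star : PathAlgebra k Q →ₗ[k] PathAlgebra k Qᵒᵖ :=
  Finsupp.lmapDomain k k QuiverPath.star

/-- The coefficients of an element of `kQ` in the basis of paths. -/
def coeff (f : PathAlgebra k Q) : QuiverPath Q →₀ k := f

/-- The symmetric bilinear form on `kQ` for which the paths are orthonormal. -/
def pairing (f g : PathAlgebra k Q) : k := (coeff f).sum fun a c => c * coeff g a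

/-- The ideal `I_op^⊥` of `kQ^op`, generated by the orthogonal complement in `kQ^op_2` of
`{f* | f ∈ I ∩ kQ_2}`. -/
def dualIdeal (I : TwoSidedIdeal (PathAlgebra k Q)) : TwoSidedIdeal (PathAlgebra k Qᵒᵖ) :=
  TwoSidedIdeal.span {g | g ∈ grading k 2 ∧ ∀ f ∈ I, f ∈ grading k 2 → pairing g (star f) = 0}

/-- The left UQSGds `O^left(kQ/I)`. -/
abbrev OLeft (I : TwoSidedIdeal (PathAlgebra k Q)) :=
  LeftUQSGd.{u, max u v w, max u v w} (quotGrading I)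

/-- The right UQSGds `O^right(kQ/I)`. -/
abbrev ORight (I : TwoSidedIdeal (PathAlgebra k Q)) :=
  RightUQSGd.{u, max u v w, max u v w} (quotGrading I)

/-- The transposed UQSGds `O^trans(kQ/I)`; transposition is with respect to the classes of
the paths. -/
abbrev OTrans [∀ i j : Q, Finite (i ⟶ j)] (I : TwoSidedIdeal (PathAlgebra k Q)) :=
  TransUQSGd.{u, max u v w, max v w, max u v w} (quotGrading I) (quotPath I)

end PathAlgebra

end

/-! Let `X` be the space of coefficient vectors of the degree 2 part of `I`. A base preserving
linear left coaction of `H` on `kQ/I` amounts to a matrix over `H`, indexed by pairs of vertices and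
pairs of arrows, with three properties. Its entries form a representation of the product quiver `Q ×
Q` whose idempotents sum to `1`. They satisfy `Δ(x_{a,b}) = ∑ x_{a,c} ⊗ x_{c,b}` and `ε(x_{a,b}) =
δ_{a,b}` (`PathRep.IsCorep`). The induced matrix on paths of length 2 maps `X` to itself, that is,
`∑ f_a g_b x_{a,b} = 0` for `f ∈ X` and `g ∈ X^⊥` (`PathRep.Compatible`). Hence `O^left(kQ/I)` is
the path algebra of `Q × Q` modulo these last relations, `UnivMat {X}`.

Everything else is symmetry. Transposing the matrix reverses `Δ` and exchanges `X` with `X^⊥`: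
`UnivMat {X} ≅ UnivMat {X^⊥}^cop` (`copEquiv`). Reversing paths reverses the product: `UnivMat {X} ≅
UnivMat {X*}^op` (`mopEquiv`). A right coaction of `H` is a left coaction of `H^cop`, so
`O^right(kQ/I) = UnivMat {X}^cop`; a transposed pair is a single matrix compatible with both `X` and
`X^⊥`, so `O^trans(kQ/I) = UnivMat {X, X^⊥}`. The quadratic part of the dual ideal is `(X*)^⊥`
(`quadPart_dualIdeal`), and the four isomorphisms are compositions of these.

Two points need work. The first is that `UnivMat S` is a weak bialgebra. Its comultiplication is
well defined by `Compatible.comp`, which rests on the linear algebra of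
`Submodule.sum_tmul_eq_zero`. Its counit is not multiplicative, but it is the sum of the entries of
a homomorphism `diag` to matrices, `x_{a,b} ↦ δ_{a,b} E_{s(a),t(a)}`, and the weak counit axiom
becomes an identity for matrix units.

The second is that the degree 0 coefficients of an arbitrary base preserving coaction are orthogonal
idempotents. Let `t_i` be the image of the vertex `i` in `H_t`, and write `Δ(t_i) = ∑ z_{ij} ⊗ t_j`,
so that `Δ(1) = ∑ c_j ⊗ t_j` with the column sums `c_j`. The two formulas for `Δ²(1)` give `z_{lj} =
t_l c_j = c_j t_l`, and `Δ(1)² = Δ(1)` gives `c_j² = c_j`. Finally, the two weak counit formulas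
force `c_j c_l = 0` for `j ≠ l` (`IsBaseMatrix.col_mul_of_ne`). -/

noncomputable section

/-! ### Multiplicative linear maps -/

section Multiplicative

variable {k : Type*} [Field k]

/-- A linear map between algebras that respects products, but not necessarily the units. -/
def LinearMap.IsMultiplicative {A B : Type*} [Ring A] [Algebra k A] [Ring B] [Algebra k B]
    (f : A →ₗ[k] B) : Prop :=
  ∀ x y, f (x * y) = f x * f y

namespace LinearMap.IsMultiplicative

variable {A B C D : Type*} [Ring A] [Algebra k A] [Ring B] [Algebra k B] [Ring C] [Algebra k C]
  [Ring D] [Algebra k D]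

theorem id : (LinearMap.id : A →ₗ[k] A).IsMultiplicative := fun _ _ => rfl

theorem comp {g : B →ₗ[k] C} {f : A →ₗ[k] B} (hg : g.IsMultiplicative)
    (hf : f.IsMultiplicative) : (g ∘ₗ f).IsMultiplicative := fun x y => by
  rw [LinearMap.comp_apply, hf, hg]; rfl

theorem map {f : A →ₗ[k] B} {g : C →ₗ[k] D} (hf : f.IsMultiplicative)
    (hg : g.IsMultiplicative) : (TensorProduct.map f g).IsMultiplicative := fun x y => by
  induction x with
  | zero => simp
  | add x x' hx hx' => simp only [add_mul, map_add, hx, hx']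
  | tmul a b =>
    induction y with
    | zero => simp
    | add y y' hy hy' => simp only [mul_add, map_add, hy, hy']
    | tmul c d => simp [hf a c, hg b d]

theorem of_algHom (f : A →ₐ[k] B) : f.toLinearMap.IsMultiplicative := map_mul f

theorem comm : (TensorProduct.comm k A B).toLinearMap.IsMultiplicative := fun x y =>
  map_mul (Algebra.TensorProduct.comm k A B) x y

theorem assoc : (TensorProduct.assoc k A B C).toLinearMap.IsMultiplicative := fun x y =>
  map_mul (Algebra.TensorProduct.assoc k k k A B C) x y

/-- The zeros of a multiplicative map form a two-sided ideal, even if the map is not unital. This is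
how all relations are checked on generators only. -/
theorem eq_zero_of_mem_span {f : A →ₗ[k] B} (hf : f.IsMultiplicative) {S : Set A}
    (hS : ∀ x ∈ S, f x = 0) {x : A} (hx : x ∈ TwoSidedIdeal.span S) : f x = 0 := by
  let J : TwoSidedIdeal A := TwoSidedIdeal.mk' {x | f x = 0} (map_zero f)
    (fun {x y} hx hy => by simp_all) (fun {x} hx => by simp_all)
    (fun {x y} hy => by
      have hy : f y = 0 := hy
      simp [hf x y, hy])
    (fun {x y} hx => by
      have hx : f x = 0 := hx
      simp [hf x y, hx])
  have hJ : x ∈ J := TwoSidedIdeal.mem_span_iff.1 hx J fun y hy =>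
    by simpa only [J, SetLike.mem_coe, TwoSidedIdeal.mem_mk', Set.mem_ofPred_eq] using hS y hy
  have h0 : x ∈ {x | f x = 0} := by simpa only [J, TwoSidedIdeal.mem_mk'] using hJ
  exact h0

end LinearMap.IsMultiplicative

/-- The linear map induced on the quotient of an algebra by a two-sided ideal. -/
theorem TwoSidedIdeal.exists_lift {A N : Type*} [Ring A] [Algebra k A] [AddCommGroup N]
    [Module k N] (I : TwoSidedIdeal A) (f : A →ₗ[k] N) (hf : ∀ x ∈ I, f x = 0) :
    ∃ g : (A ⧸ I.asIdeal) →ₗ[k] N, ∀ x, g (Ideal.Quotient.mkₐ k I.asIdeal x) = f x := by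
  -- The lift is `f` after a linear section `s` of the quotient map; the choice of `s` is irrelevant
  -- because `f` vanishes on `I`.
  obtain ⟨s, hs⟩ := (Ideal.Quotient.mkₐ k I.asIdeal).toLinearMap.exists_rightInverse_of_surjective
    (LinearMap.range_eq_top.2 (Ideal.Quotient.mkₐ_surjective k I.asIdeal))
  refine ⟨f ∘ₗ s, fun x => ?_⟩
  have h : s (Ideal.Quotient.mkₐ k I.asIdeal x) - x ∈ I.asIdeal := by
    rw [← Ideal.Quotient.eq]
    exact LinearMap.congr_fun hs (Ideal.Quotient.mkₐ k I.asIdeal x)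
  have := hf _ (TwoSidedIdeal.mem_asIdeal.1 h)
  rw [map_sub, sub_eq_zero] at this
  exact this

/-- The linear map induced on the quotient of an algebra by a two-sided ideal. -/
def TwoSidedIdeal.liftₗ {A N : Type*} [Ring A] [Algebra k A] [AddCommGroup N]
    [Module k N] (I : TwoSidedIdeal A) (f : A →ₗ[k] N) (hf : ∀ x ∈ I, f x = 0) :
    (A ⧸ I.asIdeal) →ₗ[k] N :=
  (I.exists_lift f hf).choose

theorem TwoSidedIdeal.liftₗ_mk {A N : Type*} [Ring A] [Algebra k A] [AddCommGroup N]
    [Module k N] (I : TwoSidedIdeal A) (f : A →ₗ[k] N) (hf : ∀ x ∈ I, f x = 0) (x : A) :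
    I.liftₗ f hf (Ideal.Quotient.mkₐ k I.asIdeal x) = f x :=
  (I.exists_lift f hf).choose_spec x

theorem TwoSidedIdeal.liftₗ_isMultiplicative {A B : Type*} [Ring A] [Algebra k A] [Ring B]
    [Algebra k B] (I : TwoSidedIdeal A) (f : A →ₗ[k] B) (hf : ∀ x ∈ I, f x = 0)
    (hmul : f.IsMultiplicative) : (I.liftₗ f hf).IsMultiplicative := fun x y => by
  obtain ⟨x, rfl⟩ := Ideal.Quotient.mkₐ_surjective k I.asIdeal x
  obtain ⟨y, rfl⟩ := Ideal.Quotient.mkₐ_surjective k I.asIdeal y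
  rw [← map_mul, liftₗ_mk, liftₗ_mk, liftₗ_mk, hmul x y]

end Multiplicative

/-! ### Annihilators of subspaces of `ι → k` -/

section Annihilator

variable {k : Type*} [Field k] {ι : Type*} [Fintype ι]

/-- The orthogonal complement of a subspace of `ι → k` for the dot product. -/
def Submodule.dotPerp (X : Submodule k (ι → k)) : Submodule k (ι → k) where
  carrier := {g | ∀ f ∈ X, ∑ a, f a * g a = 0}
  zero_mem' := by simp
  add_mem' {g h} hg hh f hf := by
    simp [mul_add, Finset.sum_add_distrib, hg f hf, hh f hf]
  smul_mem' c g hg f hf := by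
    have := hg f hf
    simp only [Pi.smul_apply, smul_eq_mul, mul_left_comm _ c, ← Finset.mul_sum, this, mul_zero]

/-- If `y` is annihilated by the orthogonal complement of `X` and `T` vanishes on `X`, then
`∑ a, y a ⊗ T a` vanishes. -/
theorem Submodule.sum_tmul_eq_zero (X : Submodule k (ι → k)) {M N : Type*} [AddCommGroup M]
    [Module k M] [AddCommGroup N] [Module k N] (y : ι → M) (T : ι → N)
    (hy : ∀ g ∈ X.dotPerp, ∑ a, g a • y a = 0) (hT : ∀ f ∈ X, ∑ a, f a • T a = 0) :
    ∑ a, y a ⊗ₜ[k] T a = 0 := by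
  classical
  -- `P` is the projection onto a complement `W` along `X`. As `T` vanishes on `X`, each `T a` can
  -- be rewritten through the coordinates of `P e_a`.
  obtain ⟨W, hW⟩ := X.exists_isCompl
  let P : (ι → k) →ₗ[k] (ι → k) := W.subtype ∘ₗ W.projectionOnto X hW.symm
  have hP : ∀ v, v - P v ∈ X := fun v => by
    rw [← Submodule.projectionOnto_apply_eq_zero_iff hW.symm, map_sub, sub_eq_zero]
    exact (Submodule.projectionOnto_apply_left hW.symm _).symm
  have hPX : ∀ v ∈ X, P v = 0 := fun v hv => by
    simp [P, (Submodule.projectionOnto_apply_eq_zero_iff hW.symm).2 hv]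
  have hPf : ∀ (f : ι → k) (b : ι), P f b = ∑ a, f a * P (Pi.single a 1) b := fun f b => by
    conv_lhs => rw [← Finset.univ_sum_single f]
    simp only [map_sum, Finset.sum_apply]
    refine Finset.sum_congr rfl fun a _ => ?_
    rw [show Pi.single a (f a) = f a • (Pi.single a 1 : ι → k) by
      rw [← Pi.single_smul, smul_eq_mul, mul_one], map_smul, Pi.smul_apply, smul_eq_mul]
  have hT' : ∀ a, T a = ∑ b, P (Pi.single a 1) b • T b := fun a => by
    have := hT _ (hP (Pi.single a 1))
    simpa [sub_smul, Finset.sum_sub_distrib, sub_eq_zero, Pi.single_apply] using this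
  calc ∑ a, y a ⊗ₜ[k] T a = ∑ a, ∑ b, (P (Pi.single a 1) b • y a) ⊗ₜ[k] T b := by
        refine Finset.sum_congr rfl fun a _ => ?_
        conv_lhs => rw [hT' a, TensorProduct.tmul_sum]
        simp [TensorProduct.smul_tmul]
    _ = ∑ b, (∑ a, P (Pi.single a 1) b • y a) ⊗ₜ[k] T b := by
        rw [Finset.sum_comm]
        simp [TensorProduct.sum_tmul]
    -- For fixed `b` the vector `a ↦ (P e_a)_b` is orthogonal to `X`, because its dot product with
    -- `f ∈ X` is `(P f)_b = 0`. So `y` is annihilated by it.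
    _ = 0 := Finset.sum_eq_zero fun b _ => by
        rw [hy (fun a => P (Pi.single a 1) b) (fun f hf => by
          rw [← hPf, hPX f hf]; rfl), TensorProduct.zero_tmul]

/-- No dimension count is needed: for `g` in the double complement, the preceding theorem with `y =
g` and `T a` the class of `e_a` modulo `X` says that `g` is `0` modulo `X`. -/
theorem Submodule.dotPerp_dotPerp (X : Submodule k (ι → k)) : X.dotPerp.dotPerp = X := by
  classical
  refine le_antisymm (fun g hg => ?_) fun f hf g hg => by
    simpa [mul_comm] using hg f hf
  have h := X.sum_tmul_eq_zero (M := k) (N := (ι → k) ⧸ X) g (fun a => X.mkQ (Pi.single a 1))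
    (fun f hf => hg f hf) (fun f hf => by
      simp only [← map_smul, ← map_sum]
      have : ∑ a, f a • (Pi.single a 1 : ι → k) = f := by
        ext b; simp [Pi.single_apply]
      rw [this]
      exact (Submodule.Quotient.mk_eq_zero X).2 hf)
  have h2 := congrArg (TensorProduct.lid k _) h
  simp only [map_sum, TensorProduct.lid_tmul, ← map_smul, map_zero] at h2
  rw [← map_sum] at h2
  have : ∑ a, g a • (Pi.single a 1 : ι → k) = g := by
    ext b; simp [Pi.single_apply]
  rw [this] at h2
  exact (Submodule.Quotient.mk_eq_zero X).1 h2

end Annihilator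

/-! ### Representations of path algebras -/

/-- An arrow of a quiver, together with its source and its target. -/
structure QuiverArrow (Q : Type v) [Quiver.{w} Q] where
  src : Q
  tgt : Q
  hom : src ⟶ tgt

/-- Orthogonal idempotents indexed by the vertices of a quiver and elements indexed by its arrows
that are compatible with them: a homomorphism of rings, not necessarily unital, from the path ring
to `B`. -/
@[ext]
structure PathRep (Q : Type v) [Quiver.{w} Q] (B : Type x) [Ring B] where
  vert : Q → B
  arr : QuiverArrow Q → B
  vert_mul_self : ∀ i, vert i * vert i = vert i
  vert_mul_of_ne : ∀ i j, i ≠ j → vert i * vert j = 0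
  src_mul : ∀ p, vert p.src * arr p = arr p
  mul_tgt : ∀ p, arr p * vert p.tgt = arr p

namespace PathRep

section

variable {Q : Type v} [Quiver.{w} Q] {B : Type x} [Ring B] (D : PathRep Q B)

theorem vert_mul_arr_of_ne {i : Q} {p : QuiverArrow Q} (h : i ≠ p.src) :
    D.vert i * D.arr p = 0 := by
  rw [← D.src_mul, ← mul_assoc, D.vert_mul_of_ne _ _ h, zero_mul]

theorem arr_mul_vert_of_ne {i : Q} {p : QuiverArrow Q} (h : p.tgt ≠ i) :
    D.arr p * D.vert i = 0 := by
  rw [← D.mul_tgt, mul_assoc, D.vert_mul_of_ne _ _ h, mul_zero]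

/-- The value of a representation on a path. -/
def eval {i : Q} : ∀ {j : Q}, Quiver.Path i j → B
  | _, Quiver.Path.nil => D.vert i
  | _, Quiver.Path.cons a p => eval a * D.arr ⟨_, _, p⟩

@[simp]
theorem eval_nil (i : Q) : D.eval (Quiver.Path.nil : Quiver.Path i i) = D.vert i := rfl

@[simp]
theorem eval_cons {i j l : Q} (a : Quiver.Path i j) (p : j ⟶ l) :
    D.eval (a.cons p) = D.eval a * D.arr ⟨j, l, p⟩ := rfl

theorem eval_toPath {i j : Q} (p : i ⟶ j) : D.eval p.toPath = D.arr ⟨i, j, p⟩ :=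
  D.src_mul ⟨i, j, p⟩

theorem src_mul_eval {i j : Q} (a : Quiver.Path i j) : D.vert i * D.eval a = D.eval a := by
  induction a with
  | nil => exact D.vert_mul_self i
  | cons a p ih => rw [eval_cons, ← mul_assoc, ih]

theorem eval_mul_tgt {i j : Q} (a : Quiver.Path i j) : D.eval a * D.vert j = D.eval a := by
  cases a with
  | nil => exact D.vert_mul_self i
  | cons a p => rw [eval_cons, mul_assoc, D.mul_tgt]

theorem eval_comp {i j l : Q} (a : Quiver.Path i j) (b : Quiver.Path j l) :
    D.eval (a.comp b) = D.eval a * D.eval b := by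
  induction b with
  | nil => exact (D.eval_mul_tgt a).symm
  | cons b p ih => rw [Quiver.Path.comp_cons, eval_cons, eval_cons, ih, mul_assoc]

theorem eval_mul_arr_of_ne {i j : Q} (a : Quiver.Path i j) {p : QuiverArrow Q} (h : j ≠ p.src) :
    D.eval a * D.arr p = 0 := by
  rw [← D.eval_mul_tgt, mul_assoc, D.vert_mul_arr_of_ne h, mul_zero]

theorem vert_mul_eval_of_ne {i j l : Q} (a : Quiver.Path i j) (h : l ≠ i) :
    D.vert l * D.eval a = 0 := by
  rw [← D.src_mul_eval, ← mul_assoc, D.vert_mul_of_ne _ _ h, zero_mul]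

theorem eval_mul_eval_of_ne {i j i' j' : Q} (a : Quiver.Path i j) (b : Quiver.Path i' j')
    (h : j ≠ i') : D.eval a * D.eval b = 0 := by
  rw [← D.eval_mul_tgt, mul_assoc, D.vert_mul_eval_of_ne b h, mul_zero]

/-- The idempotents of a representation are idempotents with sum `1`. -/
def IsUnital [Fintype Q] : Prop := ∑ i, D.vert i = 1

end

variable {k : Type u} [Field k] {Q : Type v} [Quiver.{w} Q] {B C : Type*} [Ring B] [Algebra k B]
  [Ring C] [Algebra k C]

/-- The image of a representation under a multiplicative linear map. -/
@[simps]
def map (D : PathRep Q B) (f : B →ₗ[k] C) (hf : f.IsMultiplicative) : PathRep Q C where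
  vert i := f (D.vert i)
  arr p := f (D.arr p)
  vert_mul_self i := by rw [← hf, D.vert_mul_self]
  vert_mul_of_ne i j h := by rw [← hf, D.vert_mul_of_ne i j h, map_zero]
  src_mul p := by rw [← hf, D.src_mul]
  mul_tgt p := by rw [← hf, D.mul_tgt]

theorem eval_map (D : PathRep Q B) (f : B →ₗ[k] C) (hf : f.IsMultiplicative) {i j : Q}
    (a : Quiver.Path i j) : (D.map f hf).eval a = f (D.eval a) := by
  induction a with
  | nil => rfl
  | cons a p ih => rw [eval_cons, ih, eval_cons, hf]; rfl

/-- The linear extension of a representation to the path algebra. -/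
def lift (D : PathRep Q B) : PathAlgebra k Q →ₗ[k] B :=
  Finsupp.lift B k (QuiverPath Q) fun a => D.eval a.path

theorem lift_ofPath (D : PathRep Q B) (a : QuiverPath Q) :
    D.lift (PathAlgebra.ofPath k a) = D.eval a.path := by
  have h : ∀ (f : QuiverPath Q → B) (c : QuiverPath Q),
      Finsupp.lift B k (QuiverPath Q) f (Finsupp.single c 1) = f c := fun f c => by simp
  exact h _ a

end PathRep

namespace PathAlgebra

variable {k : Type u} [Field k] {Q : Type v} [Quiver.{w} Q] [Fintype Q]

theorem ofPath_mul_ofPath {i j l : Q} (a : Quiver.Path i j) (b : Quiver.Path j l) :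
    ofPath k ⟨i, j, a⟩ * ofPath k ⟨j, l, b⟩ = ofPath k ⟨i, l, a.comp b⟩ := by
  change mulMap k Q _ _ = _
  rw [mulMap_ofPath]
  simp [pathMul, QuiverPath.comp, Quiver.Path.cast_rfl_rfl]

theorem ofPath_mul_of_ne {a b : QuiverPath Q} (h : a.tgt ≠ b.src) :
    ofPath k a * ofPath k b = 0 := by
  change mulMap k Q _ _ = _
  rw [mulMap_ofPath, pathMul, dif_neg h]

theorem one_eq_sum : (1 : PathAlgebra k Q) = ∑ i : Q, ofPath k (QuiverPath.nil i) := rfl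

theorem linearMap_ext {N : Type*} [AddCommGroup N] [Module k N] {f g : PathAlgebra k Q →ₗ[k] N}
    (h : ∀ a, f (ofPath k a) = g (ofPath k a)) : f = g :=
  LinearMap.ext fun x => by
    induction x using induction_on with
    | zero => simp
    | add x y hx hy => simp [hx, hy]
    | smul c x hx => simp [hx]
    | path a => exact h a

variable (k Q) in
/-- The tautological representation of a quiver in its path algebra. -/
@[simps]
def rep : PathRep Q (PathAlgebra k Q) where
  vert i := ofPath k (QuiverPath.nil i)
  arr p := ofPath k ⟨p.src, p.tgt, p.hom.toPath⟩
  vert_mul_self i := ofPath_mul_ofPath _ _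
  vert_mul_of_ne i j h := ofPath_mul_of_ne h
  src_mul p := (ofPath_mul_ofPath _ _).trans (by rw [Quiver.Path.nil_comp])
  mul_tgt p := ofPath_mul_ofPath _ _

theorem eval_rep {i j : Q} (a : Quiver.Path i j) : (rep k Q).eval a = ofPath k ⟨i, j, a⟩ := by
  induction a with
  | nil => rfl
  | cons a p ih => rw [PathRep.eval_cons, ih, rep_arr, ofPath_mul_ofPath]; rfl

variable {B : Type*} [Ring B] [Algebra k B]

theorem lift_isMultiplicative (D : PathRep Q B) :
    (D.lift : PathAlgebra k Q →ₗ[k] B).IsMultiplicative := fun x y => by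
  induction x using induction_on with
  | zero => simp
  | add x x' hx hx' => simp only [add_mul, map_add, hx, hx']
  | smul c x hx => simp only [smul_mul_assoc, map_smul, hx]
  | path a =>
  induction y using induction_on with
  | zero => simp
  | add x x' hx hx' => simp only [mul_add, map_add, hx, hx']
  | smul c x hx => simp only [mul_smul_comm, map_smul, hx]
  | path b =>
  obtain ⟨i, j, a⟩ := a
  obtain ⟨i', j', b⟩ := b
  rw [PathRep.lift_ofPath, PathRep.lift_ofPath]
  by_cases h : j = i'
  · subst h
    rw [ofPath_mul_ofPath, PathRep.lift_ofPath, PathRep.eval_comp]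
  · rw [ofPath_mul_of_ne h, map_zero, D.eval_mul_eval_of_ne _ _ h]

theorem lift_one {D : PathRep Q B} (hD : D.IsUnital) : D.lift (1 : PathAlgebra k Q) = 1 := by
  rw [one_eq_sum, map_sum, ← hD]
  exact Finset.sum_congr rfl fun i _ => D.lift_ofPath _

end PathAlgebra

/-! ### Sums over paths of fixed length -/

namespace QuiverArrow

variable {Q : Type v} [Quiver.{w} Q]

instance instFinite [Finite Q] [∀ i j : Q, Finite (i ⟶ j)] : Finite (QuiverArrow Q) :=
  Finite.of_surjective (fun x : Σ i j : Q, (i ⟶ j) => ⟨x.1, x.2.1, x.2.2⟩)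
    fun p => ⟨⟨p.src, p.tgt, p.hom⟩, rfl⟩

instance instFintype [Finite Q] [∀ i j : Q, Finite (i ⟶ j)] : Fintype (QuiverArrow Q) :=
  Fintype.ofFinite _

/-- An arrow as a path of length `1`. -/
def toPath (p : QuiverArrow Q) : QuiverPath Q := ⟨p.src, p.tgt, p.hom.toPath⟩

theorem length_toPath (p : QuiverArrow Q) : p.toPath.length = 1 := rfl

end QuiverArrow

namespace QuiverPath

variable {Q : Type v} [Quiver.{w} Q]

variable (Q) in
/-- The paths of length `n`. -/
abbrev OfLength (n : ℕ) := {a : QuiverPath Q // a.length = n}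

/-- The trivial paths are the paths of length `0`. -/
def nilEquiv : Q ≃ OfLength Q 0 where
  toFun i := ⟨nil i, rfl⟩
  invFun a := a.1.src
  left_inv _ := rfl
  right_inv := by
    rintro ⟨⟨i, j, a⟩, h⟩
    cases a with
    | nil => rfl
    | cons a p => exact absurd h (Nat.succ_ne_zero _)

/-- The arrows are the paths of length `1`. -/
def arrowEquiv : QuiverArrow Q ≃ OfLength Q 1 :=
  Equiv.ofBijective (fun p => ⟨p.toPath, p.length_toPath⟩) <| by
    constructor
    · rintro ⟨i, j, p⟩ ⟨i', j', p'⟩ h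
      simp only [Subtype.mk.injEq, QuiverArrow.toPath, QuiverPath.mk.injEq] at h
      obtain ⟨rfl, rfl, h⟩ := h
      cases h
      rfl
    · rintro ⟨⟨i, j, a⟩, h⟩
      cases a with
      | nil => exact absurd h.symm (Nat.succ_ne_zero _)
      | cons a p =>
        cases a with
        | nil => exact ⟨⟨_, _, p⟩, rfl⟩
        | cons a q => exact absurd (Nat.succ.inj h) (Nat.succ_ne_zero _)

/-- Splitting off the last arrow of a path. -/
def splitLast {n : ℕ} : OfLength Q (n + 1) → OfLength Q n × QuiverArrow Q
  | ⟨⟨i, _, Quiver.Path.cons a p⟩, h⟩ => ⟨⟨⟨i, _, a⟩, Nat.succ.inj h⟩, ⟨_, _, p⟩⟩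

theorem splitLast_injective {n : ℕ} :
    Function.Injective (splitLast : OfLength Q (n + 1) → OfLength Q n × QuiverArrow Q) := by
  rintro ⟨⟨i, j, a⟩, h⟩ ⟨⟨i', j', a'⟩, h'⟩ e
  cases a with
  | nil => exact absurd h.symm (Nat.succ_ne_zero _)
  | cons a p =>
  cases a' with
  | nil => exact absurd h'.symm (Nat.succ_ne_zero _)
  | cons a' p' =>
  simp only [splitLast, Prod.mk.injEq, Subtype.mk.injEq, QuiverPath.mk.injEq,
    QuiverArrow.mk.injEq] at e
  obtain ⟨⟨rfl, rfl, e⟩, -, rfl, e'⟩ := e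
  cases e
  cases e'
  rfl

theorem mem_range_splitLast {n : ℕ} {x : OfLength Q n × QuiverArrow Q}
    (h : x.1.1.tgt = x.2.src) : x ∈ Set.range (splitLast (Q := Q) (n := n)) := by
  obtain ⟨⟨⟨i, j, a⟩, ha⟩, ⟨i', j', p⟩⟩ := x
  obtain rfl : j = i' := h
  exact ⟨⟨⟨i, _, a.cons p⟩, congrArg Nat.succ ha⟩, rfl⟩

variable [Fintype Q] [∀ i j : Q, Finite (i ⟶ j)] {M : Type*} [AddCommMonoid M]

theorem sum_zero (F : QuiverPath Q → M) : ∑ a : OfLength Q 0, F a.1 = ∑ i, F (nil i) :=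
  (Fintype.sum_equiv nilEquiv (fun i => F (nil i)) (fun a => F a.1) fun _ => rfl).symm

/-- Splitting off the last arrow embeds the paths of length `n + 1` into pairs of a path and an
arrow; the pairs outside the image are not composable and contribute `0`. It drives the inductions
for products of sums over paths. -/
theorem sum_succ (n : ℕ) (F : QuiverPath Q → M) (G : QuiverPath Q → QuiverArrow Q → M)
    (hG : ∀ a p, a.tgt ≠ p.src → G a p = 0)
    (hFG : ∀ (i j l : Q) (a : Quiver.Path i j) (p : j ⟶ l),
      F ⟨i, l, a.cons p⟩ = G ⟨i, j, a⟩ ⟨j, l, p⟩) :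
    ∑ a : OfLength Q (n + 1), F a.1 = ∑ a : OfLength Q n, ∑ p, G a.1 p := by
  rw [← Fintype.sum_prod_type']
  refine Fintype.sum_of_injective splitLast splitLast_injective _
    (fun x : OfLength Q n × QuiverArrow Q => G x.1.1 x.2) (fun x hx => ?_) fun a => ?_
  · exact hG _ _ fun h => hx (mem_range_splitLast h)
  · obtain ⟨⟨i, j, a⟩, h⟩ := a
    cases a with
    | nil => exact absurd h.symm (Nat.succ_ne_zero _)
    | cons a p => exact hFG _ _ _ a p

end QuiverPath

/-! ### Matrix representations: representations of the product of a quiver with itself -/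

/-- The vertices of the product of a quiver with itself. -/
@[ext]
structure SquareVertex (Q : Type v) where
  fst : Q
  snd : Q

namespace SquareVertex

instance instFintype (Q : Type v) [Fintype Q] : Fintype (SquareVertex Q) :=
  Fintype.ofEquiv (Q × Q) ⟨fun x => ⟨x.1, x.2⟩, fun x => ⟨x.1, x.2⟩, fun _ => rfl, fun _ => rfl⟩

theorem sum_eq {Q : Type v} [Fintype Q] {M : Type*} [AddCommMonoid M] (F : SquareVertex Q → M) :
    ∑ x, F x = ∑ i, ∑ j, F ⟨i, j⟩ := by
  rw [← Fintype.sum_prod_type']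
  exact Fintype.sum_equiv ⟨fun x => (x.1, x.2), fun x => ⟨x.1, x.2⟩, fun _ => rfl, fun _ => rfl⟩
    _ _ fun _ => rfl

variable {Q : Type v} [Quiver.{w} Q]

/-- The product of a quiver with itself. -/
instance instQuiver : Quiver.{w} (SquareVertex Q) where
  Hom x y := (x.fst ⟶ y.fst) × (x.snd ⟶ y.snd)

end SquareVertex

namespace QuiverArrow

variable {Q : Type v} [Quiver.{w} Q]

/-- The arrow of the product quiver given by a pair of arrows. -/
def pair (p q : QuiverArrow Q) : QuiverArrow (SquareVertex Q) :=
  ⟨⟨p.src, q.src⟩, ⟨p.tgt, q.tgt⟩, (p.hom, q.hom)⟩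

/-- The first component of an arrow of the product quiver. -/
def fst (p : QuiverArrow (SquareVertex Q)) : QuiverArrow Q := ⟨p.src.fst, p.tgt.fst, p.hom.1⟩

/-- The second component of an arrow of the product quiver. -/
def snd (p : QuiverArrow (SquareVertex Q)) : QuiverArrow Q := ⟨p.src.snd, p.tgt.snd, p.hom.2⟩

@[simp] theorem fst_src (p : QuiverArrow (SquareVertex Q)) : p.fst.src = p.src.fst := rfl
@[simp] theorem fst_tgt (p : QuiverArrow (SquareVertex Q)) : p.fst.tgt = p.tgt.fst := rfl
@[simp] theorem snd_src (p : QuiverArrow (SquareVertex Q)) : p.snd.src = p.src.snd := rfl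
@[simp] theorem snd_tgt (p : QuiverArrow (SquareVertex Q)) : p.snd.tgt = p.tgt.snd := rfl
@[simp] theorem pair_src (p q : QuiverArrow Q) : (p.pair q).src = ⟨p.src, q.src⟩ := rfl
@[simp] theorem pair_tgt (p q : QuiverArrow Q) : (p.pair q).tgt = ⟨p.tgt, q.tgt⟩ := rfl
@[simp] theorem pair_fst (p q : QuiverArrow Q) : (p.pair q).fst = p := rfl
@[simp] theorem pair_snd (p q : QuiverArrow Q) : (p.pair q).snd = q := rfl
@[simp] theorem pair_fst_snd (p : QuiverArrow (SquareVertex Q)) : p.fst.pair p.snd = p := rfl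

end QuiverArrow

namespace PathRep

section Ite

variable {Q : Type v} [Quiver.{w} Q] {B : Type x} [Ring B] (D : PathRep Q B)

open Classical in
theorem vert_mul_vert (i j : Q) : D.vert i * D.vert j = if i = j then D.vert i else 0 := by
  split_ifs with h
  · rw [← h, D.vert_mul_self]
  · exact D.vert_mul_of_ne i j h

open Classical in
theorem vert_mul_arr (i : Q) (p : QuiverArrow Q) :
    D.vert i * D.arr p = if i = p.src then D.arr p else 0 := by
  split_ifs with h
  · rw [h, D.src_mul]
  · exact D.vert_mul_arr_of_ne h

open Classical in
theorem arr_mul_vert (i : Q) (p : QuiverArrow Q) :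
    D.arr p * D.vert i = if p.tgt = i then D.arr p else 0 := by
  split_ifs with h
  · rw [← h, D.mul_tgt]
  · exact D.arr_mul_vert_of_ne h

end Ite

variable {Q : Type v} [Quiver.{w} Q]

section Mat

variable {B : Type x} [Ring B] (D : PathRep (SquareVertex Q) B)

/-- The entries of a matrix representation, indexed by pairs of paths; they are `0` for paths of
different lengths. -/
def mat {i i' : Q} : ∀ {j j' : Q}, Quiver.Path i j → Quiver.Path i' j' → B
  | _, _, Quiver.Path.nil, Quiver.Path.nil => D.vert ⟨i, i'⟩
  | _, _, Quiver.Path.cons a p, Quiver.Path.cons b q =>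
    mat a b * D.arr (QuiverArrow.pair ⟨_, _, p⟩ ⟨_, _, q⟩)
  | _, _, Quiver.Path.nil, Quiver.Path.cons _ _ => 0
  | _, _, Quiver.Path.cons _ _, Quiver.Path.nil => 0

@[simp]
theorem mat_nil_nil (i i' : Q) :
    D.mat (Quiver.Path.nil : Quiver.Path i i) (Quiver.Path.nil : Quiver.Path i' i') =
      D.vert ⟨i, i'⟩ := by
  simp only [mat]

@[simp]
theorem mat_cons_cons {i j l i' j' l' : Q} (a : Quiver.Path i j) (p : j ⟶ l)
    (b : Quiver.Path i' j') (q : j' ⟶ l') : D.mat (a.cons p) (b.cons q) =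
      D.mat a b * D.arr (QuiverArrow.pair ⟨_, _, p⟩ ⟨_, _, q⟩) := by
  simp only [mat]

@[simp]
theorem mat_nil_cons {i i' j' l' : Q} (b : Quiver.Path i' j') (q : j' ⟶ l') :
    D.mat (Quiver.Path.nil : Quiver.Path i i) (b.cons q) = 0 := by
  simp only [mat]

@[simp]
theorem mat_cons_nil {i j l i' : Q} (a : Quiver.Path i j) (p : j ⟶ l) :
    D.mat (a.cons p) (Quiver.Path.nil : Quiver.Path i' i') = 0 := by
  simp only [mat]

theorem mat_of_length_ne {i i' j j' : Q} (a : Quiver.Path i j) (b : Quiver.Path i' j')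
    (h : a.length ≠ b.length) : D.mat a b = 0 := by
  induction a generalizing j' with
  | nil =>
    cases b with
    | nil => exact absurd rfl h
    | cons b q => exact D.mat_nil_cons b q
  | cons a p ih =>
    cases b with
    | nil => exact D.mat_cons_nil a p
    | cons b q =>
      rw [mat_cons_cons, ih b fun e => h (congrArg Nat.succ e), zero_mul]

theorem mat_mul_vert {i i' j j' : Q} (a : Quiver.Path i j) (b : Quiver.Path i' j') :
    D.mat a b * D.vert ⟨j, j'⟩ = D.mat a b := by
  cases a with
  | nil =>
    cases b with
    | nil => simp [D.vert_mul_self]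
    | cons b q => simp
  | cons a p =>
    cases b with
    | nil => simp
    | cons b q =>
      rw [mat_cons_cons, mul_assoc]
      exact congrArg _ (D.mul_tgt (QuiverArrow.pair ⟨_, _, p⟩ ⟨_, _, q⟩))

theorem mat_mul_arr_of_ne {i i' j j' : Q} (a : Quiver.Path i j) (b : Quiver.Path i' j')
    {p : QuiverArrow (SquareVertex Q)} (h : (⟨j, j'⟩ : SquareVertex Q) ≠ p.src) :
    D.mat a b * D.arr p = 0 := by
  rw [← D.mat_mul_vert, mul_assoc, D.vert_mul_arr_of_ne h, mul_zero]

theorem mat_toPath (p q : QuiverArrow Q) :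
    D.mat p.toPath.path q.toPath.path = D.arr (p.pair q) := by
  change D.mat (Quiver.Path.nil.cons p.hom) (Quiver.Path.nil.cons q.hom) = _
  rw [mat_cons_cons, mat_nil_nil]
  exact D.src_mul (p.pair q)

/-- The hypothesis on lengths aligns the two factorizations. If `c` and `d` have different lengths,
both sides vanish. -/
theorem mat_comp {i i' j j' l l' : Q} (a : Quiver.Path i j) (b : Quiver.Path i' j')
    (h : a.length = b.length) (c : Quiver.Path j l) (d : Quiver.Path j' l') :
    D.mat (a.comp c) (b.comp d) = D.mat a b * D.mat c d := by
  induction c generalizing l' with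
  | nil =>
    cases d with
    | nil => simp [D.mat_mul_vert]
    | cons d q =>
      rw [D.mat_of_length_ne, D.mat_nil_cons, mul_zero]
      simp only [Quiver.Path.comp_nil, Quiver.Path.length_comp, Quiver.Path.length_cons]
      omega
  | cons c p ih =>
    cases d with
    | nil =>
      rw [D.mat_of_length_ne, D.mat_cons_nil, mul_zero]
      simp only [Quiver.Path.comp_nil, Quiver.Path.length_comp, Quiver.Path.length_cons]
      omega
    | cons d q =>
      rw [Quiver.Path.comp_cons, Quiver.Path.comp_cons, mat_cons_cons, ih, mat_cons_cons, mul_assoc]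

section Counital

/-- The column sums of the matrix of idempotents of a matrix representation. -/
def col [Fintype Q] (j : Q) : B := ∑ i, D.vert ⟨i, j⟩

/-- The row sums of the matrix of idempotents of a matrix representation. -/
def row [Fintype Q] (i : Q) : B := ∑ j, D.vert ⟨i, j⟩

variable [Fintype Q]

theorem sum_row (hD : D.IsUnital) : ∑ i, D.row i = 1 := by
  rw [← hD, SquareVertex.sum_eq]; rfl

theorem sum_col (hD : D.IsUnital) : ∑ i, D.col i = 1 := by
  rw [← hD, SquareVertex.sum_eq, Finset.sum_comm]; rfl

/-- Row `i` and column `j` share only the position `(i, j)`, and all other products of entries are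
orthogonal. With `col_mul_row`, this yields the two formulas for `Δ²(1)`. -/
theorem row_mul_col (i j : Q) : D.row i * D.col j = D.vert ⟨i, j⟩ := by
  classical
  rw [row, col, Finset.sum_mul_sum, Finset.sum_eq_single j, Finset.sum_eq_single i]
  · exact D.vert_mul_self _
  · intro b _ hb
    exact D.vert_mul_of_ne _ _ fun h => hb (SquareVertex.mk.inj h).1.symm
  · simp
  · intro b _ hb
    exact Finset.sum_eq_zero fun c _ => D.vert_mul_of_ne _ _ fun h => hb (SquareVertex.mk.inj h).2
  · simp

theorem col_mul_row (i j : Q) : D.col j * D.row i = D.vert ⟨i, j⟩ := by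
  classical
  rw [row, col, Finset.sum_mul_sum, Finset.sum_eq_single i, Finset.sum_eq_single j]
  · exact D.vert_mul_self _
  · intro b _ hb
    exact D.vert_mul_of_ne _ _ fun h => hb (SquareVertex.mk.inj h).2.symm
  · simp
  · intro b _ hb
    exact Finset.sum_eq_zero fun c _ => D.vert_mul_of_ne _ _ fun h => hb (SquareVertex.mk.inj h).1
  · simp

open Classical in
theorem vert_mul_col (x : SquareVertex Q) (m : Q) :
    D.vert x * D.col m = if x.snd = m then D.vert x else 0 := by
  simp only [col, Finset.mul_sum, vert_mul_vert]
  split_ifs with h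
  · subst h
    rw [Finset.sum_eq_single x.fst] <;> simp +contextual [SquareVertex.ext_iff, eq_comm]
  · exact Finset.sum_eq_zero fun i _ => if_neg fun e => h (by rw [e])

open Classical in
theorem row_mul_vert (x : SquareVertex Q) (m : Q) :
    D.row m * D.vert x = if m = x.fst then D.vert x else 0 := by
  simp only [row, Finset.sum_mul, vert_mul_vert]
  split_ifs with h
  · subst h
    rw [Finset.sum_eq_single x.snd] <;> simp +contextual [SquareVertex.ext_iff, eq_comm]
  · exact Finset.sum_eq_zero fun i _ => if_neg fun e => h (by rw [← e])

end Counital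

/-- The transposed matrix representation. -/
@[simps]
def transpose : PathRep (SquareVertex Q) B where
  vert x := D.vert ⟨x.snd, x.fst⟩
  arr p := D.arr (p.snd.pair p.fst)
  vert_mul_self _ := D.vert_mul_self _
  vert_mul_of_ne _ _ h := D.vert_mul_of_ne _ _ fun e =>
    h (SquareVertex.ext (SquareVertex.mk.inj e).2 (SquareVertex.mk.inj e).1)
  src_mul p := D.src_mul (p.snd.pair p.fst)
  mul_tgt p := D.mul_tgt (p.snd.pair p.fst)

theorem mat_transpose {i i' j j' : Q} (a : Quiver.Path i j) (b : Quiver.Path i' j') :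
    D.transpose.mat a b = D.mat b a := by
  induction a generalizing j' with
  | nil => cases b <;> simp
  | cons a p ih =>
    cases b with
    | nil => simp
    | cons b q => simp [ih]

end Mat

section Tensor

variable {k : Type u} [Field k] {B C : Type*} [Ring B] [Algebra k B] [Ring C] [Algebra k C]

theorem ite_tmul_ite (P : Prop) [Decidable P] (b : B) (c : C) :
    (if P then b else 0) ⊗ₜ[k] (if P then c else 0) = if P then b ⊗ₜ[k] c else 0 := by
  split_ifs <;> simp

theorem mat_map (D : PathRep (SquareVertex Q) B) (f : B →ₗ[k] C) (hf : f.IsMultiplicative)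
    {i i' j j' : Q} (a : Quiver.Path i j) (b : Quiver.Path i' j') :
    (D.map f hf).mat a b = f (D.mat a b) := by
  induction a generalizing j' with
  | nil => cases b <;> simp
  | cons a p ih =>
    cases b with
    | nil => simp
    | cons b q => simp [ih, hf (D.mat a b)]

variable [Fintype Q] [∀ i j : Q, Finite (i ⟶ j)]

/-- The product of a matrix representation with a representation, considered as a column. -/
@[simps]
def act (D : PathRep (SquareVertex Q) B) (E : PathRep Q C) : PathRep Q (B ⊗[k] C) where
  vert i := ∑ l, D.vert ⟨i, l⟩ ⊗ₜ[k] E.vert l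
  arr p := ∑ q, D.arr (p.pair q) ⊗ₜ[k] E.arr q
  vert_mul_self i := by
    classical
    simp [Finset.sum_mul_sum, vert_mul_vert, ite_tmul_ite]
  vert_mul_of_ne i j h := by
    classical
    simp [Finset.sum_mul_sum, vert_mul_vert, h]
  src_mul p := by
    classical
    simp [Finset.sum_mul_sum, vert_mul_arr, ite_tmul_ite,
      Finset.sum_comm (s := (Finset.univ : Finset Q))]
  mul_tgt p := by
    classical
    simp [Finset.sum_mul_sum, arr_mul_vert, ite_tmul_ite]

/-- The product of matrix representations. -/
@[simps]
def comp (D : PathRep (SquareVertex Q) B) (E : PathRep (SquareVertex Q) C) :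
    PathRep (SquareVertex Q) (B ⊗[k] C) where
  vert x := ∑ l, D.vert ⟨x.fst, l⟩ ⊗ₜ[k] E.vert ⟨l, x.snd⟩
  arr p := ∑ q, D.arr (p.fst.pair q) ⊗ₜ[k] E.arr (q.pair p.snd)
  vert_mul_self i := by
    classical
    simp [Finset.sum_mul_sum, vert_mul_vert, ite_tmul_ite]
  vert_mul_of_ne x y h := by
    classical
    simp only [Finset.sum_mul_sum, vert_mul_vert, Algebra.TensorProduct.tmul_mul_tmul]
    refine Finset.sum_eq_zero fun i _ => Finset.sum_eq_zero fun j _ => ?_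
    split_ifs with h1 h2
    · exact absurd (SquareVertex.ext (SquareVertex.mk.inj h1).1 (SquareVertex.mk.inj h2).2) h
    all_goals simp
  src_mul p := by
    classical
    simp [Finset.sum_mul_sum, vert_mul_arr, ite_tmul_ite,
      Finset.sum_comm (s := (Finset.univ : Finset Q))]
  mul_tgt p := by
    classical
    simp [Finset.sum_mul_sum, arr_mul_vert, ite_tmul_ite]

/-- The action is defined on vertices and arrows only; this is the resulting formula `a ↦ ∑ x_{a,c}
⊗ c` in every degree. In the product of two such sums the terms with non-composable `c` and `q`
vanish in the second factor. -/
theorem eval_act (D : PathRep (SquareVertex Q) B) (E : PathRep Q C) {i j : Q}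
    (a : Quiver.Path i j) : (D.act (k := k) E).eval a =
      ∑ c : QuiverPath.OfLength Q a.length, D.mat a c.1.path ⊗ₜ[k] E.eval c.1.path := by
  induction a with
  | nil =>
    refine Eq.trans ?_ (QuiverPath.sum_zero fun c =>
      D.mat (Quiver.Path.nil : Quiver.Path i i) c.path ⊗ₜ[k] E.eval c.path).symm
    simp [QuiverPath.nil]
  | @cons j l a p ih =>
    rw [eval_cons, ih, act_arr, Finset.sum_mul_sum]
    refine (QuiverPath.sum_succ a.length (fun c => D.mat (a.cons p) c.path ⊗ₜ[k] E.eval c.path)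
      (fun c q => (D.mat a c.path ⊗ₜ[k] E.eval c.path) *
        (D.arr (QuiverArrow.pair ⟨j, l, p⟩ q) ⊗ₜ[k] E.arr q)) (fun c q h => ?_)
        fun i j l c q => ?_).symm
    · rw [Algebra.TensorProduct.tmul_mul_tmul, E.eval_mul_arr_of_ne _ h, TensorProduct.tmul_zero]
    · simp

/-- The analogue of `eval_act` for products of matrices, giving `Δ(x_{a,b}) = ∑ x_{a,c} ⊗ x_{c,b}`
for paths of any length. -/
theorem mat_comp_rep (D : PathRep (SquareVertex Q) B) (E : PathRep (SquareVertex Q) C)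
    {i i' j j' : Q} (a : Quiver.Path i j) (b : Quiver.Path i' j') :
    (D.comp (k := k) E).mat a b =
      ∑ c : QuiverPath.OfLength Q a.length, D.mat a c.1.path ⊗ₜ[k] E.mat c.1.path b := by
  induction a generalizing j' with
  | nil =>
    refine Eq.trans ?_ (QuiverPath.sum_zero fun c =>
      D.mat (Quiver.Path.nil : Quiver.Path i i) c.path ⊗ₜ[k] E.mat c.path b).symm
    cases b <;> simp [QuiverPath.nil]
  | @cons j l a p ih =>
    cases b with
    | nil =>
      rw [mat_cons_nil]
      refine (Finset.sum_eq_zero fun c _ => ?_).symm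
      rw [E.mat_of_length_ne c.1.path, TensorProduct.tmul_zero]
      have : c.1.path.length = a.length + 1 := c.2
      rw [this]
      exact Nat.succ_ne_zero _
    | cons b p' =>
    rw [mat_cons_cons, ih, comp_arr, Finset.sum_mul_sum]
    refine (QuiverPath.sum_succ a.length
      (fun c => D.mat (a.cons p) c.path ⊗ₜ[k] E.mat c.path (b.cons p'))
      (fun c q => (D.mat a c.path ⊗ₜ[k] E.mat c.path b) *
        (D.arr (QuiverArrow.pair ⟨j, l, p⟩ q) ⊗ₜ[k] E.arr (QuiverArrow.pair q ⟨_, _, p'⟩)))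
        (fun c q h => ?_) fun i j l c q => ?_).symm
    · rw [Algebra.TensorProduct.tmul_mul_tmul, E.mat_mul_arr_of_ne _ _ fun e =>
        h (SquareVertex.mk.inj e).1, TensorProduct.tmul_zero]
    · simp

/-- The index type of the sum depends on the length of `a`. Allowing any `n` equal to that length
lets paths of `OfLength Q n` share one index type. -/
theorem eval_act_eq_sum (D : PathRep (SquareVertex Q) B) (E : PathRep Q C) {i j : Q}
    (a : Quiver.Path i j) {n : ℕ} (h : a.length = n) : (D.act (k := k) E).eval a =
      ∑ c : QuiverPath.OfLength Q n, D.mat a c.1.path ⊗ₜ[k] E.eval c.1.path := by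
  subst h
  exact D.eval_act E a

theorem mat_comp_eq_sum (D : PathRep (SquareVertex Q) B) (E : PathRep (SquareVertex Q) C)
    {i i' j j' : Q} (a : Quiver.Path i j) (b : Quiver.Path i' j') {n : ℕ} (h : a.length = n) :
    (D.comp (k := k) E).mat a b =
      ∑ c : QuiverPath.OfLength Q n, D.mat a c.1.path ⊗ₜ[k] E.mat c.1.path b := by
  subst h
  exact D.mat_comp_rep E a b

end Tensor

end PathRep

/-! ### Quadratic relations and the universal algebra -/

open Classical in
/-- A space of coefficient vectors of quadratic elements of `kQ` that is a bimodule over the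
vertices: it is stable under restriction to the paths from `i` to `j`. -/
@[ext]
structure VertexSubmodule (k : Type u) (Q : Type v) [Field k] [Quiver.{w} Q] where
  toSubmodule : Submodule k (QuiverPath.OfLength Q 2 → k)
  restrict_mem : ∀ f ∈ toSubmodule, ∀ i j : Q,
    (fun a => if a.1.src = i ∧ a.1.tgt = j then f a else 0) ∈ toSubmodule

namespace VertexSubmodule

variable {k : Type u} {Q : Type v} [Field k] [Quiver.{w} Q] [Fintype Q]
  [∀ i j : Q, Finite (i ⟶ j)]

/-- The orthogonal complement. -/
def perp (X : VertexSubmodule k Q) : VertexSubmodule k Q where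
  toSubmodule := X.toSubmodule.dotPerp
  restrict_mem g hg i j f hf := by
    classical
    -- Restriction to the paths from `i` to `j` is self-adjoint for the dot product, so it moves
    -- from `g` to `f`.
    have := hg _ (X.restrict_mem f hf i j)
    simpa using this

theorem perp_perp (X : VertexSubmodule k Q) : X.perp.perp = X := by
  cases X
  simp only [perp, Submodule.dotPerp_dotPerp]

end VertexSubmodule

namespace PathRep

variable {k : Type u} [Field k] {Q : Type v} [Quiver.{w} Q] [Fintype Q]
  [∀ i j : Q, Finite (i ⟶ j)] {B C : Type*} [Ring B] [Algebra k B] [Ring C] [Algebra k C]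

/-- The entry of a matrix representation given by vectors of coefficients of paths of
length `2`. -/
def quad (D : PathRep (SquareVertex Q) B) (f g : QuiverPath.OfLength Q 2 → k) : B :=
  ∑ a, ∑ b, (f a * g b) • D.mat a.1.path b.1.path

theorem quad_eq (D : PathRep (SquareVertex Q) B) (f g : QuiverPath.OfLength Q 2 → k) :
    D.quad f g = ∑ b, g b • ∑ a, f a • D.mat a.1.path b.1.path := by
  rw [quad, Finset.sum_comm]
  simp [Finset.smul_sum, smul_smul, mul_comm]

theorem quad_eq' (D : PathRep (SquareVertex Q) B) (f g : QuiverPath.OfLength Q 2 → k) :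
    D.quad f g = ∑ a, f a • ∑ b, g b • D.mat a.1.path b.1.path := by
  simp [quad, Finset.smul_sum, smul_smul]

theorem quad_transpose (D : PathRep (SquareVertex Q) B) (f g : QuiverPath.OfLength Q 2 → k) :
    D.transpose.quad f g = D.quad g f := by
  simp only [quad, mat_transpose]
  rw [Finset.sum_comm]
  simp [mul_comm]

theorem quad_map (D : PathRep (SquareVertex Q) B) (φ : B →ₗ[k] C) (hφ : φ.IsMultiplicative)
    (f g : QuiverPath.OfLength Q 2 → k) : (D.map φ hφ).quad f g = φ (D.quad f g) := by
  simp [quad, mat_map]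

/-- A matrix representation is compatible with `X` if it maps `X` to itself. -/
def Compatible (D : PathRep (SquareVertex Q) B) (X : VertexSubmodule k Q) : Prop :=
  ∀ f ∈ X.toSubmodule, ∀ g ∈ X.perp.toSubmodule, D.quad f g = 0

/-- Transposing swaps the two arguments of `quad`, and the pair `(X, X^⊥)` becomes `(X^⊥, X^⊥⊥) =
(X^⊥, X)`. -/
theorem Compatible.transpose {D : PathRep (SquareVertex Q) B} {X : VertexSubmodule k Q}
    (h : D.Compatible X) : D.transpose.Compatible X.perp := fun f hf g hg => by
  rw [quad_transpose]
  rw [X.perp_perp] at hg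
  exact h g hg f hf

theorem Compatible.map {D : PathRep (SquareVertex Q) B} {X : VertexSubmodule k Q}
    (h : D.Compatible X) (φ : B →ₗ[k] C) (hφ : φ.IsMultiplicative) :
    (D.map φ hφ).Compatible X := fun f hf g hg => by
  rw [quad_map, h f hf g hg, map_zero]

/-- The vector `f D` is annihilated by `X^⊥` and the vector `E g` is annihilated by `X`, so `∑ (f
D)_c ⊗ (E g)_c` vanishes by `Submodule.sum_tmul_eq_zero`. This makes the comultiplication of the
universal algebra well defined. -/
theorem Compatible.comp {D : PathRep (SquareVertex Q) B} {E : PathRep (SquareVertex Q) C}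
    {X : VertexSubmodule k Q} (hD : D.Compatible X) (hE : E.Compatible X) :
    (D.comp (k := k) E).Compatible X := fun f hf g hg => by
  have key := X.toSubmodule.sum_tmul_eq_zero
    (fun c => ∑ a, f a • D.mat a.1.path c.1.path) (fun c => ∑ b, g b • E.mat c.1.path b.1.path)
    (fun g' hg' => by rw [← quad_eq]; exact hD f hf g' hg')
    (fun f' hf' => by rw [← quad_eq']; exact hE f' hf' g hg)
  have h : ∀ a b : QuiverPath.OfLength Q 2, (f a * g b) • (D.comp (k := k) E).mat a.1.path b.1.path =
      ∑ c : QuiverPath.OfLength Q 2,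
        (f a • D.mat a.1.path c.1.path) ⊗ₜ[k] (g b • E.mat c.1.path b.1.path) := fun a b => by
    rw [D.mat_comp_eq_sum E a.1.path b.1.path a.2, Finset.smul_sum]
    simp only [TensorProduct.smul_tmul_smul]
  simp only [quad, h]
  rw [← key, Finset.sum_congr rfl fun a _ => Finset.sum_comm, Finset.sum_comm]
  simp only [TensorProduct.sum_tmul, TensorProduct.tmul_sum]
  exact Finset.sum_congr rfl fun _ _ => Finset.sum_comm

/-- A matrix representation that is compatible with `X` acts on quotients by `X`. -/
theorem Compatible.act {D : PathRep (SquareVertex Q) B} {E : PathRep Q C}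
    {X : VertexSubmodule k Q} (hD : D.Compatible X)
    (hE : ∀ f ∈ X.toSubmodule, ∑ a, f a • E.eval a.1.path = 0) :
    ∀ f ∈ X.toSubmodule, ∑ a, f a • (D.act (k := k) E).eval a.1.path = 0 := fun f hf => by
  have key := X.toSubmodule.sum_tmul_eq_zero
    (fun c => ∑ a, f a • D.mat a.1.path c.1.path) (fun c => E.eval c.1.path)
    (fun g' hg' => by rw [← quad_eq]; exact hD f hf g' hg') hE
  rw [← key]
  simp only [TensorProduct.sum_tmul]
  rw [Finset.sum_comm]
  refine Finset.sum_congr rfl fun a _ => ?_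
  rw [D.eval_act_eq_sum E a.1.path a.2, Finset.smul_sum]
  simp only [TensorProduct.smul_tmul']

end PathRep

/-! ### The universal weak bialgebra -/

/-- The relations of the universal algebra. -/
def quadRelations {k : Type u} {Q : Type v} [Field k] [Quiver.{w} Q] [Fintype Q]
    [∀ i j : Q, Finite (i ⟶ j)] (S : Set (VertexSubmodule k Q)) :
    Set (PathAlgebra k (SquareVertex Q)) :=
  {r | ∃ X ∈ S, ∃ f ∈ X.toSubmodule, ∃ g ∈ X.perp.toSubmodule,
    r = (PathAlgebra.rep k (SquareVertex Q)).quad f g}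

/-- The algebra with a universal matrix representation of `Q` that is compatible with the elements
of `S`. -/
def UnivMat {k : Type u} {Q : Type v} [Field k] [Quiver.{w} Q] [Fintype Q]
    [∀ i j : Q, Finite (i ⟶ j)] (S : Set (VertexSubmodule k Q)) : Type (max u v w) :=
  PathAlgebra.Quot (TwoSidedIdeal.span (quadRelations S))

namespace UnivMat

/-! ### The universal algebra and its lifting property -/

section Algebra

variable {k : Type u} {Q : Type v} [Field k] [Quiver.{w} Q] [Fintype Q]
  [∀ i j : Q, Finite (i ⟶ j)] (S : Set (VertexSubmodule k Q))

instance instRing : Ring (UnivMat S) :=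
  inferInstanceAs (Ring (PathAlgebra.Quot (TwoSidedIdeal.span (quadRelations S))))

instance instAlgebra : Algebra k (UnivMat S) :=
  inferInstanceAs (Algebra k (PathAlgebra.Quot (TwoSidedIdeal.span (quadRelations S))))

/-- The quotient map from the path algebra of the product quiver. -/
def mk : PathAlgebra k (SquareVertex Q) →ₐ[k] UnivMat S :=
  Ideal.Quotient.mkₐ k (TwoSidedIdeal.span (quadRelations S)).asIdeal

theorem mk_surjective : Function.Surjective (mk S) :=
  Ideal.Quotient.mkₐ_surjective k (TwoSidedIdeal.span (quadRelations S)).asIdeal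

/-- The universal matrix representation. -/
def rep : PathRep (SquareVertex Q) (UnivMat S) :=
  (PathAlgebra.rep k (SquareVertex Q)).map (mk S).toLinearMap (.of_algHom _)

theorem eval_rep {x y : SquareVertex Q} (a : Quiver.Path x y) :
    (rep S).eval a = mk S (PathAlgebra.ofPath k ⟨x, y, a⟩) := by
  rw [rep, PathRep.eval_map, PathAlgebra.eval_rep]; rfl

theorem rep_compatible {X : VertexSubmodule k Q} (hX : X ∈ S) : (rep S).Compatible X :=
  fun f hf g hg => by
    rw [rep, PathRep.quad_map]
    exact Ideal.Quotient.eq_zero_iff_mem.2 (TwoSidedIdeal.mem_asIdeal.2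
      (TwoSidedIdeal.subset_span ⟨X, hX, f, hf, g, hg, rfl⟩))

theorem rep_isUnital : (rep S).IsUnital := by
  rw [PathRep.IsUnital, ← map_one (mk S), PathAlgebra.one_eq_sum, map_sum]; rfl

theorem linearMap_ext {S : Set (VertexSubmodule k Q)} {N : Type*} [AddCommGroup N] [Module k N]
    {f g : UnivMat S →ₗ[k] N}
    (h : ∀ (x y : SquareVertex Q) (a : Quiver.Path x y), f ((rep S).eval a) = g ((rep S).eval a)) :
    f = g := by
  have : f ∘ₗ (mk S).toLinearMap = g ∘ₗ (mk S).toLinearMap :=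
    PathAlgebra.linearMap_ext fun ⟨x, y, a⟩ => by simpa [eval_rep] using h x y a
  refine LinearMap.ext fun x => ?_
  obtain ⟨x, rfl⟩ := mk_surjective S x
  exact LinearMap.congr_fun this x

variable {B : Type*} [Ring B] [Algebra k B]

theorem ext_of_isMultiplicative {S : Set (VertexSubmodule k Q)} {f g : UnivMat S →ₗ[k] B}
    (hf : f.IsMultiplicative) (hg : g.IsMultiplicative)
    (hv : ∀ i, f ((rep S).vert i) = g ((rep S).vert i))
    (ha : ∀ p, f ((rep S).arr p) = g ((rep S).arr p)) : f = g := by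
  refine linearMap_ext fun x y a => ?_
  have h : (rep S).map f hf = (rep S).map g hg := PathRep.ext (funext hv) (funext ha)
  rw [← PathRep.eval_map _ f hf, ← PathRep.eval_map _ g hg, h]

variable {S}

theorem lift_eq_zero (D : PathRep (SquareVertex Q) B) (hD : ∀ X ∈ S, D.Compatible X)
    (x : PathAlgebra k (SquareVertex Q)) (hx : x ∈ TwoSidedIdeal.span (quadRelations S)) :
    D.lift x = 0 := by
  refine (PathAlgebra.lift_isMultiplicative D).eq_zero_of_mem_span ?_ hx
  rintro _ ⟨X, hX, f, hf, g, hg, rfl⟩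
  rw [← PathRep.quad_map _ _ (PathAlgebra.lift_isMultiplicative D), ← hD X hX f hf g hg]
  congr 1
  refine PathRep.ext (funext fun x => ?_) (funext fun p => ?_)
  · exact D.lift_ofPath _
  · exact (D.lift_ofPath _).trans (D.eval_toPath _)

/-- The multiplicative linear map given by a compatible matrix representation. -/
def lift (D : PathRep (SquareVertex Q) B) (hD : ∀ X ∈ S, D.Compatible X) : UnivMat S →ₗ[k] B :=
  (TwoSidedIdeal.span (quadRelations S)).liftₗ D.lift (lift_eq_zero D hD)

variable (D : PathRep (SquareVertex Q) B) (hD : ∀ X ∈ S, D.Compatible X)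

theorem lift_mk (x : PathAlgebra k (SquareVertex Q)) : lift D hD (mk S x) = D.lift x :=
  (TwoSidedIdeal.span (quadRelations S)).liftₗ_mk _ (lift_eq_zero D hD) x

theorem lift_isMultiplicative : (lift D hD).IsMultiplicative :=
  (TwoSidedIdeal.span (quadRelations S)).liftₗ_isMultiplicative _ (lift_eq_zero D hD)
    (PathAlgebra.lift_isMultiplicative D)

theorem lift_eval {x y : SquareVertex Q} (a : Quiver.Path x y) :
    lift D hD ((rep S).eval a) = D.eval a := by
  rw [eval_rep, lift_mk, PathRep.lift_ofPath]

theorem lift_vert (x : SquareVertex Q) : lift D hD ((rep S).vert x) = D.vert x :=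
  lift_eval D hD (Quiver.Path.nil : Quiver.Path x x)

theorem lift_arr (p : QuiverArrow (SquareVertex Q)) : lift D hD ((rep S).arr p) = D.arr p := by
  have := lift_eval D hD p.hom.toPath
  rwa [PathRep.eval_toPath, PathRep.eval_toPath] at this

theorem lift_mat {i j i' j' : Q} (a : Quiver.Path i j) (b : Quiver.Path i' j') :
    lift D hD ((rep S).mat a b) = D.mat a b := by
  rw [← PathRep.mat_map _ _ (lift_isMultiplicative D hD)]
  congr 1
  exact PathRep.ext (funext (lift_vert D hD)) (funext (lift_arr D hD))

theorem lift_one (h : D.IsUnital) : lift D hD 1 = 1 := by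
  rw [← map_one (mk S), lift_mk, PathAlgebra.lift_one h]

end Algebra

/-! ### The matrix-valued homomorphism behind the counit -/

section Counit

variable {k : Type u} {Q : Type v} [Field k] [Quiver.{w} Q] [Fintype Q] [DecidableEq Q]

open Classical in
variable (k Q) in
/-- The matrix representation with the diagonal entries `E_{s(a), t(a)}` for paths `a`. -/
@[simps]
def diagRep : PathRep (SquareVertex Q) (Matrix Q Q k) where
  vert x := if x.fst = x.snd then Matrix.single x.fst x.fst 1 else 0
  arr p := if p.fst = p.snd then Matrix.single p.src.fst p.tgt.fst 1 else 0
  vert_mul_self x := by split_ifs <;> simp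
  vert_mul_of_ne x y h := by
    split_ifs with h1 h2 <;> try simp
    have hne : x.fst ≠ y.fst := fun e => h (SquareVertex.ext e (by rw [← h1, ← h2, e]))
    simp [hne]
  src_mul p := by
    by_cases h : p.fst = p.snd
    · have : p.src.fst = p.src.snd := congrArg QuiverArrow.src h
      simp [h, this]
    · simp [h]
  mul_tgt p := by
    by_cases h : p.fst = p.snd
    · have : p.tgt.fst = p.tgt.snd := congrArg QuiverArrow.tgt h
      simp [h, this]
    · simp [h]

/-- Every path goes to a multiple of a single matrix unit; this is the form in which sums of entries
factor. -/
theorem eval_diagRep {x y : SquareVertex Q} (a : Quiver.Path x y) :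
    ∃ c : k, (diagRep k Q).eval a = c • Matrix.single x.fst y.fst 1 := by
  induction a with
  | nil =>
    rw [PathRep.eval_nil, diagRep_vert]
    split_ifs
    · exact ⟨1, (one_smul _ _).symm⟩
    · exact ⟨0, (zero_smul _ _).symm⟩
  | cons a p ih =>
    obtain ⟨c, hc⟩ := ih
    rw [PathRep.eval_cons, hc, diagRep_arr]
    split_ifs
    · exact ⟨c, by simp⟩
    · exact ⟨0, by simp⟩

-- A product of diagonal entries survives only if the two paths agree arrow by arrow, and then the
-- matrix units multiply to `E_{s(a),t(a)}`.
open Classical in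
theorem mat_diagRep {i j i' j' : Q} (a : Quiver.Path i j) (b : Quiver.Path i' j') :
    (diagRep k Q).mat a b =
      if (⟨i, j, a⟩ : QuiverPath Q) = ⟨i', j', b⟩ then Matrix.single i j 1 else 0 := by
  induction a generalizing j' with
  | nil =>
    cases b with
    | nil =>
      by_cases h : i = i'
      · subst h; simp
      · simp [h]
    | cons b q =>
      rw [PathRep.mat_nil_cons, if_neg]
      intro h
      have := congrArg QuiverPath.length h
      simp [QuiverPath.length] at this
  | @cons j l a p ih =>
    cases b with
    | nil =>
      rw [PathRep.mat_cons_nil, if_neg]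
      intro h
      have := congrArg QuiverPath.length h
      simp [QuiverPath.length] at this
    | cons b q =>
      rw [PathRep.mat_cons_cons, ih, diagRep_arr, QuiverArrow.pair_fst, QuiverArrow.pair_snd]
      by_cases h : (⟨i, l, a.cons p⟩ : QuiverPath Q) = ⟨i', _, b.cons q⟩
      · rw [if_pos h]
        simp only [QuiverPath.mk.injEq] at h
        obtain ⟨rfl, rfl, h⟩ := h
        cases h
        simp
      · rw [if_neg h]
        split_ifs with h1 h2
        · simp only [QuiverPath.mk.injEq] at h1
          obtain ⟨rfl, rfl, h1⟩ := h1
          cases h1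
          simp only [QuiverArrow.mk.injEq, true_and] at h2
          obtain ⟨rfl, h2⟩ := h2
          cases h2
          exact absurd rfl h
        all_goals simp

/-- The `(i, j)` entry of `quad f g` is the dot product of `g` with the restriction of `f` to the
paths from `i` to `j`. This is where `X` has to be a bimodule over the vertices. -/
theorem diagRep_compatible [∀ i j : Q, Finite (i ⟶ j)] (X : VertexSubmodule k Q) :
    (diagRep k Q).Compatible X := fun f hf g hg => by
  classical
  ext i j
  have h := hg _ (X.restrict_mem f hf i j)
  rw [Matrix.zero_apply, ← h, PathRep.quad, Matrix.sum_apply]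
  refine Finset.sum_congr rfl fun a _ => ?_
  rw [Matrix.sum_apply, Finset.sum_eq_single a]
  · rw [mat_diagRep, if_pos rfl, Matrix.smul_apply, Matrix.single_apply]
    split_ifs <;> simp
  · intro b _ hb
    rw [mat_diagRep, if_neg fun e => hb (Subtype.ext e.symm)]
    simp
  · simp

end Counit

section EntrySum

variable {k : Type u} {Q : Type v} [Field k] [Fintype Q]

variable (k Q) in
/-- The sum of the entries of a matrix. -/
def entrySum : Matrix Q Q k →ₗ[k] k where
  toFun M := ∑ i, ∑ j, M i j
  map_add' M N := by simp [Finset.sum_add_distrib]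
  map_smul' c M := by simp [Finset.mul_sum]

variable [DecidableEq Q]

theorem entrySum_single (i j : Q) : entrySum k Q (Matrix.single i j 1) = 1 := by
  simp [entrySum, Matrix.single_apply, ite_and]

/-- The entries of `M E_{ij} N` are `M_{ai} N_{jb}`, so their sum is the sum of column `i` of `M`
times the sum of row `j` of `N`. This is the weak multiplicativity of the counit in matrix form. -/
theorem entrySum_mul_single_mul (M N : Matrix Q Q k) (i j : Q) :
    entrySum k Q (M * Matrix.single i j 1 * N) =
      entrySum k Q (M * Matrix.single i j 1) * entrySum k Q (Matrix.single i j 1 * N) := by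
  have h1 : ∀ a b, (M * Matrix.single i j 1 : Matrix Q Q k) a b = if j = b then M a i else 0 := fun a b => by
    simp [Matrix.mul_apply, Matrix.single_apply, ite_and]
  have h2 : ∀ a b, (Matrix.single i j 1 * N : Matrix Q Q k) a b = if i = a then N j b else 0 := fun a b => by
    simp [Matrix.mul_apply, Matrix.single_apply, ite_and]
  have h3 : ∀ a b, (M * Matrix.single i j 1 * N : Matrix Q Q k) a b = M a i * N j b := fun a b => by
    simp [Matrix.mul_apply, h1]
  simp only [entrySum, LinearMap.coe_mk, AddHom.coe_mk, h1, h2, h3]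
  rw [Finset.sum_comm (f := fun a b => if i = a then N j b else 0)]
  simp [Finset.sum_mul_sum]

end EntrySum

end UnivMat

/-! ### Comultiplication and counit of the universal algebra -/

namespace UnivMat

variable {k : Type u} {Q : Type v} [Field k] [Quiver.{w} Q] [Fintype Q]
  [∀ i j : Q, Finite (i ⟶ j)] (S : Set (VertexSubmodule k Q))

/-- The comultiplication `Δ(x_{a,b}) = ∑ c, x_{a,c} ⊗ x_{c,b}`. -/
def comulMap : UnivMat S →ₗ[k] UnivMat S ⊗[k] UnivMat S :=
  lift ((rep S).comp (rep S)) fun _ hX => (rep_compatible S hX).comp (rep_compatible S hX)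

theorem comulMap_isMultiplicative : (comulMap S).IsMultiplicative :=
  lift_isMultiplicative _ _

theorem comulMap_vert (x : SquareVertex Q) : comulMap S ((rep S).vert x) =
    ∑ l, (rep S).vert ⟨x.fst, l⟩ ⊗ₜ[k] (rep S).vert ⟨l, x.snd⟩ :=
  lift_vert _ _ x

theorem comulMap_arr (p : QuiverArrow (SquareVertex Q)) : comulMap S ((rep S).arr p) =
    ∑ q, (rep S).arr (p.fst.pair q) ⊗ₜ[k] (rep S).arr (q.pair p.snd) :=
  lift_arr _ _ p

theorem comulMap_coassoc :
    (TensorProduct.assoc k (UnivMat S) (UnivMat S) (UnivMat S)).toLinearMap ∘ₗ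
      (comulMap S).rTensor (UnivMat S) ∘ₗ comulMap S =
      (comulMap S).lTensor (UnivMat S) ∘ₗ comulMap S := by
  have hm := comulMap_isMultiplicative S
  refine ext_of_isMultiplicative (LinearMap.IsMultiplicative.assoc.comp ((hm.map .id).comp hm))
    ((LinearMap.IsMultiplicative.id.map hm).comp hm) (fun x => ?_) fun p => ?_
  · simp only [LinearMap.comp_apply, comulMap_vert, map_sum, LinearMap.rTensor_tmul,
      LinearMap.lTensor_tmul, TensorProduct.sum_tmul, TensorProduct.tmul_sum, LinearEquiv.coe_coe,
      TensorProduct.assoc_tmul]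
    exact Finset.sum_comm
  · simp only [LinearMap.comp_apply, comulMap_arr, map_sum, LinearMap.rTensor_tmul,
      LinearMap.lTensor_tmul, TensorProduct.sum_tmul, TensorProduct.tmul_sum, LinearEquiv.coe_coe,
      TensorProduct.assoc_tmul, QuiverArrow.pair_fst, QuiverArrow.pair_snd]
    exact Finset.sum_comm

section Diag

variable [DecidableEq Q]

/-- The homomorphism to matrices that maps `x_{a,b}` to `δ_{a,b} E_{s(a),t(a)}`. -/
def diag : UnivMat S →ₗ[k] Matrix Q Q k :=
  lift (diagRep k Q) fun X _ => diagRep_compatible X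

theorem diag_isMultiplicative : (diag S).IsMultiplicative :=
  lift_isMultiplicative _ _

/-- In `∑ x_{a,c} ⊗ x_{c,b}` the map `diag` on the left keeps only `c = a` and records
`E_{s(a),t(a)}`. The mirror image below keeps only `c = b`. -/
theorem map_diag_comulMap {x y : SquareVertex Q} (a : Quiver.Path x y) :
    TensorProduct.map (diag S) LinearMap.id (comulMap S ((rep S).eval a)) =
      Matrix.single x.fst y.fst 1 ⊗ₜ[k] (rep S).eval a := by
  classical
  induction a with
  | nil =>
    rw [PathRep.eval_nil, comulMap_vert, map_sum, Finset.sum_eq_single x.fst]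
    · simp [diag, lift_vert]
    · intro l _ hl
      simp [diag, lift_vert, hl.symm]
    · simp
  | @cons y z a p ih =>
    rw [PathRep.eval_cons, comulMap_isMultiplicative, (diag_isMultiplicative S).map .id, ih,
      comulMap_arr, map_sum, Finset.sum_eq_single (QuiverArrow.fst ⟨y, z, p⟩)]
    · simp [diag, lift_arr]
    · intro l _ hl
      simp [diag, lift_arr, hl.symm]
    · simp

theorem map_diag_comulMap' {x y : SquareVertex Q} (a : Quiver.Path x y) :
    TensorProduct.map LinearMap.id (diag S) (comulMap S ((rep S).eval a)) =
      (rep S).eval a ⊗ₜ[k] Matrix.single x.snd y.snd 1 := by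
  classical
  induction a with
  | nil =>
    rw [PathRep.eval_nil, comulMap_vert, map_sum, Finset.sum_eq_single x.snd]
    · simp [diag, lift_vert]
    · intro l _ hl
      simp [diag, lift_vert, hl]
    · simp
  | @cons y z a p ih =>
    rw [PathRep.eval_cons, comulMap_isMultiplicative, LinearMap.IsMultiplicative.id.map
      (diag_isMultiplicative S), ih, comulMap_arr, map_sum,
      Finset.sum_eq_single (QuiverArrow.snd ⟨y, z, p⟩)]
    · simp [diag, lift_arr]
    · intro l _ hl
      simp [diag, lift_arr, hl]
    · simp

/-- The scalar `c` is the counit of the path. Both legs of the coproduct become multiples of the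
same matrix unit, so their order is irrelevant and one computation serves both weak counit axioms.
-/
theorem map_diag_diag {x y : SquareVertex Q} (a : Quiver.Path x y) :
    ∃ c : k, diag S ((rep S).eval a) = c • Matrix.single x.fst y.fst 1 ∧
      TensorProduct.map (diag S) (diag S) (comulMap S ((rep S).eval a)) =
        Matrix.single x.fst y.fst 1 ⊗ₜ[k] (c • Matrix.single x.fst y.fst 1) := by
  obtain ⟨c, hc⟩ := eval_diagRep (k := k) a
  have hd : diag S ((rep S).eval a) = c • Matrix.single x.fst y.fst 1 := by
    rw [← hc, diag, lift_eval]
  refine ⟨c, hd, ?_⟩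
  have : TensorProduct.map (diag S) (diag S) =
      TensorProduct.map LinearMap.id (diag S) ∘ₗ TensorProduct.map (diag S) LinearMap.id := by
    rw [← TensorProduct.map_comp]; simp
  rw [this, LinearMap.comp_apply, map_diag_comulMap, TensorProduct.map_tmul, hd]
  rfl

end Diag

open Classical in
/-- The counit `ε(x_{a,b}) = δ_{a,b}`. -/
def counitMap : UnivMat S →ₗ[k] k := entrySum k Q ∘ₗ diag S

open Classical in
theorem counitMap_vert (x : SquareVertex Q) :
    counitMap S ((rep S).vert x) = if x.fst = x.snd then 1 else 0 := by
  rw [counitMap, LinearMap.comp_apply, diag, lift_vert, diagRep_vert]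
  split_ifs <;> simp [entrySum_single]

open Classical in
theorem counitMap_arr (p : QuiverArrow (SquareVertex Q)) :
    counitMap S ((rep S).arr p) = if p.fst = p.snd then 1 else 0 := by
  rw [counitMap, LinearMap.comp_apply, diag, lift_arr, diagRep_arr]
  split_ifs <;> simp [entrySum_single]

instance instCoalgebra : Coalgebra k (UnivMat S) where
  comul := comulMap S
  counit := counitMap S
  coassoc := comulMap_coassoc S
  rTensor_counit_comp_comul := by
    classical
    refine linearMap_ext fun x y a => ?_
    -- The counit factors through `diag`, and the sum of the entries of a matrix unit is `1`; the
    -- counit law is then `map_diag_comulMap`.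
    have h : (counitMap S).rTensor (UnivMat S) =
        (entrySum k Q).rTensor (UnivMat S) ∘ₗ TensorProduct.map (diag S) LinearMap.id := by
      rw [counitMap, LinearMap.rTensor_comp, LinearMap.rTensor_def (M := UnivMat S) (f := diag S)]
    rw [LinearMap.comp_apply, h, LinearMap.comp_apply, map_diag_comulMap, LinearMap.rTensor_tmul,
      entrySum_single]
    rfl
  lTensor_counit_comp_comul := by
    classical
    refine linearMap_ext fun x y a => ?_
    have h : (counitMap S).lTensor (UnivMat S) =
        (entrySum k Q).lTensor (UnivMat S) ∘ₗ TensorProduct.map LinearMap.id (diag S) := by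
      rw [counitMap, LinearMap.lTensor_comp, LinearMap.lTensor_def (M := UnivMat S) (f := diag S)]
    rw [LinearMap.comp_apply, h, LinearMap.comp_apply, map_diag_comulMap', LinearMap.lTensor_tmul,
      entrySum_single]
    rfl

end UnivMat

/-! ### Matrix corepresentations -/

namespace PathRep

/-- A matrix representation in an algebra with a comultiplication is a matrix corepresentation
if it has the unit as the sum of its idempotents, `Δ(x_{a,b}) = ∑ c, x_{a,c} ⊗ x_{c,b}` and
`ε(x_{a,b}) = δ_{a,b}`. -/
structure IsCorep {k : Type u} [Field k] {Q : Type v} [Quiver.{w} Q] [Fintype Q]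
    [∀ i j : Q, Finite (i ⟶ j)] {H : Type*} [Ring H] [Algebra k H] [Coalgebra k H]
    (D : PathRep (SquareVertex Q) H) : Prop where
  isUnital : D.IsUnital
  comul_vert : ∀ i j, comul (R := k) (D.vert ⟨i, j⟩) =
    ∑ l, D.vert ⟨i, l⟩ ⊗ₜ[k] D.vert ⟨l, j⟩
  comul_arr : ∀ p q, comul (R := k) (D.arr (QuiverArrow.pair p q)) =
    ∑ r, D.arr (p.pair r) ⊗ₜ[k] D.arr (r.pair q)
  counit_vert_self : ∀ i, counit (R := k) (D.vert ⟨i, i⟩) = 1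
  counit_vert_of_ne : ∀ i j, i ≠ j → counit (R := k) (D.vert ⟨i, j⟩) = 0
  counit_arr_self : ∀ p : QuiverArrow Q, counit (R := k) (D.arr (p.pair p)) = 1
  counit_arr_of_ne : ∀ p q : QuiverArrow Q, p ≠ q → counit (R := k) (D.arr (p.pair q)) = 0

namespace IsCorep

variable {k : Type u} [Field k] {Q : Type v} [Quiver.{w} Q] [Fintype Q]
  [∀ i j : Q, Finite (i ⟶ j)] {H : Type*} [Ring H] [Algebra k H]

section Coalgebra

variable [Coalgebra k H] {D : PathRep (SquareVertex Q) H}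

theorem comul_col (hD : D.IsCorep (k := k)) (j : Q) :
    comul (R := k) (D.col j) = ∑ l, D.col l ⊗ₜ[k] D.vert ⟨l, j⟩ := by
  simp only [col, map_sum, hD.comul_vert, TensorProduct.sum_tmul]
  exact Finset.sum_comm

theorem comul_row (hD : D.IsCorep (k := k)) (i : Q) :
    comul (R := k) (D.row i) = ∑ l, D.vert ⟨i, l⟩ ⊗ₜ[k] D.row l := by
  simp only [row, map_sum, hD.comul_vert, TensorProduct.tmul_sum]
  exact Finset.sum_comm

/-- Summing `Δ(x_{i,j})` over both outer indices leaves one sum over the middle index, whose terms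
are a column sum and a row sum. -/
theorem comul_one (hD : D.IsCorep (k := k)) :
    comul (R := k) (1 : H) = ∑ l, D.col l ⊗ₜ[k] D.row l := by
  rw [← D.sum_col hD.isUnital, map_sum]
  simp only [hD.comul_col, row, TensorProduct.tmul_sum]
  exact Finset.sum_comm

theorem comul_comul_one (hD : D.IsCorep (k := k)) :
    comul.rTensor H (comul (R := k) (1 : H)) =
      ∑ l, ∑ m, (D.col l ⊗ₜ[k] D.vert ⟨l, m⟩) ⊗ₜ[k] D.row m := by
  simp only [hD.comul_one, map_sum, LinearMap.rTensor_tmul, hD.comul_col, TensorProduct.sum_tmul]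
  exact Finset.sum_comm

end Coalgebra

end IsCorep

end PathRep

/-! ### The weak bialgebra axioms for the universal algebra -/

namespace UnivMat

variable {k : Type u} {Q : Type v} [Field k] [Quiver.{w} Q] [Fintype Q]
  [∀ i j : Q, Finite (i ⟶ j)] (S : Set (VertexSubmodule k Q))

theorem rep_isCorep : (rep S).IsCorep (k := k) where
  isUnital := rep_isUnital S
  comul_vert i j := comulMap_vert S ⟨i, j⟩
  comul_arr p q := comulMap_arr S (p.pair q)
  counit_vert_self i := (counitMap_vert S ⟨i, i⟩).trans (by simp)
  counit_vert_of_ne i j h := (counitMap_vert S ⟨i, j⟩).trans (by simp [h])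
  counit_arr_self p := (counitMap_arr S (p.pair p)).trans (by simp)
  counit_arr_of_ne p q h := (counitMap_arr S (p.pair q)).trans (by simp [h])

open Classical in
theorem counit_comp_mulLeft (a : UnivMat S) :
    (counit : UnivMat S →ₗ[k] k) ∘ₗ LinearMap.mulLeft k a =
      (entrySum k Q ∘ₗ LinearMap.mulLeft k (diag S a)) ∘ₗ diag S :=
  LinearMap.ext fun z => congrArg (entrySum k Q) (diag_isMultiplicative S a z)

open Classical in
theorem counit_comp_mulRight (a : UnivMat S) :
    (counit : UnivMat S →ₗ[k] k) ∘ₗ LinearMap.mulRight k a =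
      (entrySum k Q ∘ₗ LinearMap.mulRight k (diag S a)) ∘ₗ diag S :=
  LinearMap.ext fun z => congrArg (entrySum k Q) (diag_isMultiplicative S z a)

instance instWeakBialgebra : WeakBialgebra k (UnivMat S) where
  comul_mul := comulMap_isMultiplicative S
  counit_mul_mul a b c := by
    classical
    have h : (counit : UnivMat S →ₗ[k] k) ∘ₗ LinearMap.mulLeft k a ∘ₗ LinearMap.mulRight k c =
      LinearMap.mul' k k ∘ₗ TensorProduct.map (counit ∘ₗ LinearMap.mulLeft k a)
        (counit ∘ₗ LinearMap.mulRight k c) ∘ₗ comul := by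
      refine linearMap_ext fun x y p => ?_
      obtain ⟨s, hs, hss⟩ := map_diag_diag S p
      rw [← LinearMap.comp_assoc, counit_comp_mulLeft, counit_comp_mulRight,
        TensorProduct.map_comp]
      change entrySum k Q (diag S a * diag S ((rep S).eval p * c)) = LinearMap.mul' k k
        (TensorProduct.map _ _ (TensorProduct.map (diag S) (diag S) (comulMap S ((rep S).eval p))))
      -- On a path, `diag` gives `c • E` and the coproduct gives `E ⊗ c • E`, so the axiom is
      -- `entrySum_mul_single_mul`.
      rw [diag_isMultiplicative, hs, hss, ← mul_assoc]
      simp [-Matrix.smul_single, entrySum_mul_single_mul]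
    simpa [mul_assoc] using LinearMap.congr_fun h b
  counit_mul_mul' a b c := by
    classical
    have h : (counit : UnivMat S →ₗ[k] k) ∘ₗ LinearMap.mulLeft k a ∘ₗ LinearMap.mulRight k c =
      LinearMap.mul' k k ∘ₗ TensorProduct.map (counit ∘ₗ LinearMap.mulRight k c)
        (counit ∘ₗ LinearMap.mulLeft k a) ∘ₗ comul := by
      refine linearMap_ext fun x y p => ?_
      obtain ⟨s, hs, hss⟩ := map_diag_diag S p
      rw [← LinearMap.comp_assoc, counit_comp_mulLeft, counit_comp_mulRight,
        TensorProduct.map_comp]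
      change entrySum k Q (diag S a * diag S ((rep S).eval p * c)) = LinearMap.mul' k k
        (TensorProduct.map _ _ (TensorProduct.map (diag S) (diag S) (comulMap S ((rep S).eval p))))
      rw [diag_isMultiplicative, hs, hss, ← mul_assoc]
      simp [-Matrix.smul_single, entrySum_mul_single_mul, mul_comm]
    simpa [mul_assoc] using LinearMap.congr_fun h b
  comul_comul_one := by
    -- The product has the terms `col l ⊗ (row l * col m) ⊗ row m`, and `row l * col m` is the entry
    -- at `(l, m)`.
    rw [(rep_isCorep S).comul_comul_one, (rep_isCorep S).comul_one, TensorProduct.sum_tmul,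
      TensorProduct.tmul_sum, map_sum, Finset.sum_mul_sum]
    simp [PathRep.row_mul_col]
  comul_comul_one' := by
    rw [(rep_isCorep S).comul_comul_one, (rep_isCorep S).comul_one, TensorProduct.sum_tmul,
      TensorProduct.tmul_sum, map_sum, Finset.sum_mul_sum, Finset.sum_comm]
    simp [PathRep.col_mul_row]

end UnivMat

/-! ### Equivalences of weak bialgebras -/

section Equivalences

variable {k : Type*} [Field k]

/-- A homomorphism of algebras and coalgebras with an inverse is an equivalence. -/
def BialgHom.equivOfInverse {A B : Type*} [Ring A] [Algebra k A] [Coalgebra k A] [Ring B]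
    [Algebra k B] [Coalgebra k B] (f : A →ₐc[k] B) (g : B → A) (h : ∀ x, g (f x) = x)
    (h' : ∀ y, f (g y) = y) : A ≃ₐc[k] B :=
  { f with
    invFun := g
    left_inv := h
    right_inv := h' }

/-- A multiplicative map that respects the coalgebra structures. -/
def BialgHom.ofLinearMap {A B : Type*} [Ring A] [Algebra k A] [Coalgebra k A] [Ring B]
    [Algebra k B] [Coalgebra k B] (f : A →ₗ[k] B) (h1 : f 1 = 1) (hm : f.IsMultiplicative)
    (hc : ∀ x, counit (R := k) (f x) = counit (R := k) x)
    (hΔ : ∀ x, TensorProduct.map f f (comul (R := k) x) = comul (R := k) (f x)) : A →ₐc[k] B :=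
  { f with
    map_one' := h1
    map_mul' := hm
    counit_comp := LinearMap.ext hc
    map_comp_comul := LinearMap.ext hΔ }

namespace CoOpposite

variable (k) in
/-- The identity of an algebra as a map to its co-opposite. -/
def of (H : Type*) [Ring H] [Algebra k H] : H ≃ₐ[k] CoOpposite H :=
  (AlgEquiv.refl : H ≃ₐ[k] H)

variable {H : Type*} [Ring H] [Algebra k H]

theorem comul_of [Coalgebra k H] (x : H) : comul (R := k) (of k H x) =
    TensorProduct.map (of k H).toLinearMap (of k H).toLinearMap
      (TensorProduct.comm k H H (comul (R := k) x)) :=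
  (LinearMap.congr_fun (TensorProduct.map_id (R := k) (M := H) (N := H)) _).symm

theorem of_isMultiplicative : (of k H).toLinearMap.IsMultiplicative := map_mul (of k H)

end CoOpposite

namespace MulOpposite

variable {H : Type*} [Ring H] [Algebra k H]

theorem comul_op [Coalgebra k H] (x : H) : comul (R := k) (op x) =
    TensorProduct.map (opLinearEquiv k).toLinearMap (opLinearEquiv k).toLinearMap
      (comul (R := k) x) := rfl

end MulOpposite

variable {A B : Type*} [Ring A] [Algebra k A] [Coalgebra k A] [Ring B] [Algebra k B]
  [Coalgebra k B]

/-- A homomorphism of algebras and coalgebras between the co-opposites. -/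
def BialgHom.cop (f : A →ₐc[k] B) : CoOpposite A →ₐc[k] CoOpposite B :=
  .ofLinearMap ((CoOpposite.of k B).toLinearMap ∘ₗ (f : A →ₗ[k] B) ∘ₗ
    (CoOpposite.of k A).symm.toLinearMap) (map_one f) (map_mul f)
    (fun x => CoalgHomClass.counit_comp_apply f _) fun x => by
      obtain ⟨x, rfl⟩ := (CoOpposite.of k A).surjective x
      simp only [LinearMap.comp_apply, AlgEquiv.toLinearMap_apply, AlgEquiv.symm_apply_apply,
        CoOpposite.comul_of, LinearMap.coe_coe]
      rw [← CoalgHomClass.map_comp_comul_apply]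
      generalize comul (R := k) x = z
      induction z with
      | zero => simp
      | add z z' h h' => simp only [map_add, h, h']
      | tmul a b => simp

/-- A homomorphism of algebras and coalgebras between the opposites. -/
def BialgHom.mop (f : A →ₐc[k] B) : Aᵐᵒᵖ →ₐc[k] Bᵐᵒᵖ :=
  .ofLinearMap ((MulOpposite.opLinearEquiv k).toLinearMap ∘ₗ (f : A →ₗ[k] B) ∘ₗ
    (MulOpposite.opLinearEquiv k).symm.toLinearMap) (congrArg MulOpposite.op (map_one f))
    (fun x y => congrArg MulOpposite.op (map_mul f y.unop x.unop))
    (fun x => CoalgHomClass.counit_comp_apply f _) fun x => by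
      obtain ⟨x, rfl⟩ := MulOpposite.op_surjective x
      simp only [LinearMap.comp_apply, MulOpposite.comul_op, LinearMap.coe_coe,
        LinearEquiv.coe_coe, MulOpposite.coe_opLinearEquiv_symm, MulOpposite.unop_op,
        MulOpposite.coe_opLinearEquiv]
      rw [← CoalgHomClass.map_comp_comul_apply]
      generalize comul (R := k) x = z
      induction z with
      | zero => simp
      | add z z' h h' => simp only [map_add, h, h']
      | tmul a b => simp

/-- An equivalence of algebras and coalgebras between the co-opposites. -/
def BialgEquiv.cop (e : A ≃ₐc[k] B) : CoOpposite A ≃ₐc[k] CoOpposite B :=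
  (e : A →ₐc[k] B).cop.equivOfInverse (e.symm : B →ₐc[k] A).cop (fun x => e.symm_apply_apply x)
    fun x => e.apply_symm_apply x

/-- An equivalence of algebras and coalgebras between the opposites. -/
def BialgEquiv.mop (e : A ≃ₐc[k] B) : Aᵐᵒᵖ ≃ₐc[k] Bᵐᵒᵖ :=
  (e : A →ₐc[k] B).mop.equivOfInverse (e.symm : B →ₐc[k] A).mop
    (fun x => congrArg MulOpposite.op (e.symm_apply_apply x.unop))
    fun x => congrArg MulOpposite.op (e.apply_symm_apply x.unop)

variable (k A) in
/-- The co-opposite is an involution. -/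
def CoOpposite.copCop : A ≃ₐc[k] CoOpposite (CoOpposite A) :=
  (BialgHom.ofLinearMap ((CoOpposite.of k (CoOpposite A)).toLinearMap ∘ₗ
    (CoOpposite.of k A).toLinearMap) rfl (fun _ _ => rfl) (fun _ => rfl) (fun x => by
      simp only [LinearMap.comp_apply, AlgEquiv.toLinearMap_apply, CoOpposite.comul_of]
      generalize comul (R := k) x = z
      induction z with
      | zero => simp
      | add z z' h h' => simp only [map_add, h, h']
      | tmul a b => simp) : A →ₐc[k] CoOpposite (CoOpposite A)).equivOfInverse
    (fun x => (CoOpposite.of k A).symm ((CoOpposite.of k (CoOpposite A)).symm x))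
    (fun _ => rfl) fun _ => rfl

end Equivalences

/-! ### Corepresentations in weak bialgebras -/

namespace PathRep.IsCorep

variable {k : Type u} [Field k] {Q : Type v} [Quiver.{w} Q] [Fintype Q]
  [∀ i j : Q, Finite (i ⟶ j)] {H : Type*} [Ring H] [Algebra k H] [WeakBialgebra k H]
  {D : PathRep (SquareVertex Q) H}

/-- Weak multiplicativity of `ε` with middle factor `1`, expanded by `Δ(1) = ∑ col m ⊗ row m`. -/
theorem counit_mul (hD : D.IsCorep (k := k)) (a b : H) : counit (R := k) (a * b) =
    ∑ m, counit (R := k) (a * D.col m) * counit (R := k) (D.row m * b) := by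
  have h := WeakBialgebra.counit_mul_mul (k := k) a 1 b
  rw [mul_one, hD.comul_one] at h
  simpa using h

-- At the vertex `y` the factor `col m` leaves only `m = y.snd` and the factor `row m` only `m =
-- y.fst`. Thus `ε` on a path is determined by its values on arrows and vertices, although `ε` is
-- not multiplicative.
open Classical in
theorem counit_eval_cons (hD : D.IsCorep (k := k)) {x y z : SquareVertex Q} (a : Quiver.Path x y)
    (p : y ⟶ z) : counit (R := k) (D.eval (a.cons p)) =
      if y.fst = y.snd then counit (R := k) (D.eval a) * counit (R := k) (D.arr ⟨y, z, p⟩)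
      else 0 := by
  have h1 : ∀ m, D.eval a * D.col m = if y.snd = m then D.eval a else 0 := fun m => by
    rw [← D.eval_mul_tgt, mul_assoc, vert_mul_col]
    split_ifs <;> simp
  have h2 : ∀ m, D.row m * D.arr ⟨y, z, p⟩ = if m = y.fst then D.arr ⟨y, z, p⟩ else 0 := fun m => by
    rw [← D.src_mul, ← mul_assoc, row_mul_vert]
    split_ifs <;> simp
  rw [eval_cons, hD.counit_mul]
  simp only [h1, h2]
  rw [Finset.sum_eq_single y.snd]
  · simp only [if_true, eq_comm (a := y.snd)]
    split_ifs <;> simp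
  · intro m _ hm
    simp [hm.symm]
  · simp

theorem counit_vert_congr {K : Type*} [Ring K] [Algebra k K] [WeakBialgebra k K]
    {E : PathRep (SquareVertex Q) K} (hD : D.IsCorep (k := k)) (hE : E.IsCorep (k := k))
    (x : SquareVertex Q) : counit (R := k) (D.vert x) = counit (R := k) (E.vert x) := by
  obtain ⟨i, j⟩ := x
  by_cases h : i = j
  · rw [h, hD.counit_vert_self, hE.counit_vert_self]
  · rw [hD.counit_vert_of_ne _ _ h, hE.counit_vert_of_ne _ _ h]

theorem counit_arr_congr {K : Type*} [Ring K] [Algebra k K] [WeakBialgebra k K]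
    {E : PathRep (SquareVertex Q) K} (hD : D.IsCorep (k := k)) (hE : E.IsCorep (k := k))
    (p : QuiverArrow (SquareVertex Q)) :
    counit (R := k) (D.arr p) = counit (R := k) (E.arr p) := by
  rw [← p.pair_fst_snd]
  by_cases h : p.fst = p.snd
  · rw [h, hD.counit_arr_self, hE.counit_arr_self]
  · rw [hD.counit_arr_of_ne _ _ h, hE.counit_arr_of_ne _ _ h]

theorem counit_eval_congr {K : Type*} [Ring K] [Algebra k K] [WeakBialgebra k K]
    {E : PathRep (SquareVertex Q) K} (hD : D.IsCorep (k := k)) (hE : E.IsCorep (k := k))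
    {x y : SquareVertex Q} (a : Quiver.Path x y) :
    counit (R := k) (D.eval a) = counit (R := k) (E.eval a) := by
  classical
  induction a with
  | nil => exact hD.counit_vert_congr hE x
  | cons a p ih => rw [hD.counit_eval_cons, hE.counit_eval_cons, ih, hD.counit_arr_congr hE]

end PathRep.IsCorep

namespace UnivMat

variable {k : Type u} {Q : Type v} [Field k] [Quiver.{w} Q] [Fintype Q]
  [∀ i j : Q, Finite (i ⟶ j)] {S : Set (VertexSubmodule k Q)}
  {H : Type*} [Ring H] [Algebra k H] [WeakBialgebra k H]

/-- The homomorphism of weak bialgebras given by a compatible corepresentation. -/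
def hom (D : PathRep (SquareVertex Q) H) (hD : D.IsCorep (k := k))
    (hS : ∀ X ∈ S, D.Compatible X) : UnivMat S →ₐc[k] H :=
  .ofLinearMap (lift D hS) (lift_one _ _ hD.isUnital) (lift_isMultiplicative _ _)
    -- The counit is not multiplicative, so it is compared on all paths; for the comultiplication
    -- below, generators suffice.
    (LinearMap.congr_fun (f := counit ∘ₗ lift D hS) (g := counit) <|
      linearMap_ext fun x y a => by
        rw [LinearMap.comp_apply, lift_eval]
        exact hD.counit_eval_congr (rep_isCorep S) a)
    (LinearMap.congr_fun (f := TensorProduct.map (lift D hS) (lift D hS) ∘ₗ comul)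
      (g := comul ∘ₗ lift D hS) <| by
        have hm := lift_isMultiplicative D hS
        refine ext_of_isMultiplicative ((hm.map hm).comp (comulMap_isMultiplicative S))
          (LinearMap.IsMultiplicative.comp (WeakBialgebra.comul_mul (k := k)) hm) (fun x => ?_)
          fun p => ?_
        · have := (rep_isCorep S).comul_vert x.fst x.snd
          simp only [LinearMap.comp_apply, lift_vert]
          rw [show x = ⟨x.fst, x.snd⟩ from rfl, this, map_sum]
          simp only [TensorProduct.map_tmul, lift_vert]
          exact (hD.comul_vert _ _).symm
        · have := (rep_isCorep S).comul_arr p.fst p.snd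
          simp only [LinearMap.comp_apply, lift_arr]
          rw [← p.pair_fst_snd, this, map_sum]
          simp only [TensorProduct.map_tmul, lift_arr]
          exact (hD.comul_arr _ _).symm)

variable (D : PathRep (SquareVertex Q) H) (hD : D.IsCorep (k := k))
  (hS : ∀ X ∈ S, D.Compatible X)

theorem hom_vert (x : SquareVertex Q) : hom D hD hS ((rep S).vert x) = D.vert x :=
  lift_vert D hS x

theorem hom_arr (p : QuiverArrow (SquareVertex Q)) : hom D hD hS ((rep S).arr p) = D.arr p :=
  lift_arr D hS p

theorem bialgHom_ext {f g : UnivMat S →ₐc[k] H}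
    (hv : ∀ i, f ((rep S).vert i) = g ((rep S).vert i))
    (ha : ∀ p, f ((rep S).arr p) = g ((rep S).arr p)) : f = g := by
  have : (f : UnivMat S →ₗ[k] H) = (g : UnivMat S →ₗ[k] H) :=
    ext_of_isMultiplicative (map_mul f) (map_mul g) hv ha
  exact BialgHom.ext fun x => LinearMap.congr_fun this x

end UnivMat

/-! ### Transposition -/

namespace PathRep

variable {k : Type u} [Field k] {Q : Type v} [Quiver.{w} Q] {H : Type*} [Ring H] [Algebra k H]

/-- The transposed representation, as a representation in the co-opposite. -/
def cop (D : PathRep (SquareVertex Q) H) : PathRep (SquareVertex Q) (CoOpposite H) :=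
  D.transpose.map (CoOpposite.of k H).toLinearMap CoOpposite.of_isMultiplicative

theorem mat_cop (D : PathRep (SquareVertex Q) H) {i j i' j' : Q} (a : Quiver.Path i j)
    (b : Quiver.Path i' j') : (D.cop (k := k)).mat a b = CoOpposite.of k H (D.mat b a) := by
  rw [PathRep.cop, mat_map, mat_transpose]; rfl

variable [Fintype Q]

theorem IsUnital.transpose {D : PathRep (SquareVertex Q) H} (hD : D.IsUnital) :
    D.transpose.IsUnital := by
  rw [IsUnital, SquareVertex.sum_eq, Finset.sum_comm, ← hD, SquareVertex.sum_eq]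
  rfl

variable [∀ i j : Q, Finite (i ⟶ j)]

theorem IsCorep.cop [Coalgebra k H] {D : PathRep (SquareVertex Q) H} (hD : D.IsCorep (k := k)) :
    (D.cop (k := k)).IsCorep (k := k) where
  isUnital := by
    have := congrArg (CoOpposite.of k H) hD.isUnital.transpose
    rw [map_sum, map_one] at this
    exact this
  comul_vert i j := by
    change comul (CoOpposite.of k H (D.vert ⟨j, i⟩)) = _
    rw [CoOpposite.comul_of, hD.comul_vert]
    simp only [map_sum, TensorProduct.comm_tmul, TensorProduct.map_tmul]
    rfl
  comul_arr p q := by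
    change comul (CoOpposite.of k H (D.arr (q.pair p))) = _
    rw [CoOpposite.comul_of, hD.comul_arr]
    simp only [map_sum, TensorProduct.comm_tmul, TensorProduct.map_tmul]
    rfl
  counit_vert_self i := hD.counit_vert_self i
  counit_vert_of_ne i j h := hD.counit_vert_of_ne j i h.symm
  counit_arr_self p := hD.counit_arr_self p
  counit_arr_of_ne p q h := hD.counit_arr_of_ne q p h.symm

theorem Compatible.cop {D : PathRep (SquareVertex Q) H} {X : VertexSubmodule k Q}
    (h : D.Compatible X) : (D.cop (k := k)).Compatible X.perp :=
  h.transpose.map _ _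

end PathRep

namespace UnivMat

variable {k : Type u} {Q : Type v} [Field k] [Quiver.{w} Q] [Fintype Q]
  [∀ i j : Q, Finite (i ⟶ j)]

/-- Transposition, as a homomorphism to the co-opposite. -/
def copHom (S T : Set (VertexSubmodule k Q)) (h : ∀ X ∈ S, X.perp ∈ T) :
    UnivMat S →ₐc[k] CoOpposite (UnivMat T) :=
  hom ((rep T).cop (k := k)) (rep_isCorep T).cop fun X hX => by
    have := (rep_compatible T (h X hX)).cop
    rwa [X.perp_perp] at this

theorem copHom_copHom (S T : Set (VertexSubmodule k Q)) (h : ∀ X ∈ S, X.perp ∈ T)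
    (h' : ∀ X ∈ T, X.perp ∈ S) (x : UnivMat S) :
    (CoOpposite.of k (UnivMat S)).symm (copHom T S h' ((CoOpposite.of k (UnivMat T)).symm
      (copHom S T h x))) = x := by
  have key : (CoOpposite.of k (UnivMat S)).symm.toLinearMap ∘ₗ
      (copHom T S h' : UnivMat T →ₗ[k] CoOpposite (UnivMat S)) ∘ₗ
      (CoOpposite.of k (UnivMat T)).symm.toLinearMap ∘ₗ
      (copHom S T h : UnivMat S →ₗ[k] CoOpposite (UnivMat T)) = LinearMap.id := by
    refine ext_of_isMultiplicative (fun x y => ?_) .id (fun x => ?_) fun p => ?_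
    · simp
    · simp only [LinearMap.comp_apply, AlgEquiv.toLinearMap_apply, LinearMap.coe_coe, copHom,
        hom_vert]
      simp [PathRep.cop, hom_vert]
    · simp only [LinearMap.comp_apply, AlgEquiv.toLinearMap_apply, LinearMap.coe_coe, copHom,
        hom_arr]
      simp [PathRep.cop, hom_arr]
  exact LinearMap.congr_fun key x

/-- Transposition, as an equivalence to the co-opposite. -/
def copEquiv (S T : Set (VertexSubmodule k Q)) (h : ∀ X ∈ S, X.perp ∈ T)
    (h' : ∀ X ∈ T, X.perp ∈ S) : UnivMat S ≃ₐc[k] CoOpposite (UnivMat T) :=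
  (copHom S T h).equivOfInverse
    (fun y => (CoOpposite.of k (UnivMat S)).symm (copHom T S h' ((CoOpposite.of k _).symm y)))
    (copHom_copHom S T h h') fun y => by
      obtain ⟨y, rfl⟩ := (CoOpposite.of k (UnivMat T)).surjective y
      exact congrArg (CoOpposite.of k (UnivMat T)) (copHom_copHom T S h' h y)

end UnivMat

/-! ### The opposite quiver -/

namespace QuiverPath

variable {Q : Type v} [Quiver.{w} Q]

theorem length_opPath {i j : Q} (a : Quiver.Path i j) : (opPath a).length = a.length := by
  induction a with
  | nil => rfl
  | cons a p ih =>
    rw [opPath, Quiver.Path.length_comp, ih, Quiver.Path.length_cons, add_comm]; rfl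

/-- The path of `Q` whose reversal is a given path of the opposite quiver. -/
def unopPath {i : Qᵒᵖ} : ∀ {j : Qᵒᵖ}, Quiver.Path i j → Quiver.Path j.unop i.unop
  | _, Quiver.Path.nil => Quiver.Path.nil
  | _, Quiver.Path.cons a p => p.unop.toPath.comp (unopPath a)

theorem opPath_comp {i j l : Q} (a : Quiver.Path i j) (b : Quiver.Path j l) :
    opPath (a.comp b) = (opPath b).comp (opPath a) := by
  induction b with
  | nil => exact (Quiver.Path.nil_comp _).symm
  | cons b p ih =>
    rw [Quiver.Path.comp_cons, opPath, ih, opPath, Quiver.Path.comp_assoc]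

theorem unopPath_comp {i j l : Qᵒᵖ} (a : Quiver.Path i j) (b : Quiver.Path j l) :
    unopPath (a.comp b) = (unopPath b).comp (unopPath a) := by
  induction b with
  | nil => exact (Quiver.Path.nil_comp _).symm
  | cons b p ih =>
    rw [Quiver.Path.comp_cons, unopPath, ih, unopPath, Quiver.Path.comp_assoc]

theorem unopPath_opPath {i j : Q} (a : Quiver.Path i j) : unopPath (opPath a) = a := by
  induction a with
  | nil => rfl
  | cons a p ih => rw [opPath, unopPath_comp, ih]; rfl

theorem opPath_unopPath {i j : Qᵒᵖ} (a : Quiver.Path i j) : opPath (unopPath a) = a := by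
  induction a with
  | nil => rfl
  | cons a p ih => rw [unopPath, opPath_comp, ih]; rfl

theorem length_star (a : QuiverPath Q) : a.star.length = a.length := length_opPath a.path

/-- Reversal of paths of a given length. -/
def starEquiv (n : ℕ) : OfLength Q n ≃ OfLength Qᵒᵖ n where
  toFun a := ⟨a.1.star, a.1.length_star.trans a.2⟩
  invFun b := ⟨⟨b.1.tgt.unop, b.1.src.unop, unopPath b.1.path⟩, by
    refine Eq.trans ?_ b.2
    rw [length, length, ← length_opPath, opPath_unopPath]⟩
  left_inv a := Subtype.ext (by simp [star, unopPath_opPath])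
  right_inv b := Subtype.ext (by simp [star, opPath_unopPath])

end QuiverPath

namespace VertexSubmodule

variable {k : Type u} {Q : Type v} [Field k] [Quiver.{w} Q]

open Classical in
/-- The space of reversed elements. -/
def star (X : VertexSubmodule k Q) : VertexSubmodule k Qᵒᵖ where
  toSubmodule := X.toSubmodule.comap (LinearMap.funLeft k k (QuiverPath.starEquiv 2))
  restrict_mem g hg i j := by
    have := X.restrict_mem _ hg j.unop i.unop
    refine (congrArg (· ∈ X.toSubmodule) (funext fun a => ?_)).mpr this
    have : (a.1.star.src = i ∧ a.1.star.tgt = j) ↔ (a.1.src = j.unop ∧ a.1.tgt = i.unop) := by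
      rw [and_comm]
      simp [QuiverPath.star, Opposite.op_eq_iff_eq_unop]
    simp only [LinearMap.funLeft_apply]
    exact if_congr this rfl rfl

theorem mem_star {X : VertexSubmodule k Q} {g : QuiverPath.OfLength Qᵒᵖ 2 → k} :
    g ∈ X.star.toSubmodule ↔ (fun a => g (QuiverPath.starEquiv 2 a)) ∈ X.toSubmodule := Iff.rfl

variable [Fintype Q] [∀ i j : Q, Finite (i ⟶ j)]

/-- Reversal permutes the basis of paths, hence preserves the dot product. -/
theorem star_perp (X : VertexSubmodule k Q) : X.perp.star = X.star.perp := by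
  have : X.perp.star.toSubmodule = X.star.perp.toSubmodule := by
    ext g
    constructor
    · intro hg f hf
      rw [← Equiv.sum_comp (QuiverPath.starEquiv 2)]
      exact hg _ hf
    · intro hg f hf
      have := hg (fun b => f ((QuiverPath.starEquiv 2).symm b)) (by simpa [mem_star] using hf)
      rw [← Equiv.sum_comp (QuiverPath.starEquiv 2)] at this
      simpa using this
  exact VertexSubmodule.ext this

end VertexSubmodule

namespace PathRep

open MulOpposite

variable {k : Type u} [Field k] {Q : Type v} [Quiver.{w} Q] {H : Type*} [Ring H]

/-- The representation of the opposite quiver in the opposite algebra. -/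
@[simps]
def mop (D : PathRep (SquareVertex Q) H) : PathRep (SquareVertex Qᵒᵖ) Hᵐᵒᵖ where
  vert x := op (D.vert ⟨x.fst.unop, x.snd.unop⟩)
  arr p := op (D.arr (QuiverArrow.pair ⟨_, _, p.hom.1.unop⟩ ⟨_, _, p.hom.2.unop⟩))
  vert_mul_self _ := congrArg op (D.vert_mul_self _)
  vert_mul_of_ne _ _ h := congrArg op (D.vert_mul_of_ne _ _ fun e => h (SquareVertex.ext
    (Opposite.unop_injective (SquareVertex.mk.inj e).1.symm)
    (Opposite.unop_injective (SquareVertex.mk.inj e).2.symm)))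
  src_mul _ := congrArg op (D.mul_tgt _)
  mul_tgt p := congrArg op
    (D.src_mul (QuiverArrow.pair ⟨_, _, p.hom.1.unop⟩ ⟨_, _, p.hom.2.unop⟩))

/-- The representation in the opposite algebra given by a representation of the opposite
quiver. -/
@[simps]
def unmop (D : PathRep (SquareVertex Qᵒᵖ) H) : PathRep (SquareVertex Q) Hᵐᵒᵖ where
  vert x := op (D.vert ⟨Opposite.op x.fst, Opposite.op x.snd⟩)
  arr p := op (D.arr (QuiverArrow.pair ⟨_, _, p.hom.1.op⟩ ⟨_, _, p.hom.2.op⟩))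
  vert_mul_self _ := congrArg op (D.vert_mul_self _)
  vert_mul_of_ne _ _ h := congrArg op (D.vert_mul_of_ne _ _ fun e => h (SquareVertex.ext
    (Opposite.op_injective (SquareVertex.mk.inj e).1.symm)
    (Opposite.op_injective (SquareVertex.mk.inj e).2.symm)))
  src_mul _ := congrArg op (D.mul_tgt _)
  mul_tgt p := congrArg op
    (D.src_mul (QuiverArrow.pair ⟨_, _, p.hom.1.op⟩ ⟨_, _, p.hom.2.op⟩))

/-- The reversal of `a.cons p` starts with the reversed arrow, so `mat_comp` splits off that arrow
on the left, where the opposite product puts it. Paths of different lengths give `0` on both sides.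
-/
theorem mat_mop (D : PathRep (SquareVertex Q) H) {i j i' j' : Q} (a : Quiver.Path i j)
    (b : Quiver.Path i' j') :
    D.mop.mat (QuiverPath.opPath a) (QuiverPath.opPath b) = op (D.mat a b) := by
  by_cases h : a.length = b.length
  · induction a generalizing j' with
    | nil =>
      cases b with
      | nil => simp [QuiverPath.opPath]
      | cons b q => exact absurd h.symm (Nat.succ_ne_zero _)
    | cons a p ih =>
      cases b with
      | nil => exact absurd h (Nat.succ_ne_zero _)
      | cons b q =>
        have := D.mop.mat_toPath ⟨_, _, p.op⟩ ⟨_, _, q.op⟩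
        rw [QuiverPath.opPath, QuiverPath.opPath, mat_comp _ p.op.toPath q.op.toPath rfl, ih b (Nat.succ.inj h),
          mat_cons_cons, op_mul]
        exact congrArg (· * _) this
  · rw [mat_of_length_ne, mat_of_length_ne _ _ _ h, op_zero]
    rwa [QuiverPath.length_opPath, QuiverPath.length_opPath]

theorem mat_unmop (D : PathRep (SquareVertex Qᵒᵖ) H) {i j i' j' : Q} (a : Quiver.Path i j)
    (b : Quiver.Path i' j') :
    D.unmop.mat a b = op (D.mat (QuiverPath.opPath a) (QuiverPath.opPath b)) := by
  by_cases h : a.length = b.length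
  · induction a generalizing j' with
    | nil =>
      cases b with
      | nil => simp [QuiverPath.opPath]
      | cons b q => exact absurd h.symm (Nat.succ_ne_zero _)
    | cons a p ih =>
      cases b with
      | nil => exact absurd h (Nat.succ_ne_zero _)
      | cons b q =>
        have := D.mat_toPath ⟨_, _, p.op⟩ ⟨_, _, q.op⟩
        rw [QuiverPath.opPath, QuiverPath.opPath, mat_comp _ p.op.toPath q.op.toPath rfl, op_mul,
          ← ih b (Nat.succ.inj h), mat_cons_cons]
        exact congrArg (_ * ·) (congrArg op this.symm)
  · rw [mat_of_length_ne _ _ _ h, mat_of_length_ne, op_zero]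
    rwa [QuiverPath.length_opPath, QuiverPath.length_opPath]

variable [Fintype Q] [∀ i j : Q, Finite (i ⟶ j)] [Algebra k H]

theorem quad_mop (D : PathRep (SquareVertex Q) H) (f g : QuiverPath.OfLength Qᵒᵖ 2 → k) :
    D.mop.quad f g = op (D.quad (fun a => f (QuiverPath.starEquiv 2 a))
      fun a => g (QuiverPath.starEquiv 2 a)) := by
  rw [quad, ← Equiv.sum_comp (QuiverPath.starEquiv 2), quad, Finset.op_sum]
  refine Finset.sum_congr rfl fun a _ => ?_
  rw [← Equiv.sum_comp (QuiverPath.starEquiv 2), Finset.op_sum]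
  refine Finset.sum_congr rfl fun b _ => ?_
  rw [op_smul]
  exact congrArg _ (D.mat_mop a.1.path b.1.path)

theorem quad_unmop (D : PathRep (SquareVertex Qᵒᵖ) H) (f g : QuiverPath.OfLength Qᵒᵖ 2 → k) :
    D.unmop.quad (fun a => f (QuiverPath.starEquiv 2 a))
      (fun a => g (QuiverPath.starEquiv 2 a)) = op (D.quad f g) := by
  rw [quad, quad, Finset.op_sum, ← Equiv.sum_comp (QuiverPath.starEquiv 2)]
  refine Finset.sum_congr rfl fun a _ => ?_
  rw [Finset.op_sum, ← Equiv.sum_comp (QuiverPath.starEquiv 2)]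
  refine Finset.sum_congr rfl fun b _ => ?_
  rw [op_smul]
  exact congrArg _ (D.mat_unmop a.1.path b.1.path)

theorem Compatible.mop {D : PathRep (SquareVertex Q) H} {X : VertexSubmodule k Q}
    (h : D.Compatible X) : D.mop.Compatible X.star := fun f hf g hg => by
  rw [← X.star_perp] at hg
  exact (D.quad_mop f g).trans (congrArg op (h _ hf _ hg))

theorem Compatible.unmop {D : PathRep (SquareVertex Qᵒᵖ) H} {X : VertexSubmodule k Q}
    (h : D.Compatible X.star) : D.unmop.Compatible X := fun f hf g hg => by
  have := D.quad_unmop (fun b => f ((QuiverPath.starEquiv 2).symm b))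
    fun b => g ((QuiverPath.starEquiv 2).symm b)
  simp only [Equiv.symm_apply_apply] at this
  rw [this, h _ (by simpa [VertexSubmodule.mem_star] using hf) _
    (by rw [← X.star_perp]; simpa [VertexSubmodule.mem_star] using hg), op_zero]

end PathRep

/-- Reversal of arrows. -/
def QuiverArrow.opEquiv {Q : Type v} [Quiver.{w} Q] : QuiverArrow Q ≃ QuiverArrow Qᵒᵖ where
  toFun p := ⟨_, _, p.hom.op⟩
  invFun p := ⟨_, _, p.hom.unop⟩
  left_inv _ := rfl
  right_inv _ := rfl

namespace PathRep.IsCorep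

open MulOpposite

variable {k : Type u} [Field k] {Q : Type v} [Quiver.{w} Q] [Fintype Q]
  [∀ i j : Q, Finite (i ⟶ j)] {H : Type*} [Ring H] [Algebra k H] [Coalgebra k H]

theorem mop {D : PathRep (SquareVertex Q) H} (hD : D.IsCorep (k := k)) :
    D.mop.IsCorep (k := k) where
  isUnital := by
    have := congrArg op hD.isUnital
    rw [Finset.op_sum, SquareVertex.sum_eq] at this
    rw [IsUnital, SquareVertex.sum_eq, ← op_one, ← this,
      ← Equiv.sum_comp Opposite.equivToOpposite]
    refine Finset.sum_congr rfl fun i _ => ?_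
    rw [← Equiv.sum_comp Opposite.equivToOpposite]
    rfl
  comul_vert i j := by
    refine (comul_op _).trans ?_
    rw [hD.comul_vert, map_sum, ← Equiv.sum_comp Opposite.equivToOpposite]
    rfl
  comul_arr p q := by
    refine (comul_op _).trans ?_
    rw [hD.comul_arr, map_sum, ← Equiv.sum_comp QuiverArrow.opEquiv]
    rfl
  counit_vert_self i := hD.counit_vert_self i.unop
  counit_vert_of_ne i j h := hD.counit_vert_of_ne i.unop j.unop
    fun e => h (Opposite.unop_injective e)
  counit_arr_self p := hD.counit_arr_self (QuiverArrow.opEquiv.symm p)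
  counit_arr_of_ne p q h := hD.counit_arr_of_ne (QuiverArrow.opEquiv.symm p)
    (QuiverArrow.opEquiv.symm q) fun e => h (QuiverArrow.opEquiv.symm.injective e)

theorem unmop {D : PathRep (SquareVertex Qᵒᵖ) H} (hD : D.IsCorep (k := k)) :
    D.unmop.IsCorep (k := k) where
  isUnital := by
    have := congrArg op hD.isUnital
    rw [Finset.op_sum, SquareVertex.sum_eq, ← Equiv.sum_comp Opposite.equivToOpposite] at this
    rw [IsUnital, SquareVertex.sum_eq, ← op_one, ← this]
    refine Finset.sum_congr rfl fun i _ => ?_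
    rw [← Equiv.sum_comp Opposite.equivToOpposite]
    rfl
  comul_vert i j := by
    refine (comul_op _).trans ?_
    rw [hD.comul_vert, map_sum, ← Equiv.sum_comp Opposite.equivToOpposite]
    rfl
  comul_arr p q := by
    refine (comul_op _).trans ?_
    have := hD.comul_arr (QuiverArrow.opEquiv p) (QuiverArrow.opEquiv q)
    refine (congrArg _ this).trans ?_
    rw [map_sum, ← Equiv.sum_comp QuiverArrow.opEquiv]
    rfl
  counit_vert_self i := hD.counit_vert_self (Opposite.op i)
  counit_vert_of_ne i j h := hD.counit_vert_of_ne (Opposite.op i) (Opposite.op j)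
    fun e => h (Opposite.op_injective e)
  counit_arr_self p := hD.counit_arr_self (QuiverArrow.opEquiv p)
  counit_arr_of_ne p q h := hD.counit_arr_of_ne (QuiverArrow.opEquiv p)
    (QuiverArrow.opEquiv q) fun e => h (QuiverArrow.opEquiv.injective e)

end PathRep.IsCorep

namespace UnivMat

open MulOpposite

variable {k : Type u} {Q : Type v} [Field k] [Quiver.{w} Q] [Fintype Q]
  [∀ i j : Q, Finite (i ⟶ j)]

/-- Reversal of paths, as a homomorphism to the opposite. -/
def mopHom (S : Set (VertexSubmodule k Q)) (T : Set (VertexSubmodule k Qᵒᵖ))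
    (h : ∀ X ∈ S, X.star ∈ T) : UnivMat S →ₐc[k] (UnivMat T)ᵐᵒᵖ :=
  hom (rep T).unmop (rep_isCorep T).unmop fun X hX => (rep_compatible T (h X hX)).unmop

/-- Reversal of paths, as a homomorphism to the opposite. -/
def unmopHom (S : Set (VertexSubmodule k Q)) (T : Set (VertexSubmodule k Qᵒᵖ))
    (h : ∀ Y ∈ T, ∃ X ∈ S, X.star = Y) : UnivMat T →ₐc[k] (UnivMat S)ᵐᵒᵖ :=
  hom (rep S).mop (rep_isCorep S).mop fun Y hY => by
    obtain ⟨X, hX, rfl⟩ := h Y hY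
    exact (rep_compatible S hX).mop

/-- Reversal of paths, as an equivalence to the opposite. -/
def mopEquiv (S : Set (VertexSubmodule k Q)) (T : Set (VertexSubmodule k Qᵒᵖ))
    (h : ∀ X ∈ S, X.star ∈ T) (h' : ∀ Y ∈ T, ∃ X ∈ S, X.star = Y) :
    UnivMat S ≃ₐc[k] (UnivMat T)ᵐᵒᵖ :=
  (mopHom S T h).equivOfInverse (fun y => (unmopHom S T h' y.unop).unop)
    (fun x => by
      have key : (opLinearEquiv k).symm.toLinearMap ∘ₗ
          (unmopHom S T h' : UnivMat T →ₗ[k] (UnivMat S)ᵐᵒᵖ) ∘ₗ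
          (opLinearEquiv k).symm.toLinearMap ∘ₗ
          (mopHom S T h : UnivMat S →ₗ[k] (UnivMat T)ᵐᵒᵖ) = LinearMap.id := by
        refine ext_of_isMultiplicative (fun x y => ?_) .id (fun x => ?_) fun p => ?_
        · simp
        · simp only [LinearMap.comp_apply, LinearMap.coe_coe, mopHom, hom_vert, LinearEquiv.coe_coe,
            coe_opLinearEquiv_symm, PathRep.unmop_vert, unop_op, unmopHom, PathRep.mop_vert]
          rfl
        · simp only [LinearMap.comp_apply, LinearMap.coe_coe, mopHom, hom_arr, LinearEquiv.coe_coe,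
            coe_opLinearEquiv_symm, PathRep.unmop_arr, unop_op, unmopHom, PathRep.mop_arr]
          rfl
      exact LinearMap.congr_fun key x)
    (fun y => by
      have key : (opLinearEquiv k).symm.toLinearMap ∘ₗ
          (mopHom S T h : UnivMat S →ₗ[k] (UnivMat T)ᵐᵒᵖ) ∘ₗ
          (opLinearEquiv k).symm.toLinearMap ∘ₗ
          (unmopHom S T h' : UnivMat T →ₗ[k] (UnivMat S)ᵐᵒᵖ) = LinearMap.id := by
        refine ext_of_isMultiplicative (fun x y => ?_) .id (fun x => ?_) fun p => ?_
        · simp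
        · simp only [LinearMap.comp_apply, LinearMap.coe_coe, mopHom, hom_vert, LinearEquiv.coe_coe,
            coe_opLinearEquiv_symm, PathRep.unmop_vert, unop_op, unmopHom, PathRep.mop_vert]
          rfl
        · simp only [LinearMap.comp_apply, LinearMap.coe_coe, mopHom, hom_arr, LinearEquiv.coe_coe,
            coe_opLinearEquiv_symm, PathRep.unmop_arr, unop_op, unmopHom, PathRep.mop_arr]
          rfl
      exact congrArg op (LinearMap.congr_fun key y.unop))

end UnivMat

/-! ### Quadratic ideals of path algebras -/

namespace PathAlgebra

variable {k : Type u} [Field k] {Q : Type v} [Quiver.{w} Q]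

/-- The coefficient of a path, as a linear map. -/
def coeffₗ (a : QuiverPath Q) : PathAlgebra k Q →ₗ[k] k := Finsupp.lapply a

open Classical in
theorem coeffₗ_ofPath (a b : QuiverPath Q) :
    coeffₗ a (ofPath k b) = if b = a then 1 else 0 :=
  Finsupp.single_apply

variable (k Q) in
/-- The coefficients of the paths of length `2`. -/
def quadVec : PathAlgebra k Q →ₗ[k] (QuiverPath.OfLength Q 2 → k) :=
  LinearMap.pi fun a => coeffₗ a.1

theorem quadVec_apply (x : PathAlgebra k Q) (a : QuiverPath.OfLength Q 2) :
    quadVec k Q x a = coeffₗ a.1 x := rfl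

/-- The elements without components of degree less than `2` whose component of degree `2` lies in
a given space. -/
def aboveQuad (X : Submodule k (QuiverPath.OfLength Q 2 → k)) : Submodule k (PathAlgebra k Q) where
  carrier := {x | (∀ a : QuiverPath Q, a.length < 2 → coeffₗ a x = 0) ∧ quadVec k Q x ∈ X}
  zero_mem' := ⟨fun a _ => map_zero _, by rw [map_zero]; exact X.zero_mem⟩
  add_mem' hx hy := ⟨fun a ha => by rw [map_add, hx.1 a ha, hy.1 a ha, add_zero], by
    rw [map_add]; exact X.add_mem hx.2 hy.2⟩
  smul_mem' c x hx := ⟨fun a ha => by rw [map_smul, hx.1 a ha, smul_zero], by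
    rw [map_smul]; exact X.smul_mem c hx.2⟩

theorem mem_aboveQuad {X : Submodule k (QuiverPath.OfLength Q 2 → k)} {x : PathAlgebra k Q} :
    x ∈ aboveQuad X ↔
      (∀ a : QuiverPath Q, a.length < 2 → coeffₗ a x = 0) ∧ quadVec k Q x ∈ X := Iff.rfl

variable [Fintype Q]

theorem coeffₗ_of_mem_grading {n : ℕ} {x : PathAlgebra k Q} (hx : x ∈ grading k n)
    {a : QuiverPath Q} (ha : a.length ≠ n) : coeffₗ a x = 0 := by
  classical
  induction hx using Submodule.span_induction with
  | zero => simp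
  | add x y _ _ hx hy => simp [hx, hy]
  | smul c x _ hx => simp [hx]
  | mem x hx =>
    obtain ⟨b, hb, rfl⟩ := hx
    rw [coeffₗ_ofPath, if_neg]
    rintro rfl
    exact ha hb

theorem grading_le_aboveQuad (X : Submodule k (QuiverPath.OfLength Q 2 → k)) {n : ℕ}
    (hn : 2 < n) : grading k n ≤ aboveQuad X := fun x hx =>
  ⟨fun a ha => coeffₗ_of_mem_grading hx (by omega), by
    have : quadVec k Q x = 0 := funext fun a => coeffₗ_of_mem_grading hx (by rw [a.2]; omega)
    rw [this]
    exact X.zero_mem⟩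

theorem isQuadratic_dualIdeal (I : TwoSidedIdeal (PathAlgebra k Q)) :
    IsQuadratic (dualIdeal I) := ⟨_, fun _ hg => hg.1, rfl⟩

variable [∀ i j : Q, Finite (i ⟶ j)]

variable (k Q) in
/-- The quadratic element with given coefficients. -/
def ofVec : (QuiverPath.OfLength Q 2 → k) →ₗ[k] PathAlgebra k Q :=
  Fintype.linearCombination k fun a => ofPath k a.1

theorem ofVec_apply (f : QuiverPath.OfLength Q 2 → k) :
    ofVec k Q f = ∑ a, f a • ofPath k a.1 := Fintype.linearCombination_apply ..

theorem quadVec_ofVec (f : QuiverPath.OfLength Q 2 → k) : quadVec k Q (ofVec k Q f) = f := by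
  classical
  funext a
  rw [quadVec_apply, ofVec_apply, map_sum, Finset.sum_eq_single a]
  · simp [coeffₗ_ofPath]
  · intro b _ hb
    have : b.1 ≠ a.1 := fun e => hb (Subtype.ext e)
    simp [coeffₗ_ofPath, this]
  · simp

theorem ofVec_mem_grading (f : QuiverPath.OfLength Q 2 → k) : ofVec k Q f ∈ grading k 2 := by
  rw [ofVec_apply]
  exact Submodule.sum_mem _ fun a _ => Submodule.smul_mem _ _ (Submodule.subset_span ⟨a.1, a.2, rfl⟩)

theorem ofVec_quadVec {x : PathAlgebra k Q} (hx : x ∈ grading k 2) :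
    ofVec k Q (quadVec k Q x) = x := by
  classical
  induction hx using Submodule.span_induction with
  | zero => simp
  | add x y _ _ hx hy => simp [hx, hy]
  | smul c x _ hx => simp [hx]
  | mem x hx =>
    obtain ⟨b, hb, rfl⟩ := hx
    rw [ofVec_apply, Finset.sum_eq_single ⟨b, hb⟩]
    · simp [quadVec_apply, coeffₗ_ofPath]
    · intro a _ ha
      have : b ≠ a.1 := fun e => ha (Subtype.ext e.symm)
      simp [quadVec_apply, coeffₗ_ofPath, this]
    · simp

-- Multiplying by a vertex on each side is the restriction that occurs in `VertexSubmodule`; it is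
-- why quadratic parts of ideals are of this kind.
open Classical in
theorem nil_mul_ofVec_mul_nil (f : QuiverPath.OfLength Q 2 → k) (i j : Q) :
    ofPath k (QuiverPath.nil i) * ofVec k Q f * ofPath k (QuiverPath.nil j) =
      ofVec k Q fun a => if a.1.src = i ∧ a.1.tgt = j then f a else 0 := by
  simp only [ofVec_apply, Finset.mul_sum, Finset.sum_mul, mul_smul_comm, smul_mul_assoc]
  refine Finset.sum_congr rfl fun a _ => ?_
  obtain ⟨⟨i', j', a⟩, ha⟩ := a
  by_cases hi : i' = i
  · subst hi
    have h1 : ofPath k (QuiverPath.nil i') * ofPath k ⟨i', j', a⟩ = ofPath k ⟨i', j', a⟩ := by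
      refine (ofPath_mul_ofPath _ _).trans ?_
      rw [Quiver.Path.nil_comp]
    rw [h1]
    by_cases hj : j' = j
    · subst hj
      have h2 : ofPath k ⟨i', j', a⟩ * ofPath k (QuiverPath.nil j') = ofPath k ⟨i', j', a⟩ :=
        ofPath_mul_ofPath _ _
      simp [h2]
    · rw [ofPath_mul_of_ne (b := QuiverPath.nil j) hj]
      simp [hj]
  · rw [ofPath_mul_of_ne (a := QuiverPath.nil i) (b := ⟨i', j', a⟩) (Ne.symm hi)]
    simp [hi]

theorem ofVec_mem_aboveQuad {X : Submodule k (QuiverPath.OfLength Q 2 → k)}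
    {f : QuiverPath.OfLength Q 2 → k} (hf : f ∈ X) : ofVec k Q f ∈ aboveQuad X :=
  ⟨fun a ha => coeffₗ_of_mem_grading (ofVec_mem_grading f) (by omega), by
    rwa [quadVec_ofVec]⟩

/-- Multiplying by paths raises the degree above 2 unless both paths are trivial, and then it is a
restriction to the paths between two vertices. -/
theorem mul_ofVec_mul_mem (X : VertexSubmodule k Q) {f : QuiverPath.OfLength Q 2 → k}
    (hf : f ∈ X.toSubmodule) (y z : PathAlgebra k Q) :
    y * ofVec k Q f * z ∈ aboveQuad X.toSubmodule := by
  induction y using induction_on with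
  | zero => simp
  | add x x' hx hx' => simpa only [add_mul] using Submodule.add_mem _ hx hx'
  | smul c x hx => simpa only [smul_mul_assoc] using Submodule.smul_mem _ c hx
  | path a =>
  induction z using induction_on with
  | zero => simp
  | add x x' hx hx' => simpa only [mul_add] using Submodule.add_mem _ hx hx'
  | smul c x hx => simpa only [mul_smul_comm] using Submodule.smul_mem _ c hx
  | path b =>
  have hab : ofPath k a * ofVec k Q f * ofPath k b ∈ grading k (a.length + 2 + b.length) :=
    mul_mem_grading (mul_mem_grading (Submodule.subset_span ⟨a, rfl, rfl⟩) (ofVec_mem_grading f))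
      (Submodule.subset_span ⟨b, rfl, rfl⟩)
  by_cases h : a.length = 0 ∧ b.length = 0
  · obtain ⟨i, ha⟩ := QuiverPath.nilEquiv.surjective ⟨a, h.1⟩
    obtain ⟨j, hb⟩ := QuiverPath.nilEquiv.surjective ⟨b, h.2⟩
    obtain rfl : QuiverPath.nil i = a := congrArg Subtype.val ha
    obtain rfl : QuiverPath.nil j = b := congrArg Subtype.val hb
    rw [nil_mul_ofVec_mul_nil]
    exact ofVec_mem_aboveQuad (X.restrict_mem f hf i j)
  · exact grading_le_aboveQuad _ (by omega) hab

/-- The ideal is additively generated by products `y s z` with `s ∈ S`. So quadratic generators in a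
vertex bimodule `X` produce nothing in degree 2 outside `X`, and nothing in lower degrees. -/
theorem mem_aboveQuad_of_mem_span {X : VertexSubmodule k Q} {S : Set (PathAlgebra k Q)}
    (hS : ∀ s ∈ S, s ∈ grading k 2) (hX : ∀ s ∈ S, quadVec k Q s ∈ X.toSubmodule)
    {x : PathAlgebra k Q} (hx : x ∈ TwoSidedIdeal.span S) : x ∈ aboveQuad X.toSubmodule := by
  rw [TwoSidedIdeal.mem_span_iff_mem_addSubgroup_closure] at hx
  induction hx using AddSubgroup.closure_induction with
  | zero => exact Submodule.zero_mem _
  | add x y _ _ hx hy => exact Submodule.add_mem _ hx hy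
  | neg x _ hx => exact Submodule.neg_mem _ hx
  | mem x hx =>
    obtain ⟨_, ⟨y, -, s, hs, rfl⟩, z, -, rfl⟩ := hx
    have := mul_ofVec_mul_mem X (hX s hs) y z
    rwa [ofVec_quadVec (hS s hs)] at this

/-- The quadratic part of a two-sided ideal. -/
def quadPart (I : TwoSidedIdeal (PathAlgebra k Q)) : VertexSubmodule k Q where
  toSubmodule :=
    { carrier := {f | ofVec k Q f ∈ I}
      zero_mem' := by
        change ofVec k Q 0 ∈ I
        rw [map_zero]; exact I.zero_mem
      add_mem' := fun {f g} hf hg => by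
        change ofVec k Q (f + g) ∈ I
        rw [map_add]; exact I.add_mem hf hg
      smul_mem' := fun c f hf => by
        change ofVec k Q (c • f) ∈ I
        rw [map_smul, Algebra.smul_def]; exact I.mul_mem_left _ _ hf }
  restrict_mem f hf i j := by
    change ofVec k Q _ ∈ I
    rw [← nil_mul_ofVec_mul_nil]
    exact I.mul_mem_right _ _ (I.mul_mem_left _ _ hf)

theorem mem_quadPart {I : TwoSidedIdeal (PathAlgebra k Q)} {f : QuiverPath.OfLength Q 2 → k} :
    f ∈ (quadPart I).toSubmodule ↔ ofVec k Q f ∈ I := Iff.rfl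

/-- A quadratic ideal lies in degrees at least `2` and contains the components of degree `2` of its
elements. -/
theorem IsQuadratic.le_aboveQuad {I : TwoSidedIdeal (PathAlgebra k Q)} (hI : IsQuadratic I)
    {x : PathAlgebra k Q} (hx : x ∈ I) : x ∈ aboveQuad (quadPart I).toSubmodule := by
  obtain ⟨S, hS, rfl⟩ := hI
  refine mem_aboveQuad_of_mem_span hS (fun s hs => ?_) hx
  rw [mem_quadPart, ofVec_quadVec (hS s hs)]
  exact TwoSidedIdeal.subset_span hs

theorem pairing_star_ofVec (g : PathAlgebra k Qᵒᵖ) (f : QuiverPath.OfLength Q 2 → k) :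
    pairing g (star (ofVec k Q f)) = ∑ a, f a * quadVec k Qᵒᵖ g (QuiverPath.starEquiv 2 a) := by
  classical
  have h1 : star (ofVec k Q f) = ∑ a, f a • ofPath k a.1.star := by
    rw [ofVec_apply, map_sum]
    refine Finset.sum_congr rfl fun a _ => ?_
    rw [map_smul]
    exact congrArg _ (Finsupp.mapDomain_single)
  have h2 : ∀ h : PathAlgebra k Qᵒᵖ, pairing g h = ∑ b ∈ (coeff g).support, coeff g b * coeffₗ b h :=
    fun _ => rfl
  rw [h1, h2]
  simp only [map_sum, map_smul, Finset.mul_sum]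
  rw [Finset.sum_comm]
  refine Finset.sum_congr rfl fun a _ => ?_
  simp only [coeffₗ_ofPath, smul_eq_mul, mul_ite, mul_one, mul_zero]
  rw [Finset.sum_ite_eq]
  split_ifs with h
  · exact mul_comm _ _
  · rw [Finsupp.notMem_support_iff] at h
    exact (mul_eq_zero_of_right _ h).symm

/-- The generators of the dual ideal are exactly the quadratic elements with coefficients in
`(X*)^⊥`. This space is a vertex bimodule, so generating an ideal does not enlarge it in degree 2.
-/
theorem quadPart_dualIdeal (I : TwoSidedIdeal (PathAlgebra k Q)) :
    quadPart (dualIdeal I) = (quadPart I).star.perp := by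
  have hmem : ∀ g : QuiverPath.OfLength Qᵒᵖ 2 → k, g ∈ (quadPart I).star.perp.toSubmodule ↔
      ∀ f ∈ (quadPart I).toSubmodule, ∑ a, f a * g (QuiverPath.starEquiv 2 a) = 0 := fun g => by
    rw [← VertexSubmodule.star_perp]
    rfl
  have hgen : ∀ g : PathAlgebra k Qᵒᵖ, (∀ f ∈ I, f ∈ grading k 2 → pairing g (star f) = 0) ↔
      quadVec k Qᵒᵖ g ∈ (quadPart I).star.perp.toSubmodule := fun g => by
    rw [hmem]
    constructor
    · intro h f hf
      rw [← pairing_star_ofVec]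
      exact h _ hf (ofVec_mem_grading f)
    · intro h f hf hf2
      rw [← ofVec_quadVec hf2, pairing_star_ofVec]
      exact h _ (by rwa [mem_quadPart, ofVec_quadVec hf2])
  refine VertexSubmodule.ext ?_
  ext g
  constructor
  · intro hg
    have := mem_aboveQuad_of_mem_span (X := (quadPart I).star.perp) (fun _ hs => hs.1)
      (fun s hs => (hgen s).1 hs.2) hg
    have := (mem_aboveQuad.1 this).2
    rwa [quadVec_ofVec] at this
  · intro hg
    refine TwoSidedIdeal.subset_span ⟨ofVec_mem_grading g, (hgen _).2 ?_⟩
    rwa [quadVec_ofVec]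

end PathAlgebra

/-! ### Coactions from corepresentations -/

theorem PathRep.row_mul_row {Q : Type v} [Quiver.{w} Q] [Fintype Q] {H : Type*} [Ring H]
    [DecidableEq Q] (D : PathRep (SquareVertex Q) H) (i j : Q) :
    D.row i * D.row j = if i = j then D.row i else 0 := by
  conv_lhs => rw [PathRep.row.eq_1 D j, Finset.mul_sum]
  simp only [PathRep.row_mul_vert]
  split_ifs with h
  · rw [h]; rfl
  · simp

namespace PathRep.IsCorep

variable {k : Type u} [Field k] {Q : Type v} [Quiver.{w} Q] [Fintype Q]
  [∀ i j : Q, Finite (i ⟶ j)] {H : Type*} [Ring H] [Algebra k H] [WeakBialgebra k H]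
  {D : PathRep (SquareVertex Q) H}

-- The representation `D` factors through `UnivMat ∅`, which has no quadratic relations; the
-- homomorphism preserves counits, and there the counit is computed by `diag`.
open Classical in
theorem counit_mat (hD : D.IsCorep (k := k)) {i j i' j' : Q} (a : Quiver.Path i j)
    (b : Quiver.Path i' j') : counit (R := k) (D.mat a b) =
      if (⟨i, j, a⟩ : QuiverPath Q) = ⟨i', j', b⟩ then 1 else 0 := by
  have h := UnivMat.lift_mat (k := k) (S := ∅) D (fun X hX => hX.elim) a b
  rw [← h]
  refine (CoalgHomClass.counit_comp_apply (UnivMat.hom (S := ∅) D hD fun X hX => hX.elim) _).trans ?_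
  change UnivMat.entrySum k Q (UnivMat.diag ∅ _) = _
  rw [UnivMat.diag, UnivMat.lift_mat, UnivMat.mat_diagRep]
  split_ifs <;> simp [UnivMat.entrySum_single]

-- The counit makes column sums and row sums dual bases. Hence `ε_s` fixes the column sums, `ε_t`
-- fixes the row sums, and the row sums are linearly independent.
open Classical in
theorem counit_col_mul_row (hD : D.IsCorep (k := k)) (i j : Q) :
    counit (R := k) (D.col i * D.row j) = if i = j then 1 else 0 := by
  rw [col_mul_row]
  split_ifs with h
  · rw [h, hD.counit_vert_self]
  · rw [hD.counit_vert_of_ne _ _ (Ne.symm h)]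

theorem sourceCounital_apply (hD : D.IsCorep (k := k)) (x : H) :
    sourceCounital k H x = ∑ m, counit (R := k) (x * D.row m) • D.col m := by
  simp [sourceCounital, hD.comul_one]

theorem targetCounital_apply (hD : D.IsCorep (k := k)) (x : H) :
    targetCounital k H x = ∑ m, counit (R := k) (D.col m * x) • D.row m := by
  simp [targetCounital, hD.comul_one]

theorem col_mem (hD : D.IsCorep (k := k)) (i : Q) : D.col i ∈ sourceCounitalSub k H := by
  classical
  refine ⟨D.col i, ?_⟩
  rw [hD.sourceCounital_apply]
  simp [hD.counit_col_mul_row]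

theorem row_mem (hD : D.IsCorep (k := k)) (i : Q) : D.row i ∈ targetCounitalSub k H := by
  classical
  refine ⟨D.row i, ?_⟩
  rw [hD.targetCounital_apply]
  simp [hD.counit_col_mul_row]

end PathRep.IsCorep

namespace PathAlgebra

variable {k : Type u} [Field k] {Q : Type v} [Quiver.{w} Q] [Fintype Q]

/-- The tautological representation in a quotient of the path algebra. -/
def quotRep (I : TwoSidedIdeal (PathAlgebra k Q)) : PathRep Q (Quot I) :=
  (rep k Q).map (Ideal.Quotient.mkₐ k I.asIdeal).toLinearMap (.of_algHom _)

theorem eval_quotRep (I : TwoSidedIdeal (PathAlgebra k Q)) {i j : Q} (a : Quiver.Path i j) :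
    (quotRep I).eval a = Ideal.Quotient.mkₐ k I.asIdeal (ofPath k ⟨i, j, a⟩) := by
  rw [quotRep, PathRep.eval_map, eval_rep]; rfl

theorem quotRep_isUnital (I : TwoSidedIdeal (PathAlgebra k Q)) : (quotRep I).IsUnital := by
  rw [PathRep.IsUnital, ← map_one (Ideal.Quotient.mkₐ k I.asIdeal), one_eq_sum, map_sum]; rfl

theorem quot_linearMap_ext {I : TwoSidedIdeal (PathAlgebra k Q)} {N : Type*} [AddCommGroup N]
    [Module k N] {f g : Quot I →ₗ[k] N}
    (h : ∀ (i j : Q) (a : Quiver.Path i j), f ((quotRep I).eval a) = g ((quotRep I).eval a)) :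
    f = g := by
  have : f ∘ₗ (Ideal.Quotient.mkₐ k I.asIdeal).toLinearMap =
      g ∘ₗ (Ideal.Quotient.mkₐ k I.asIdeal).toLinearMap :=
    linearMap_ext fun ⟨i, j, a⟩ => by
      have := h i j a
      rwa [eval_quotRep] at this
  refine LinearMap.ext fun x => ?_
  obtain ⟨x, rfl⟩ := Ideal.Quotient.mkₐ_surjective k I.asIdeal x
  exact LinearMap.congr_fun this x

theorem quot_ext_of_isMultiplicative {I : TwoSidedIdeal (PathAlgebra k Q)} {B : Type*} [Ring B]
    [Algebra k B] {f g : Quot I →ₗ[k] B} (hf : f.IsMultiplicative) (hg : g.IsMultiplicative)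
    (hv : ∀ i, f ((quotRep I).vert i) = g ((quotRep I).vert i))
    (ha : ∀ p, f ((quotRep I).arr p) = g ((quotRep I).arr p)) : f = g := by
  refine quot_linearMap_ext fun x y a => ?_
  have h : (quotRep I).map f hf = (quotRep I).map g hg := PathRep.ext (funext hv) (funext ha)
  rw [← PathRep.eval_map _ f hf, ← PathRep.eval_map _ g hg, h]

theorem eval_quotRep_mem (I : TwoSidedIdeal (PathAlgebra k Q)) {i j : Q} (a : Quiver.Path i j) :
    (quotRep I).eval a ∈ quotGrading I a.length := by
  rw [eval_quotRep]
  exact ⟨_, Submodule.subset_span ⟨⟨i, j, a⟩, rfl, rfl⟩, rfl⟩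

theorem quotGrading_induction {I : TwoSidedIdeal (PathAlgebra k Q)} {n : ℕ}
    {P : Submodule k (Quot I)}
    (h : ∀ (i j : Q) (a : Quiver.Path i j), a.length = n → (quotRep I).eval a ∈ P) :
    quotGrading I n ≤ P := by
  rintro _ ⟨x, hx, rfl⟩
  induction hx using Submodule.span_induction with
  | zero => rw [map_zero]; exact P.zero_mem
  | add x y _ _ hx hy => rw [map_add]; exact P.add_mem hx hy
  | smul c x _ hx => rw [map_smul]; exact P.smul_mem c hx
  | mem x hx =>
    obtain ⟨⟨i, j, a⟩, ha, rfl⟩ := hx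
    have := h i j a ha
    rwa [eval_quotRep] at this

variable [∀ i j : Q, Finite (i ⟶ j)] {I : TwoSidedIdeal (PathAlgebra k Q)}

/-- The coefficients of paths of length less than `2` are well-defined on a quadratic algebra. -/
def quotCoeff (hI : IsQuadratic I) (a : QuiverPath Q) (ha : a.length < 2) : Quot I →ₗ[k] k :=
  I.liftₗ (coeffₗ a) fun _ hx => (hI.le_aboveQuad hx).1 a ha

open Classical in
theorem quotCoeff_eval (hI : IsQuadratic I) (a : QuiverPath Q) (ha : a.length < 2) {i j : Q}
    (b : Quiver.Path i j) : quotCoeff hI a ha ((quotRep I).eval b) =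
      if (⟨i, j, b⟩ : QuiverPath Q) = a then 1 else 0 := by
  rw [eval_quotRep, quotCoeff, TwoSidedIdeal.liftₗ_mk, coeffₗ_ofPath]

/-- The coefficient of a vertex. -/
def vertCoeff (hI : IsQuadratic I) (i : Q) : Quot I →ₗ[k] k :=
  quotCoeff hI (QuiverPath.nil i) (show (QuiverPath.nil i).length < 2 from Nat.zero_lt_two)

/-- The coefficient of an arrow. -/
def arrCoeff (hI : IsQuadratic I) (p : QuiverArrow Q) : Quot I →ₗ[k] k :=
  quotCoeff hI p.toPath (show p.toPath.length < 2 from Nat.one_lt_two)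

open Classical in
theorem vertCoeff_vert (hI : IsQuadratic I) (i j : Q) :
    vertCoeff hI i ((quotRep I).vert j) = if j = i then 1 else 0 := by
  rw [vertCoeff, ← PathRep.eval_nil, quotCoeff_eval]
  refine if_congr ⟨fun h => congrArg QuiverPath.src h, fun h => ?_⟩ rfl rfl
  subst h
  rfl

open Classical in
theorem arrCoeff_arr (hI : IsQuadratic I) (p q : QuiverArrow Q) :
    arrCoeff hI p ((quotRep I).arr q) = if q = p then 1 else 0 := by
  rw [arrCoeff, ← show (quotRep I).eval q.hom.toPath = (quotRep I).arr q from
    PathRep.eval_toPath _ q.hom, quotCoeff_eval]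
  refine if_congr ⟨fun h => QuiverPath.arrowEquiv.injective (Subtype.ext h), fun h => ?_⟩ rfl rfl
  subst h
  rfl

theorem eq_sum_vert (hI : IsQuadratic I) {x : Quot I} (hx : x ∈ quotGrading I 0) :
    x = ∑ i, vertCoeff hI i x • (quotRep I).vert i := by
  classical
  have h : quotGrading I 0 ≤ LinearMap.eqLocus (LinearMap.id : Quot I →ₗ[k] Quot I)
      (∑ i, (vertCoeff hI i).smulRight ((quotRep I).vert i)) := by
    refine quotGrading_induction fun i j a ha => ?_
    cases a with
    | nil => simp [LinearMap.mem_eqLocus, vertCoeff_vert]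
    | cons a p => exact absurd ha (Nat.succ_ne_zero _)
  simpa using h hx

theorem sum_smul_eval_eq_zero {f : QuiverPath.OfLength Q 2 → k}
    (hf : f ∈ (quadPart I).toSubmodule) : ∑ a, f a • (quotRep I).eval a.1.path = 0 := by
  rw [mem_quadPart, ← TwoSidedIdeal.mem_asIdeal, ← Ideal.Quotient.eq_zero_iff_mem,
    ofVec_apply] at hf
  have h2 : Ideal.Quotient.mkₐ k I.asIdeal (∑ a, f a • ofPath k a.1) = 0 := hf
  simp only [map_sum, map_smul] at h2
  simpa only [eval_quotRep] using h2

end PathAlgebra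

namespace PathAlgebra

variable {k : Type u} [Field k] {Q : Type v} [Quiver.{w} Q] [Fintype Q]
  [∀ i j : Q, Finite (i ⟶ j)] {I : TwoSidedIdeal (PathAlgebra k Q)}
  {H : Type*} [Ring H] [Algebra k H]

/-- By compatibility the action respects the quadratic relations, and these generate `I`. -/
theorem lift_act_eq_zero (hI : IsQuadratic I) (D : PathRep (SquareVertex Q) H)
    (hc : D.Compatible (quadPart I)) (x : PathAlgebra k Q) (hx : x ∈ I) :
    (D.act (k := k) (quotRep I)).lift x = 0 := by
  have hS : ∀ f ∈ (quadPart I).toSubmodule,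
      (D.act (k := k) (quotRep I)).lift (ofVec k Q f) = 0 := fun f hf => by
    simp only [ofVec_apply, map_sum, map_smul, PathRep.lift_ofPath]
    exact hc.act (fun f hf => sum_smul_eval_eq_zero hf) f hf
  have hI' := hI
  obtain ⟨S, hS2, rfl⟩ := hI'
  refine (lift_isMultiplicative _).eq_zero_of_mem_span (fun s hs => ?_) hx
  rw [← ofVec_quadVec (hS2 s hs)]
  refine hS _ ?_
  rw [mem_quadPart, ofVec_quadVec (hS2 s hs)]
  exact TwoSidedIdeal.subset_span hs

variable (hI : IsQuadratic I) (D : PathRep (SquareVertex Q) H) (hc : D.Compatible (quadPart I))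

/-- The coaction on `kQ/I` given by a compatible matrix representation. -/
def coactMap : Quot I →ₗ[k] H ⊗[k] Quot I :=
  I.liftₗ _ (lift_act_eq_zero hI D hc)

theorem coactMap_isMultiplicative : (coactMap hI D hc).IsMultiplicative :=
  I.liftₗ_isMultiplicative _ _ (lift_isMultiplicative _)

theorem coactMap_eval {i j : Q} (a : Quiver.Path i j) :
    coactMap hI D hc ((quotRep I).eval a) = (D.act (k := k) (quotRep I)).eval a := by
  rw [eval_quotRep, coactMap, TwoSidedIdeal.liftₗ_mk, PathRep.lift_ofPath]

theorem coactMap_eval_eq_sum {i j : Q} (a : Quiver.Path i j) {n : ℕ} (h : a.length = n) :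
    coactMap hI D hc ((quotRep I).eval a) =
      ∑ c : QuiverPath.OfLength Q n, D.mat a c.1.path ⊗ₜ[k] (quotRep I).eval c.1.path := by
  rw [coactMap_eval, D.eval_act_eq_sum _ a h]

theorem coactMap_vert (i : Q) : coactMap hI D hc ((quotRep I).vert i) =
    ∑ l, D.vert ⟨i, l⟩ ⊗ₜ[k] (quotRep I).vert l :=
  coactMap_eval hI D hc (Quiver.Path.nil : Quiver.Path i i)

theorem coactMap_arr (p : QuiverArrow Q) : coactMap hI D hc ((quotRep I).arr p) =
    ∑ q, D.arr (p.pair q) ⊗ₜ[k] (quotRep I).arr q := by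
  have := coactMap_eval hI D hc p.hom.toPath
  rwa [PathRep.eval_toPath, PathRep.eval_toPath] at this

end PathAlgebra

/-! ### The base and the coaction axioms -/

namespace PathAlgebra

section DegreeZero

variable {k : Type u} [Field k] {Q : Type v} [Quiver.{w} Q] [Fintype Q]
  {I : TwoSidedIdeal (PathAlgebra k Q)}

theorem vert_quotRep_mem (I : TwoSidedIdeal (PathAlgebra k Q)) (i : Q) :
    (quotRep I).vert i ∈ quotGrading I 0 :=
  eval_quotRep_mem I (Quiver.Path.nil : Quiver.Path i i)

theorem arr_quotRep_mem (I : TwoSidedIdeal (PathAlgebra k Q)) (p : QuiverArrow Q) :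
    (quotRep I).arr p ∈ quotGrading I 1 := by
  have h := eval_quotRep_mem I p.hom.toPath
  rwa [PathRep.eval_toPath, Quiver.Path.length_toPath] at h

/-- A vertex as an element of degree `0`. -/
def vertZero (I : TwoSidedIdeal (PathAlgebra k Q)) (i : Q) : quotGrading I 0 :=
  ⟨(quotRep I).vert i, vert_quotRep_mem I i⟩

theorem one_eq_sum_vertZero (I : TwoSidedIdeal (PathAlgebra k Q)) :
    (1 : quotGrading I 0) = ∑ i, vertZero I i := by
  refine Subtype.ext ?_
  rw [SetLike.GradeZero.coe_one, ← quotRep_isUnital I]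
  simp [vertZero]

theorem vertZero_mul_vertZero [DecidableEq Q] (i j : Q) :
    vertZero I i * vertZero I j = if i = j then vertZero I i else 0 := by
  refine Subtype.ext ?_
  rw [SetLike.GradeZero.coe_mul, vertZero, vertZero, PathRep.vert_mul_vert]
  split_ifs <;> rfl

variable [∀ i j : Q, Finite (i ⟶ j)] {H : Type*} [Ring H] [Algebra k H] (hI : IsQuadratic I)
  (D : PathRep (SquareVertex Q) H)

/-- The isomorphism from the part of degree `0` to the target counital subalgebra, as a linear
map. -/
def baseMap : quotGrading I 0 →ₗ[k] H :=
  (∑ i, (vertCoeff hI i).smulRight (D.row i)) ∘ₗ (quotGrading I 0).subtype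

theorem baseMap_vertZero (i : Q) : baseMap hI D (vertZero I i) = D.row i := by
  classical
  simp [baseMap, vertZero, vertCoeff_vert]

theorem eq_sum_vertZero (x : quotGrading I 0) :
    x = ∑ i, vertCoeff hI i x • vertZero I i := by
  refine Subtype.ext ((eq_sum_vert hI x.2).trans ?_)
  simp [vertZero]

theorem baseMap_mul (x y : quotGrading I 0) :
    baseMap hI D (x * y) = baseMap hI D x * baseMap hI D y := by
  classical
  rw [eq_sum_vertZero hI x, eq_sum_vertZero hI y]
  have key : ∀ (c d : k) (i j : Q), baseMap hI D ((c • vertZero I i) * (d • vertZero I j)) =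
      (c • D.row i) * (d • D.row j) := fun c d i j => by
    rw [show (c • vertZero I i) * (d • vertZero I j) =
      (c * d) • (vertZero I i * vertZero I j) from Subtype.ext (smul_mul_smul_comm ..),
      vertZero_mul_vertZero, map_smul, smul_mul_assoc, mul_smul_comm, smul_smul, D.row_mul_row]
    split_ifs <;> simp [baseMap_vertZero]
  simp only [Finset.sum_mul_sum, map_sum, key, map_smul, baseMap_vertZero]

theorem baseMap_one (hD : D.IsUnital) : baseMap hI D 1 = 1 := by
  rw [one_eq_sum_vertZero, map_sum, ← D.sum_row hD]
  simp [baseMap_vertZero]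

end DegreeZero

variable {k : Type u} [Field k] {Q : Type v} [Quiver.{w} Q] [Fintype Q]
  [∀ i j : Q, Finite (i ⟶ j)] {I : TwoSidedIdeal (PathAlgebra k Q)}
  {H : Type*} [Ring H] [Algebra k H] [WeakBialgebra k H] (hI : IsQuadratic I)
  (D : PathRep (SquareVertex Q) H) (hc : D.Compatible (quadPart I))

theorem coactMap_isLeftCoaction (hD : D.IsCorep (k := k)) : IsLeftCoaction (quotGrading I) (coactMap hI D hc) where
  coassoc := by
    have hm := coactMap_isMultiplicative hI D hc
    have hΔ : (comul : H →ₗ[k] H ⊗[k] H).IsMultiplicative := WeakBialgebra.comul_mul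
    refine quot_ext_of_isMultiplicative (LinearMap.IsMultiplicative.assoc.comp
      ((hΔ.map .id).comp hm)) ((LinearMap.IsMultiplicative.id.map hm).comp hm) (fun x => ?_)
      fun p => ?_
    · simp only [LinearMap.comp_apply, coactMap_vert, map_sum, LinearMap.rTensor_tmul,
        LinearMap.lTensor_tmul, TensorProduct.sum_tmul, TensorProduct.tmul_sum,
        LinearEquiv.coe_coe, TensorProduct.assoc_tmul, hD.comul_vert]
      exact Finset.sum_comm
    · simp only [LinearMap.comp_apply, coactMap_arr, map_sum, LinearMap.rTensor_tmul,
        LinearMap.lTensor_tmul, TensorProduct.sum_tmul, TensorProduct.tmul_sum,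
        LinearEquiv.coe_coe, TensorProduct.assoc_tmul, hD.comul_arr]
      exact Finset.sum_comm
  counit := by
    classical
    refine quot_linearMap_ext fun i j a => ?_
    rw [LinearMap.comp_apply, LinearMap.comp_apply, coactMap_eval_eq_sum hI D hc a rfl, map_sum,
      map_sum, Finset.sum_eq_single ⟨⟨i, j, a⟩, rfl⟩]
    · simp [hD.counit_mat]
    · intro b _ hb
      have : (⟨i, j, a⟩ : QuiverPath Q) ≠ b.1 := fun e => hb (Subtype.ext e.symm)
      simp [hD.counit_mat, this]
    · simp
  map_mul := coactMap_isMultiplicative hI D hc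
  map_one := by
    rw [← quotRep_isUnital I, map_sum]
    simp only [coactMap_vert]
    -- Summing over the first index gives `λ(1) = ∑ col l ⊗ e_l`, whose left legs lie in `H_s`.
    rw [Finset.sum_comm]
    refine Submodule.sum_mem _ fun l _ => ?_
    rw [← TensorProduct.sum_tmul]
    exact ⟨(⟨D.col l, hD.col_mem l⟩ : sourceCounitalSub k H) ⊗ₜ[k] (quotRep I).vert l, rfl⟩
  linear n := by
    suffices h : quotGrading I n ≤ (LinearMap.range ((quotGrading I n).subtype.lTensor H)).comap
        (coactMap hI D hc) from fun a ha => h ha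
    refine quotGrading_induction fun i j a ha => ?_
    rw [Submodule.mem_comap, coactMap_eval_eq_sum hI D hc a ha]
    refine Submodule.sum_mem _ fun c _ => ?_
    have hmem : (quotRep I).eval c.1.path ∈ quotGrading I n := by
      have := eval_quotRep_mem I c.1.path
      rwa [show c.1.path.length = n from c.2] at this
    exact ⟨D.mat a c.1.path ⊗ₜ[k] ⟨_, hmem⟩, rfl⟩

/-- The isomorphism sends the vertex `i` to `row i`. It is injective because the functionals `ε(col
j * ·)` are dual to the rows, and onto `H_t` because the right legs of `Δ(1)` are the rows. -/
theorem coactMap_isLeftBasePreserving (hD : D.IsCorep (k := k)) :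
    IsLeftBasePreserving (quotGrading I) (coactMap hI D hc) := by
  classical
  refine ⟨AlgHom.ofLinearMap (baseMap hI D) (baseMap_one hI D hD.isUnital) (baseMap_mul hI D), ?_, ?_, ?_⟩
  · refine (injective_iff_map_eq_zero _).2 fun x hx => ?_
    rw [AlgHom.ofLinearMap_apply] at hx
    rw [eq_sum_vertZero hI x] at hx ⊢
    refine Finset.sum_eq_zero fun j _ => ?_
    have h := congrArg (fun y => counit (R := k) (D.col j * y)) hx
    simp only [map_sum, map_smul, baseMap_vertZero, Finset.mul_sum, mul_smul_comm,
      hD.counit_col_mul_row, mul_zero, map_zero] at h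
    simp only [smul_eq_mul, mul_ite, mul_one, mul_zero, Finset.sum_ite_eq, Finset.mem_univ,
      if_true] at h
    rw [h, zero_smul]
  · refine le_antisymm ?_ ?_
    · rintro _ ⟨x, rfl⟩
      rw [eq_sum_vertZero hI x, map_sum]
      refine Submodule.sum_mem _ fun i _ => ?_
      rw [map_smul]
      refine Submodule.smul_mem _ _ ?_
      change baseMap hI D (vertZero I i) ∈ _
      rw [baseMap_vertZero]
      exact hD.row_mem i
    · rintro _ ⟨x, rfl⟩
      rw [hD.targetCounital_apply]
      refine Submodule.sum_mem _ fun i _ => Submodule.smul_mem _ _ ⟨vertZero I i, ?_⟩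
      exact baseMap_vertZero hI D i
  · intro x
    refine ⟨∑ i, vertCoeff hI i x • ∑ l, D.vert ⟨i, l⟩ ⊗ₜ[k] vertZero I l, ?_, ?_⟩
    · conv_rhs => rw [eq_sum_vert hI x.2]
      simp [coactMap_vert, vertZero]
    · conv_rhs => rw [eq_sum_vertZero hI x]
      simp only [map_sum, map_smul, LinearMap.lTensor_tmul]
      refine Finset.sum_congr rfl fun i _ => congrArg _ ?_
      change _ = comul (baseMap hI D (vertZero I i))
      rw [baseMap_vertZero, hD.comul_row]
      refine Finset.sum_congr rfl fun l _ => congrArg _ ?_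
      exact baseMap_vertZero hI D l

end PathAlgebra

/-! ### Matrix coefficients of the base of a weak bialgebra -/

section Coefficients

variable {k : Type u} [Field k] {ι M N : Type*} [Fintype ι] [DecidableEq ι]
  [AddCommGroup M] [Module k M] [AddCommGroup N] [Module k N]

theorem TensorProduct.rid_lTensor_sum_tmul {a : ι → M} {v : ι → N} {f : N →ₗ[k] k} {i : ι}
    (hf : ∀ j, f (v j) = if j = i then 1 else 0) :
    TensorProduct.rid k M (f.lTensor M (∑ j, a j ⊗ₜ[k] v j)) = a i := by
  simp [hf]

theorem TensorProduct.eq_of_sum_tmul_eq {a b : ι → M} {v : ι → N} {f : ι → N →ₗ[k] k}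
    (hf : ∀ i j, f i (v j) = if j = i then 1 else 0)
    (h : ∑ j, a j ⊗ₜ[k] v j = ∑ j, b j ⊗ₜ[k] v j) (i : ι) : a i = b i := by
  rw [← rid_lTensor_sum_tmul (a := a) (hf i), h, rid_lTensor_sum_tmul (hf i)]

theorem TensorProduct.eq_of_sum_tmul_eq' {a b : ι → M} {v : ι → N} {f : ι → N →ₗ[k] k}
    (hf : ∀ i j, f i (v j) = if j = i then 1 else 0)
    (h : ∑ j, v j ⊗ₜ[k] a j = ∑ j, v j ⊗ₜ[k] b j) (i : ι) : a i = b i := by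
  refine eq_of_sum_tmul_eq hf ?_ i
  simpa using congrArg (TensorProduct.comm k N M) h

end Coefficients

/-- A basis `t` of orthogonal idempotents of the target counital subalgebra of a weak bialgebra,
with dual functionals `τ` and with the matrix coefficients `z` of the comultiplication. -/
structure WeakBialgebra.IsBaseMatrix {k : Type u} [Field k] {H : Type*} [Ring H] [Algebra k H]
    [WeakBialgebra k H] {ι : Type*} [Fintype ι] [DecidableEq ι] (z : ι → ι → H) (t : ι → H)
    (τ : ι → H →ₗ[k] k) : Prop where
  mul_eq : ∀ i j, t i * t j = if i = j then t i else 0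
  sum_eq_one : ∑ i, t i = 1
  dual : ∀ i j, τ i (t j) = if j = i then 1 else 0
  mem : ∀ i, t i ∈ targetCounitalSub k H
  comul_base : ∀ i, comul (R := k) (t i) = ∑ j, z i j ⊗ₜ[k] t j
  comul_mat : ∀ i j, comul (R := k) (z i j) = ∑ l, z i l ⊗ₜ[k] z l j
  counit_mat : ∀ i j, counit (R := k) (z i j) = if i = j then 1 else 0

namespace WeakBialgebra.IsBaseMatrix

variable {k : Type u} [Field k] {H : Type*} [Ring H] [Algebra k H]
  [WeakBialgebra k H] {ι : Type*} [Fintype ι] [DecidableEq ι] {z : ι → ι → H} {t : ι → H}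
  {τ : ι → H →ₗ[k] k}

/-- The sum of a column of the matrix. -/
def col (_ : IsBaseMatrix z t τ) (j : ι) : H := ∑ i, z i j

theorem comul_one (h : IsBaseMatrix z t τ) :
    comul (R := k) (1 : H) = ∑ j, h.col j ⊗ₜ[k] t j := by
  rw [← h.sum_eq_one, map_sum]
  simp only [h.comul_base, col, TensorProduct.sum_tmul]
  exact Finset.sum_comm

theorem comul_col (h : IsBaseMatrix z t τ) (j : ι) :
    comul (R := k) (h.col j) = ∑ l, h.col l ⊗ₜ[k] z l j := by
  rw [col, map_sum]
  simp only [h.comul_mat, col, TensorProduct.sum_tmul]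
  exact Finset.sum_comm

/-- The columns have dual functionals, too. -/
theorem exists_dual_col (h : IsBaseMatrix z t τ) :
    ∃ σ : ι → H →ₗ[k] k, ∀ i j, σ i (h.col j) = if j = i then 1 else 0 := by
  choose x hx using h.mem
  refine ⟨fun i => counit ∘ₗ LinearMap.mulRight k (x i), fun i j => ?_⟩
  -- From `t_i = ε_t(x_i) = ∑ ε(c_j x_i) t_j` the functionals `ε(· x_i)` are dual to the columns
  -- `c_j`.
  have h1 := congrArg (τ j) (hx i)
  rw [h.dual, targetCounital] at h1
  simp only [LinearMap.coe_mk, AddHom.coe_mk, h.comul_one, map_sum, LinearMap.rTensor_tmul,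
    TensorProduct.lid_tmul, map_smul, h.dual, smul_eq_mul, mul_ite, mul_one, mul_zero,
    Finset.sum_ite_eq', Finset.mem_univ, if_true] at h1
  simpa only [eq_comm (a := i)] using h1

/-- In `Δ²(1) = ∑ c_l ⊗ z_{lj} ⊗ t_j` both outer legs have dual functionals, so the middle legs are
determined. -/
theorem mat_eq_of_comul_comul_one (h : IsBaseMatrix z t τ) {y : ι → ι → H}
    (hy : comul.rTensor H (comul (R := k) (1 : H)) =
      ∑ j, (∑ l, h.col l ⊗ₜ[k] y l j) ⊗ₜ[k] t j) (l j : ι) : z l j = y l j := by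
  obtain ⟨σ, hσ⟩ := h.exists_dual_col
  rw [h.comul_one, map_sum] at hy
  simp only [LinearMap.rTensor_tmul, h.comul_col] at hy
  exact TensorProduct.eq_of_sum_tmul_eq' hσ (TensorProduct.eq_of_sum_tmul_eq h.dual hy j) l

/-- The product `(Δ(1) ⊗ 1)(1 ⊗ Δ(1))` has the middle legs `t_l c_j`; in the other order, used for
`mat_eq_mul'`, they are `c_j t_l`. In particular the `t_l` commute with the `c_j`. -/
theorem mat_eq_mul (h : IsBaseMatrix z t τ) (l j : ι) : z l j = t l * h.col j := by
  refine h.mat_eq_of_comul_comul_one (y := fun l j => t l * h.col j) ?_ l j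
  rw [comul_comul_one]
  simp only [h.comul_one, TensorProduct.sum_tmul,
    TensorProduct.tmul_sum, map_sum, TensorProduct.assoc_symm_tmul, Finset.sum_mul_sum,
    Algebra.TensorProduct.tmul_mul_tmul, mul_one, one_mul]
  exact Finset.sum_comm

theorem mat_eq_mul' (h : IsBaseMatrix z t τ) (l j : ι) : z l j = h.col j * t l := by
  refine h.mat_eq_of_comul_comul_one (y := fun l j => h.col j * t l) ?_ l j
  rw [comul_comul_one']
  simp only [h.comul_one, TensorProduct.sum_tmul,
    TensorProduct.tmul_sum, map_sum, TensorProduct.assoc_symm_tmul, Finset.sum_mul_sum,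
    Algebra.TensorProduct.tmul_mul_tmul, mul_one, one_mul]

theorem base_mul_col (h : IsBaseMatrix z t τ) (l j : ι) : t l * h.col j = h.col j * t l := by
  rw [← h.mat_eq_mul, h.mat_eq_mul']

/-- Compare the coefficients of `t_j` in `Δ(1)² = Δ(1)`: orthogonality of the `t_i` leaves `∑ c_j² ⊗
t_j = ∑ c_j ⊗ t_j`. -/
theorem col_mul_self (h : IsBaseMatrix z t τ) (j : ι) : h.col j * h.col j = h.col j := by
  have h1 := comul_mul (k := k) (1 : H) 1
  rw [mul_one, h.comul_one, Finset.sum_mul_sum] at h1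
  simp only [Algebra.TensorProduct.tmul_mul_tmul, h.mul_eq, TensorProduct.tmul_ite,
    Finset.sum_ite_eq, Finset.mem_univ, if_true] at h1
  exact (TensorProduct.eq_of_sum_tmul_eq h.dual h1 j).symm

theorem counit_base_mul_col (h : IsBaseMatrix z t τ) (l j : ι) :
    counit (R := k) (t l * h.col j) = if l = j then 1 else 0 := by
  rw [← h.mat_eq_mul, h.counit_mat]

/-- Move `t_m` to the right and expand `ε(c_j · c_l · t_m)` through `Δ(c_l)`: this forces `m = l`.
The next theorem expands `ε(t_m · c_j · c_l)` through `Δ(c_j)` in the other order and forces `m =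
j`. -/
theorem counit_base_mul_col_mul_col (h : IsBaseMatrix z t τ) (m j l : ι) :
    counit (R := k) (t m * h.col j * h.col l) =
      if m = l then counit (R := k) (h.col j * h.col l) else 0 := by
  have e : t m * h.col j * h.col l = h.col j * h.col l * t m := by
    rw [h.base_mul_col, mul_assoc, h.base_mul_col, mul_assoc]
  have e' : ∀ n, counit (R := k) (z n l * t m) =
      if n = m then (if m = l then 1 else 0) else 0 := fun n => by
    rw [h.mat_eq_mul', mul_assoc, h.mul_eq]
    split_ifs with hn hm
    · rw [← h.base_mul_col, h.counit_base_mul_col, if_pos (hn.trans hm)]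
    · rw [← h.base_mul_col, h.counit_base_mul_col, if_neg (hn ▸ hm)]
    · rw [mul_zero, map_zero]
  rw [e, counit_mul_mul, h.comul_col]
  simp only [map_sum, TensorProduct.map_tmul, LinearMap.mul'_apply, LinearMap.comp_apply,
    LinearMap.mulLeft_apply, LinearMap.mulRight_apply, e', mul_ite, mul_zero, mul_one,
    Finset.sum_ite_eq', Finset.mem_univ, if_true]
  exact ite_congr rfl (fun hm => by rw [hm]) fun _ => rfl

theorem counit_base_mul_col_mul_col' (h : IsBaseMatrix z t τ) (m j l : ι) :
    counit (R := k) (t m * h.col j * h.col l) =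
      if m = j then counit (R := k) (h.col j * h.col l) else 0 := by
  rw [counit_mul_mul', h.comul_col]
  simp only [h.mat_eq_mul, ← mul_assoc, h.mul_eq, map_sum, TensorProduct.map_tmul,
    LinearMap.mul'_apply, LinearMap.comp_apply, LinearMap.mulLeft_apply, LinearMap.mulRight_apply,
    ite_mul, zero_mul, apply_ite (counit (R := k)), map_zero, mul_ite, mul_zero,
    h.counit_base_mul_col]
  simp only [Finset.sum_ite_eq, Finset.mem_univ, if_true]
  split_ifs with hm
  · simp [hm]
  · simp

/-- For `j ≠ l` the two evaluations of `ε(t_m c_j c_l)` contradict each other unless it is `0` for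
all `m`. Since `Δ(c_j c_l) = ∑ c_m ⊗ t_m c_j c_l`, the counit law gives `c_j c_l = 0`. -/
theorem col_mul_of_ne (h : IsBaseMatrix z t τ) {j l : ι} (hjl : j ≠ l) :
    h.col j * h.col l = 0 := by
  have hε : counit (R := k) (h.col j * h.col l) = 0 := by
    have h1 := h.counit_base_mul_col_mul_col l j l
    rwa [h.counit_base_mul_col_mul_col', if_pos rfl, if_neg (Ne.symm hjl), eq_comm] at h1
  have h2 : comul (R := k) (h.col j * h.col l) =
      ∑ m, h.col m ⊗ₜ[k] (t m * h.col j * h.col l) := by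
    rw [comul_mul, h.comul_col, h.comul_col, Finset.sum_mul_sum]
    refine Finset.sum_congr rfl fun m _ => ?_
    -- The product `z_{mj} z_{m'l}` contains `t_m t_{m'}`, so only `m' = m` survives.
    rw [Finset.sum_eq_single m]
    · rw [Algebra.TensorProduct.tmul_mul_tmul, h.col_mul_self, h.mat_eq_mul m j, h.mat_eq_mul' m l,
        mul_assoc, mul_assoc, ← h.base_mul_col, ← mul_assoc (h.col j), ← h.base_mul_col,
        mul_assoc (t m), ← mul_assoc (t m) (t m), h.mul_eq, if_pos rfl]
    · intro m' _ hm
      rw [Algebra.TensorProduct.tmul_mul_tmul, h.mat_eq_mul' m j, h.mat_eq_mul m' l,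
        mul_assoc, ← mul_assoc (t m), h.mul_eq, if_neg (Ne.symm hm), zero_mul, mul_zero,
        TensorProduct.tmul_zero]
    · simp
  have h3 := lTensor_counit_comul (R := k) (h.col j * h.col l)
  rw [h2, map_sum] at h3
  simp only [LinearMap.lTensor_tmul, h.counit_base_mul_col_mul_col, hε, ite_self,
    TensorProduct.tmul_zero, Finset.sum_const_zero] at h3
  simpa using congrArg (TensorProduct.rid k H) h3.symm

theorem col_mul_col (h : IsBaseMatrix z t τ) (j l : ι) :
    h.col j * h.col l = if j = l then h.col j else 0 := by
  split_ifs with hjl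
  · rw [← hjl, h.col_mul_self]
  · exact h.col_mul_of_ne hjl

theorem counit_col (h : IsBaseMatrix z t τ) (j : ι) : counit (R := k) (h.col j) = 1 := by
  simp [col, h.counit_mat]

/-- The counit law for `1` gives `1 = ∑ ε(t_l) c_l`. Multiplying by `c_l` and applying `ε` shows
`ε(t_l) = 1`, because the columns are orthogonal and have counit `1`. -/
theorem sum_col (h : IsBaseMatrix z t τ) : ∑ j, h.col j = 1 := by
  have h1 := lTensor_counit_comul (R := k) (1 : H)
  rw [h.comul_one, map_sum] at h1
  simp only [LinearMap.lTensor_tmul] at h1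
  have h2 := congrArg (TensorProduct.rid k H) h1
  simp only [map_sum, TensorProduct.rid_tmul, one_smul] at h2
  have h3 : ∀ l, counit (R := k) (t l) = 1 := fun l => by
    have h4 := congrArg (fun x => counit (R := k) (h.col l * x)) h2
    simpa [Finset.mul_sum, h.col_mul_col, apply_ite (counit (R := k)), h.counit_col] using h4
  simpa [h3] using h2

theorem mat_mul_mat (h : IsBaseMatrix z t τ) (i j l m : ι) :
    z i j * z l m = if i = l ∧ j = m then z i j else 0 := by
  rw [h.mat_eq_mul i j, h.mat_eq_mul l m, mul_assoc, ← mul_assoc (h.col j), ← h.base_mul_col,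
    mul_assoc, ← mul_assoc, h.mul_eq, h.col_mul_col]
  by_cases hi : i = l <;> by_cases hj : j = m <;> simp [hi, hj]

theorem sum_mat (h : IsBaseMatrix z t τ) : ∑ i, ∑ j, z i j = 1 := by
  rw [Finset.sum_comm]
  exact h.sum_col

end WeakBialgebra.IsBaseMatrix

/-! ### Corepresentations from coactions -/

section Coefficients

variable {k : Type u} [Field k] {ι M N : Type*} [Fintype ι]
  [AddCommGroup M] [Module k M] [AddCommGroup N] [Module k N]

theorem TensorProduct.eq_sum_of_mem_range_lTensor {V : Submodule k N} {v : ι → N}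
    {f : ι → N →ₗ[k] k} (hV : ∀ x ∈ V, x = ∑ i, f i x • v i) {y : M ⊗[k] N}
    (hy : y ∈ LinearMap.range (V.subtype.lTensor M)) :
    y = ∑ i, TensorProduct.rid k M ((f i).lTensor M y) ⊗ₜ[k] v i := by
  obtain ⟨y, rfl⟩ := hy
  induction y with
  | zero => simp
  | add x y hx hy =>
    simp only [map_add, TensorProduct.add_tmul, Finset.sum_add_distrib]
    rw [← hx, ← hy]
  | tmul m n =>
    simp only [LinearMap.lTensor_tmul, Submodule.subtype_apply, TensorProduct.rid_tmul,
      TensorProduct.smul_tmul]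
    rw [← TensorProduct.tmul_sum, ← hV _ n.2]

variable [DecidableEq ι] {H : Type*} [AddCommGroup H] [Module k H] [Coalgebra k H] {lam : N →ₗ[k] H ⊗[k] N}
  {v : ι → N} {f : ι → N →ₗ[k] k} {z : ι → ι → H}

theorem TensorProduct.comul_coefficient (hf : ∀ i j, f i (v j) = if j = i then 1 else 0)
    (hlam : ∀ i, lam (v i) = ∑ j, z i j ⊗ₜ[k] v j)
    (h : (TensorProduct.assoc k H H N).toLinearMap ∘ₗ (comul.rTensor N) ∘ₗ lam =
      (lam.lTensor H) ∘ₗ lam) (i j : ι) :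
    comul (R := k) (z i j) = ∑ l, z i l ⊗ₜ[k] z l j := by
  have h1 := congrArg (TensorProduct.assoc k H H N).symm (LinearMap.congr_fun h (v i))
  simp only [LinearMap.comp_apply, LinearEquiv.coe_coe, LinearEquiv.symm_apply_apply, hlam,
    map_sum, LinearMap.rTensor_tmul, LinearMap.lTensor_tmul, TensorProduct.tmul_sum,
    TensorProduct.assoc_symm_tmul] at h1
  rw [Finset.sum_comm] at h1
  simp only [← TensorProduct.sum_tmul] at h1
  exact TensorProduct.eq_of_sum_tmul_eq hf h1 j

theorem TensorProduct.counit_coefficient (hf : ∀ i j, f i (v j) = if j = i then 1 else 0)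
    (hlam : ∀ i, lam (v i) = ∑ j, z i j ⊗ₜ[k] v j)
    (h : (TensorProduct.lid k N).toLinearMap ∘ₗ (counit.rTensor N) ∘ₗ lam = LinearMap.id)
    (i j : ι) : counit (R := k) (z i j) = if i = j then 1 else 0 := by
  have h1 := congrArg (f j) (LinearMap.congr_fun h (v i))
  simpa [hlam, hf] using h1

end Coefficients

namespace PathAlgebra

variable {k : Type u} [Field k] {Q : Type v} [Quiver.{w} Q] [Fintype Q]
  [∀ i j : Q, Finite (i ⟶ j)] {I : TwoSidedIdeal (PathAlgebra k Q)}

theorem eq_sum_arr (hI : IsQuadratic I) {x : Quot I} (hx : x ∈ quotGrading I 1) :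
    x = ∑ p, arrCoeff hI p x • (quotRep I).arr p := by
  classical
  have h : quotGrading I 1 ≤ LinearMap.eqLocus (LinearMap.id : Quot I →ₗ[k] Quot I)
      (∑ p, (arrCoeff hI p).smulRight ((quotRep I).arr p)) := by
    refine quotGrading_induction fun i j a ha => ?_
    cases a with
    | nil => exact absurd ha.symm (Nat.succ_ne_zero _)
    | cons a p =>
      cases a with
      | nil =>
        have e : (quotRep I).eval (Quiver.Path.nil.cons p) = (quotRep I).arr ⟨i, j, p⟩ :=
          PathRep.eval_toPath _ p
        simp [LinearMap.mem_eqLocus, e, arrCoeff_arr]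
      | cons a q => exact absurd (Nat.succ.inj ha) (Nat.succ_ne_zero _)
  simpa using h hx

/-- A vector that is orthogonal to the quadratic relations defines a functional on the quadratic
algebra. -/
def perpCoeff (hI : IsQuadratic I) {g : QuiverPath.OfLength Q 2 → k}
    (hg : g ∈ (quadPart I).perp.toSubmodule) : Quot I →ₗ[k] k :=
  I.liftₗ (∑ c, g c • coeffₗ c.1) fun x hx => by
    have h : ∑ c, quadVec k Q x c * g c = 0 := hg _ (hI.le_aboveQuad hx).2
    simpa [quadVec_apply, mul_comm] using h

theorem perpCoeff_eval (hI : IsQuadratic I) {g : QuiverPath.OfLength Q 2 → k}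
    (hg : g ∈ (quadPart I).perp.toSubmodule) (c : QuiverPath.OfLength Q 2) :
    perpCoeff hI hg ((quotRep I).eval c.1.path) = g c := by
  classical
  rw [eval_quotRep, perpCoeff, TwoSidedIdeal.liftₗ_mk, LinearMap.sum_apply,
    Finset.sum_eq_single c]
  · rw [LinearMap.smul_apply, coeffₗ_ofPath, if_pos rfl, smul_eq_mul, mul_one]
  · intro b _ hb
    rw [LinearMap.smul_apply, coeffₗ_ofPath, if_neg, smul_zero]
    exact fun e => hb (Subtype.ext e.symm)
  · simp

variable {H : Type*} [Ring H] [Algebra k H]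

/-- The coefficients of a linear map on the vertices. -/
def vertMat (hI : IsQuadratic I) (lam : Quot I →ₗ[k] H ⊗[k] Quot I) (i j : Q) : H :=
  TensorProduct.rid k H ((vertCoeff hI j).lTensor H (lam ((quotRep I).vert i)))

/-- The coefficients of a linear map on the arrows. -/
def arrMat (hI : IsQuadratic I) (lam : Quot I →ₗ[k] H ⊗[k] Quot I) (p q : QuiverArrow Q) : H :=
  TensorProduct.rid k H ((arrCoeff hI q).lTensor H (lam ((quotRep I).arr p)))

end PathAlgebra

theorem IsLeftCoaction.isMultiplicative {k A H : Type*} [Field k] [Ring A] [Algebra k A] [Ring H]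
    [Algebra k H] [WeakBialgebra k H] {𝒜 : ℕ → Submodule k A} {lam : A →ₗ[k] H ⊗[k] A}
    (h : IsLeftCoaction 𝒜 lam) : lam.IsMultiplicative :=
  h.map_mul

namespace IsLeftCoaction

open PathAlgebra

variable {k : Type u} [Field k] {Q : Type v} [Quiver.{w} Q] [Fintype Q]
  [∀ i j : Q, Finite (i ⟶ j)] {I : TwoSidedIdeal (PathAlgebra k Q)} {H : Type*} [Ring H]
  [Algebra k H] [WeakBialgebra k H] {lam : Quot I →ₗ[k] H ⊗[k] Quot I}

theorem apply_vert (h : IsLeftCoaction (quotGrading I) lam) (hI : IsQuadratic I) (i : Q) :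
    lam ((quotRep I).vert i) = ∑ j, vertMat hI lam i j ⊗ₜ[k] (quotRep I).vert j := by
  classical
  exact TensorProduct.eq_sum_of_mem_range_lTensor (fun _ => eq_sum_vert hI)
    (h.linear 0 _ (vert_quotRep_mem I i))

theorem apply_arr (h : IsLeftCoaction (quotGrading I) lam) (hI : IsQuadratic I)
    (p : QuiverArrow Q) :
    lam ((quotRep I).arr p) = ∑ q, arrMat hI lam p q ⊗ₜ[k] (quotRep I).arr q := by
  classical
  exact TensorProduct.eq_sum_of_mem_range_lTensor (fun _ => eq_sum_arr hI)
    (h.linear 1 _ (arr_quotRep_mem I p))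

-- The idempotents are the images of the vertices under the isomorphism `ψ` with `H_t`; their dual
-- functionals are the vertex coefficients after a left inverse of `ψ`.
open Classical in
theorem exists_isBaseMatrix (h : IsLeftCoaction (quotGrading I) lam) (hI : IsQuadratic I)
    (hb : IsLeftBasePreserving (quotGrading I) lam) :
    ∃ (t : Q → H) (τ : Q → H →ₗ[k] k), WeakBialgebra.IsBaseMatrix (vertMat hI lam) t τ := by
  obtain ⟨ψ, hψ, hrange, hcom⟩ := hb
  obtain ⟨g, hg⟩ := ψ.toLinearMap.exists_leftInverse_of_injective (LinearMap.ker_eq_bot.2 hψ)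
  refine ⟨fun i => ψ (vertZero I i), fun i => vertCoeff hI i ∘ₗ (quotGrading I 0).subtype ∘ₗ g,
    fun i j => ?_, ?_, fun i j => ?_, fun i => ?_, fun i => ?_,
    TensorProduct.comul_coefficient (vertCoeff_vert hI) (h.apply_vert hI) h.coassoc,
    TensorProduct.counit_coefficient (vertCoeff_vert hI) (h.apply_vert hI) h.counit⟩
  · rw [← _root_.map_mul, vertZero_mul_vertZero]
    split_ifs <;> simp
  · rw [← map_sum, ← one_eq_sum_vertZero, _root_.map_one]
  · have e : g (ψ (vertZero I j)) = vertZero I j := LinearMap.congr_fun hg _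
    simp only [LinearMap.comp_apply, e]
    exact vertCoeff_vert hI i j
  · rw [← hrange]
    exact ⟨_, rfl⟩
  · obtain ⟨y, hy, hy'⟩ := hcom (vertZero I i)
    have e : y = ∑ j, vertMat hI lam i j ⊗ₜ[k] vertZero I j := by
      -- The inclusion of degree 0 stays injective after tensoring with `H`, so `y` is determined by
      -- its image `λ(e_i)`.
      refine Module.Flat.lTensor_preserves_injective_linearMap (M := H)
        (quotGrading I 0).subtype (Submodule.subtype_injective _) ?_
      rw [hy]
      simpa [vertZero] using h.apply_vert hI i
    rw [← hy', e]
    simp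

/-- The corepresentation given by the coefficients of a coaction. -/
def toPathRep (h : IsLeftCoaction (quotGrading I) lam) (hI : IsQuadratic I)
    (hb : IsLeftBasePreserving (quotGrading I) lam) : PathRep (SquareVertex Q) H where
  vert x := vertMat hI lam x.fst x.snd
  arr x := arrMat hI lam x.fst x.snd
  vert_mul_self x := by
    classical
    obtain ⟨t, τ, ht⟩ := h.exists_isBaseMatrix hI hb
    rw [ht.mat_mul_mat, if_pos ⟨rfl, rfl⟩]
  vert_mul_of_ne x y hxy := by
    classical
    -- Multiplicativity of `λ` on vertices only controls products of entries in a common column; for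
    -- different columns the base preserving property is needed.
    obtain ⟨t, τ, ht⟩ := h.exists_isBaseMatrix hI hb
    rw [ht.mat_mul_mat, if_neg fun e => hxy (SquareVertex.ext e.1 e.2)]
  src_mul x := by
    classical
    -- Apply `λ` to `e_{s(p)} p = p` and compare the coefficients of the arrows.
    have h1 := h.map_mul ((quotRep I).vert x.fst.src) ((quotRep I).arr x.fst)
    rw [PathRep.src_mul, h.apply_vert hI, h.apply_arr hI, Finset.sum_mul_sum,
      Finset.sum_comm] at h1
    simp only [Algebra.TensorProduct.tmul_mul_tmul, PathRep.vert_mul_arr, TensorProduct.tmul_ite,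
      Finset.sum_ite_eq', Finset.mem_univ, if_true] at h1
    exact (TensorProduct.eq_of_sum_tmul_eq (arrCoeff_arr hI) h1 x.snd).symm
  mul_tgt x := by
    classical
    have h1 := h.map_mul ((quotRep I).arr x.fst) ((quotRep I).vert x.fst.tgt)
    rw [PathRep.mul_tgt, h.apply_vert hI, h.apply_arr hI, Finset.sum_mul_sum] at h1
    simp only [Algebra.TensorProduct.tmul_mul_tmul, PathRep.arr_mul_vert, TensorProduct.tmul_ite,
      Finset.sum_ite_eq, Finset.mem_univ, if_true] at h1
    exact (TensorProduct.eq_of_sum_tmul_eq (arrCoeff_arr hI) h1 x.snd).symm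

variable (h : IsLeftCoaction (quotGrading I) lam) (hI : IsQuadratic I)
    (hb : IsLeftBasePreserving (quotGrading I) lam)

theorem toPathRep_isCorep : (h.toPathRep hI hb).IsCorep (k := k) := by
  classical
  obtain ⟨t, τ, ht⟩ := h.exists_isBaseMatrix hI hb
  have hε := TensorProduct.counit_coefficient (arrCoeff_arr hI) (h.apply_arr hI) h.counit
  exact
    { isUnital := (SquareVertex.sum_eq _).trans ht.sum_mat
      comul_vert := ht.comul_mat
      comul_arr := TensorProduct.comul_coefficient (arrCoeff_arr hI) (h.apply_arr hI) h.coassoc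
      counit_vert_self := fun i => (ht.counit_mat i i).trans (if_pos rfl)
      counit_vert_of_ne := fun i j hij => (ht.counit_mat i j).trans (if_neg hij)
      counit_arr_self := fun p => (hε p p).trans (if_pos rfl)
      counit_arr_of_ne := fun p q hpq => (hε p q).trans (if_neg hpq) }

theorem apply_eval {i j : Q} (a : Quiver.Path i j) {n : ℕ} (ha : a.length = n) :
    lam ((quotRep I).eval a) = ∑ c : QuiverPath.OfLength Q n,
      (h.toPathRep hI hb).mat a c.1.path ⊗ₜ[k] (quotRep I).eval c.1.path := by
  have e : (quotRep I).map lam h.isMultiplicative = (h.toPathRep hI hb).act (k := k) (quotRep I) :=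
    PathRep.ext (funext fun i => h.apply_vert hI i) (funext fun p => h.apply_arr hI p)
  rw [← PathRep.eval_act_eq_sum _ _ a ha, ← e, PathRep.eval_map]

/-- For `f ∈ X` the element `∑ f_a a` is `0` in `kQ/I`. Apply `λ` and then the functional with
coefficients `g`, which is well defined on `kQ/I` because `g` is orthogonal to `X`. -/
theorem toPathRep_compatible : (h.toPathRep hI hb).Compatible (quadPart I) := fun f hf g hg => by
  have h1 := congrArg (fun x => TensorProduct.rid k H ((perpCoeff hI hg).lTensor H (lam x)))
    (sum_smul_eval_eq_zero hf)
  simp only [map_sum, map_smul, fun a : QuiverPath.OfLength Q 2 => h.apply_eval hI hb a.1.path a.2,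
    LinearMap.lTensor_tmul, TensorProduct.rid_tmul, perpCoeff_eval, map_zero, Finset.smul_sum,
    smul_smul] at h1
  exact h1

/-- With `coactMap_isLeftCoaction` and `coactMap_isLeftBasePreserving`, this identifies coactions
with compatible corepresentations. -/
theorem eq_coactMap :
    lam = coactMap hI (h.toPathRep hI hb) (h.toPathRep_compatible hI hb) :=
  quot_ext_of_isMultiplicative h.isMultiplicative (coactMap_isMultiplicative _ _ _)
    (fun i => by rw [coactMap_vert]; exact h.apply_vert hI i)
    fun p => by rw [coactMap_arr]; exact h.apply_arr hI p

end IsLeftCoaction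

/-! ### Left and right coactions -/

section Legs

variable {k : Type*} {H : Type*} [Field k] [Ring H] [Algebra k H] [WeakBialgebra k H]

/-- The element is fixed by `ε_s`: apply `id ⊗ ε ⊗ f` to `(1 ⊗ Δ(1))(Δ(1) ⊗ 1) = Δ²(1)`. So `H_s`
consists of the left legs of `Δ(1)`, and the mirror argument gives `H_t` as its right legs; this
description is symmetric under reversing `Δ`. -/
theorem rid_lTensor_comul_one_mem (f : H →ₗ[k] k) :
    TensorProduct.rid k H (f.lTensor H (comul (1 : H))) ∈ sourceCounitalSub k H := by
  refine ⟨TensorProduct.rid k H (f.lTensor H (comul (1 : H))), ?_⟩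
  let G : (H ⊗[k] H) ⊗[k] H →ₗ[k] H := (TensorProduct.rid k H).toLinearMap ∘ₗ
    TensorProduct.map ((TensorProduct.rid k H).toLinearMap ∘ₗ (counit (R := k)).lTensor H) f
  have h1 : ∀ y y' : H ⊗[k] H, TensorProduct.rid k H
      ((counit ∘ₗ LinearMap.mulLeft k (TensorProduct.rid k H (f.lTensor H y'))).lTensor H y) =
      G ((TensorProduct.assoc k H H H).symm ((1 : H) ⊗ₜ[k] y') * (y ⊗ₜ[k] (1 : H))) :=
    fun y y' => by
      induction y with
      | zero => simp
      | add x y hx hy => simp only [map_add, TensorProduct.add_tmul, mul_add, hx, hy]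
      | tmul a b =>
        induction y' with
        | zero => simp
        | add x y hx hy =>
          simp only [LinearMap.lTensor_tmul, TensorProduct.rid_tmul, LinearMap.comp_apply,
            LinearMap.mulLeft_apply] at hx hy
          simp only [LinearMap.lTensor_tmul, TensorProduct.rid_tmul, LinearMap.comp_apply,
            LinearMap.mulLeft_apply, map_add, TensorProduct.tmul_add, add_mul, hx, hy]
        | tmul c d => simp [G, smul_smul]
  have h2 : ∀ y : H ⊗[k] H, G ((comul (R := k)).rTensor H y) =
      TensorProduct.rid k H (f.lTensor H y) := fun y => by
    induction y with
    | zero => simp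
    | add x y hx hy => simp only [map_add, hx, hy]
    | tmul a b => simp [G]
  refine (h1 _ _).trans ?_
  rw [← WeakBialgebra.comul_comul_one', h2]

theorem lid_rTensor_comul_one_mem (f : H →ₗ[k] k) :
    TensorProduct.lid k H (f.rTensor H (comul (1 : H))) ∈ targetCounitalSub k H := by
  refine ⟨TensorProduct.lid k H (f.rTensor H (comul (1 : H))), ?_⟩
  let G : (H ⊗[k] H) ⊗[k] H →ₗ[k] H := (TensorProduct.lid k H).toLinearMap ∘ₗ
    ((TensorProduct.lid k k).toLinearMap ∘ₗ TensorProduct.map f (counit (R := k))).rTensor H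
  have h1 : ∀ y y' : H ⊗[k] H, TensorProduct.lid k H
      ((counit ∘ₗ LinearMap.mulRight k (TensorProduct.lid k H (f.rTensor H y'))).rTensor H y) =
      G ((TensorProduct.assoc k H H H).symm ((1 : H) ⊗ₜ[k] y) * (y' ⊗ₜ[k] (1 : H))) :=
    fun y y' => by
      induction y with
      | zero => simp
      | add x y hx hy => simp only [map_add, TensorProduct.tmul_add, add_mul, hx, hy]
      | tmul a b =>
        induction y' with
        | zero => simp
        | add x y hx hy =>
          simp only [LinearMap.rTensor_tmul, TensorProduct.lid_tmul, LinearMap.comp_apply,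
            LinearMap.mulRight_apply] at hx hy
          simp only [LinearMap.rTensor_tmul, TensorProduct.lid_tmul, LinearMap.comp_apply,
            LinearMap.mulRight_apply, map_add, TensorProduct.add_tmul, mul_add, hx, hy]
        | tmul c d => simp [G]
  have h2 : ∀ y : H ⊗[k] H, G ((TensorProduct.assoc k H H H).symm ((comul (R := k)).lTensor H y)) =
      TensorProduct.lid k H (f.rTensor H y) := fun y => by
    induction y with
    | zero => simp
    | add x y hx hy => simp only [map_add, hx, hy]
    | tmul a b =>
      have h3 : ∀ z : H ⊗[k] H, G ((TensorProduct.assoc k H H H).symm (a ⊗ₜ[k] z)) =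
          f a • TensorProduct.lid k H ((counit (R := k)).rTensor H z) := fun z => by
        induction z with
        | zero => simp
        | add x y hx hy => simp only [map_add, TensorProduct.tmul_add, smul_add, hx, hy]
        | tmul c d => simp [G, smul_smul]
      simp [h3]
  refine (h1 _ _).trans ?_
  rw [← WeakBialgebra.comul_comul_one', ← h2, ← Coalgebra.coassoc_apply,
    LinearEquiv.symm_apply_apply]

end Legs

/-- An isomorphism of algebras that reverses the comultiplication. -/
structure AlgEquiv.IsCoAnti {k H K : Type*} [Field k] [Ring H] [Algebra k H] [Coalgebra k H]
    [Ring K] [Algebra k K] [Coalgebra k K] (φ : H ≃ₐ[k] K) : Prop where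
  comul_apply : ∀ x, comul (R := k) (φ x) = TensorProduct.comm k K K
    (TensorProduct.map φ.toLinearMap φ.toLinearMap (comul (R := k) x))
  counit_apply : ∀ x, counit (R := k) (φ x) = counit (R := k) x

namespace AlgEquiv.IsCoAnti

section

variable {k H K : Type*} [Field k] [Ring H] [Algebra k H] [Coalgebra k H]
    [Ring K] [Algebra k K] [Coalgebra k K] {φ : H ≃ₐ[k] K}

theorem symm (hφ : φ.IsCoAnti) : φ.symm.IsCoAnti where
  comul_apply x := by
    obtain ⟨x, rfl⟩ := φ.surjective x
    rw [hφ.comul_apply, AlgEquiv.symm_apply_apply]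
    generalize comul (R := k) x = y
    induction y with
    | zero => simp
    | add x y hx hy => simp only [map_add, ← hx, ← hy]
    | tmul a b => simp
  counit_apply x := by
    obtain ⟨x, rfl⟩ := φ.surjective x
    rw [hφ.counit_apply, AlgEquiv.symm_apply_apply]

end

variable {k H K : Type*} [Field k] [Ring H] [Algebra k H] [WeakBialgebra k H]
    [Ring K] [Algebra k K] [WeakBialgebra k K] {φ : H ≃ₐ[k] K}

/-- Reversing the comultiplication turns left legs of `Δ(1)` into right legs. -/
theorem map_mem_targetCounitalSub (hφ : φ.IsCoAnti) {x : H} (hx : x ∈ sourceCounitalSub k H) :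
    φ x ∈ targetCounitalSub k K := by
  obtain ⟨x, rfl⟩ := hx
  convert lid_rTensor_comul_one_mem ((counit ∘ₗ LinearMap.mulLeft k x) ∘ₗ φ.symm.toLinearMap)
  rw [← map_one φ, hφ.comul_apply]
  change φ (TensorProduct.rid k H _) = _
  generalize comul (R := k) (1 : H) = y
  induction y with
  | zero => simp
  | add x y hx hy => simp only [map_add, hx, hy]
  | tmul a b => simp

theorem map_mem_sourceCounitalSub (hφ : φ.IsCoAnti) {x : H} (hx : x ∈ targetCounitalSub k H) :
    φ x ∈ sourceCounitalSub k K := by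
  obtain ⟨x, rfl⟩ := hx
  convert rid_lTensor_comul_one_mem ((counit ∘ₗ LinearMap.mulRight k x) ∘ₗ φ.symm.toLinearMap)
  rw [← map_one φ, hφ.comul_apply]
  change φ (TensorProduct.lid k H _) = _
  generalize comul (R := k) (1 : H) = y
  induction y with
  | zero => simp
  | add x y hx hy => simp only [map_add, hx, hy]
  | tmul a b => simp

theorem map_sourceCounitalSub (hφ : φ.IsCoAnti) :
    (sourceCounitalSub k H).map φ.toLinearMap = targetCounitalSub k K := by
  refine le_antisymm ?_ fun x hx => ⟨φ.symm x, hφ.symm.map_mem_sourceCounitalSub hx, ?_⟩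
  · rintro _ ⟨x, hx, rfl⟩
    exact hφ.map_mem_targetCounitalSub hx
  · exact φ.apply_symm_apply x

theorem map_targetCounitalSub (hφ : φ.IsCoAnti) :
    (targetCounitalSub k H).map φ.toLinearMap = sourceCounitalSub k K := by
  refine le_antisymm ?_ fun x hx => ⟨φ.symm x, hφ.symm.map_mem_targetCounitalSub hx, ?_⟩
  · rintro _ ⟨x, hx, rfl⟩
    exact hφ.map_mem_sourceCounitalSub hx
  · exact φ.apply_symm_apply x

end AlgEquiv.IsCoAnti

theorem CoOpposite.of_isCoAnti (k H : Type*) [Field k] [Ring H] [Algebra k H] [Coalgebra k H] :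
    (CoOpposite.of k H).IsCoAnti := by
  refine ⟨fun x => ?_, fun x => rfl⟩
  rw [CoOpposite.comul_of]
  generalize comul (R := k) x = y
  induction y with
  | zero => simp
  | add x y hx hy => simp only [map_add, hx, hy]
  | tmul a b => simp

section Flip

variable {k A H K : Type*} [Field k] [Ring A] [Algebra k A] [Ring H] [Algebra k H]
  [Ring K] [Algebra k K]

/-- The left coaction of the co-opposite that corresponds to a right coaction. -/
def LinearMap.leftOfRight (φ : H ≃ₐ[k] K) (rho : A →ₗ[k] A ⊗[k] H) : A →ₗ[k] K ⊗[k] A :=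
  φ.toLinearMap.rTensor A ∘ₗ (TensorProduct.comm k A H).toLinearMap ∘ₗ rho

/-- The right coaction of the co-opposite that corresponds to a left coaction. -/
def LinearMap.rightOfLeft (φ : H ≃ₐ[k] K) (lam : A →ₗ[k] H ⊗[k] A) : A →ₗ[k] A ⊗[k] K :=
  φ.toLinearMap.lTensor A ∘ₗ (TensorProduct.comm k H A).toLinearMap ∘ₗ lam

variable [WeakBialgebra k H] [WeakBialgebra k K] {𝒜 : ℕ → Submodule k A}
  {φ : H ≃ₐ[k] K}

theorem IsLeftCoaction.rightOfLeft {lam : A →ₗ[k] H ⊗[k] A} (h : IsLeftCoaction 𝒜 lam)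
    (hφ : φ.IsCoAnti) : IsRightCoaction 𝒜 (lam.rightOfLeft φ) where
  coassoc := by
    -- `T` reverses the order of the three tensor factors and applies `φ`. It carries the two sides
    -- of the left coassociativity law to those of the right one.
    let T : (H ⊗[k] H) ⊗[k] A →ₗ[k] A ⊗[k] (K ⊗[k] K) :=
      (TensorProduct.comm k (K ⊗[k] K) A).toLinearMap ∘ₗ
        ((TensorProduct.comm k K K).toLinearMap ∘ₗ
          TensorProduct.map φ.toLinearMap φ.toLinearMap).rTensor A
    have h1 : ∀ y : H ⊗[k] A, TensorProduct.assoc k A K K ((lam.rightOfLeft φ).rTensor K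
        (φ.toLinearMap.lTensor A (TensorProduct.comm k H A y))) =
        T ((TensorProduct.assoc k H H A).symm (lam.lTensor H y)) := fun y => by
      induction y with
      | zero => simp
      | add x y hx hy => simp only [map_add, hx, hy]
      | tmul a b =>
        simp only [LinearMap.rightOfLeft, TensorProduct.comm_tmul, LinearMap.lTensor_tmul,
          LinearMap.rTensor_tmul, LinearMap.comp_apply, LinearEquiv.coe_coe]
        generalize lam b = z
        induction z with
        | zero => simp
        | add x y hx hy =>
          simp only [map_add, TensorProduct.tmul_add, TensorProduct.add_tmul, hx, hy]
        | tmul c d => simp [T]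
    have h2 : ∀ y : H ⊗[k] A, (comul (R := k)).lTensor A
        (φ.toLinearMap.lTensor A (TensorProduct.comm k H A y)) =
        T ((comul (R := k)).rTensor A y) := fun y => by
      induction y with
      | zero => simp
      | add x y hx hy => simp only [map_add, hx, hy]
      | tmul a b => simp [T, hφ.comul_apply]
    refine LinearMap.ext fun a => (h1 (lam a)).trans ((congrArg T ?_).trans (h2 (lam a)).symm)
    rw [LinearEquiv.symm_apply_eq]
    exact (LinearMap.congr_fun h.coassoc a).symm
  counit := by
    have h1 : ∀ y : H ⊗[k] A, TensorProduct.rid k A ((Coalgebra.counit (R := k)).lTensor A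
        (φ.toLinearMap.lTensor A (TensorProduct.comm k H A y))) =
        TensorProduct.lid k A ((Coalgebra.counit (R := k)).rTensor A y) := fun y => by
      induction y with
      | zero => simp
      | add x y hx hy => simp only [map_add, hx, hy]
      | tmul a b => simp [hφ.counit_apply]
    exact LinearMap.ext fun a => (h1 (lam a)).trans (LinearMap.congr_fun h.counit a)
  map_mul := ((LinearMap.IsMultiplicative.id.map (.of_algHom φ.toAlgHom)).comp
    (LinearMap.IsMultiplicative.comm.comp h.isMultiplicative))
  map_one := by
    obtain ⟨y, hy⟩ := h.map_one
    change φ.toLinearMap.lTensor A (TensorProduct.comm k H A (lam 1)) ∈ _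
    rw [← hy]
    clear hy
    induction y with
    | zero => simp
    | add x y hx hy =>
      rw [map_add, map_add, map_add]
      exact Submodule.add_mem _ hx hy
    | tmul a b => exact ⟨b ⊗ₜ[k] ⟨φ a, hφ.map_mem_targetCounitalSub a.2⟩, by simp⟩
  linear n a ha := by
    obtain ⟨y, hy⟩ := h.linear n a ha
    change φ.toLinearMap.lTensor A (TensorProduct.comm k H A (lam a)) ∈ _
    rw [← hy]
    clear hy
    induction y with
    | zero => simp
    | add x y hx hy =>
      rw [map_add, map_add, map_add]
      exact Submodule.add_mem _ hx hy
    | tmul a b => exact ⟨b ⊗ₜ[k] φ a, by simp⟩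

theorem IsRightCoaction.leftOfRight {rho : A →ₗ[k] A ⊗[k] H} (h : IsRightCoaction 𝒜 rho)
    (hφ : φ.IsCoAnti) : IsLeftCoaction 𝒜 (rho.leftOfRight φ) where
  coassoc := by
    let T : A ⊗[k] (H ⊗[k] H) →ₗ[k] (K ⊗[k] K) ⊗[k] A :=
      (TensorProduct.comm k A (K ⊗[k] K)).toLinearMap ∘ₗ
        ((TensorProduct.comm k K K).toLinearMap ∘ₗ
          TensorProduct.map φ.toLinearMap φ.toLinearMap).lTensor A
    have h1 : ∀ y : A ⊗[k] H, (TensorProduct.assoc k K K A).symm ((rho.leftOfRight φ).lTensor K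
        (φ.toLinearMap.rTensor A (TensorProduct.comm k A H y))) =
        T (TensorProduct.assoc k A H H (rho.rTensor H y)) := fun y => by
      induction y with
      | zero => simp
      | add x y hx hy => simp only [map_add, hx, hy]
      | tmul a b =>
        simp only [LinearMap.leftOfRight, TensorProduct.comm_tmul, LinearMap.lTensor_tmul,
          LinearMap.rTensor_tmul, LinearMap.comp_apply, LinearEquiv.coe_coe]
        generalize rho a = z
        induction z with
        | zero => simp
        | add x y hx hy =>
          simp only [map_add, TensorProduct.tmul_add, TensorProduct.add_tmul, hx, hy]
        | tmul c d => simp [T]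
    have h2 : ∀ y : A ⊗[k] H, (comul (R := k)).rTensor A
        (φ.toLinearMap.rTensor A (TensorProduct.comm k A H y)) =
        T ((comul (R := k)).lTensor A y) := fun y => by
      induction y with
      | zero => simp
      | add x y hx hy => simp only [map_add, hx, hy]
      | tmul a b => simp [T, hφ.comul_apply]
    refine LinearMap.ext fun a => (LinearEquiv.eq_symm_apply _).1 ((h2 (rho a)).trans
      ((congrArg T ?_).trans (h1 (rho a)).symm))
    exact (LinearMap.congr_fun h.coassoc a).symm
  counit := by
    have h1 : ∀ y : A ⊗[k] H, TensorProduct.lid k A ((Coalgebra.counit (R := k)).rTensor A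
        (φ.toLinearMap.rTensor A (TensorProduct.comm k A H y))) =
        TensorProduct.rid k A ((Coalgebra.counit (R := k)).lTensor A y) := fun y => by
      induction y with
      | zero => simp
      | add x y hx hy => simp only [map_add, hx, hy]
      | tmul a b => simp [hφ.counit_apply]
    exact LinearMap.ext fun a => (h1 (rho a)).trans (LinearMap.congr_fun h.counit a)
  map_mul := ((LinearMap.IsMultiplicative.map (.of_algHom φ.toAlgHom) .id).comp
    (LinearMap.IsMultiplicative.comm.comp h.map_mul))
  map_one := by
    obtain ⟨y, hy⟩ := h.map_one
    change φ.toLinearMap.rTensor A (TensorProduct.comm k A H (rho 1)) ∈ _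
    rw [← hy]
    clear hy
    induction y with
    | zero => simp
    | add x y hx hy =>
      rw [map_add, map_add, map_add]
      exact Submodule.add_mem _ hx hy
    | tmul a b => exact ⟨⟨φ b, hφ.map_mem_sourceCounitalSub b.2⟩ ⊗ₜ[k] a, by simp⟩
  linear n a ha := by
    obtain ⟨y, hy⟩ := h.linear n a ha
    change φ.toLinearMap.rTensor A (TensorProduct.comm k A H (rho a)) ∈ _
    rw [← hy]
    clear hy
    induction y with
    | zero => simp
    | add x y hx hy =>
      rw [map_add, map_add, map_add]
      exact Submodule.add_mem _ hx hy
    | tmul a b => exact ⟨φ b ⊗ₜ[k] a, by simp⟩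

variable [SetLike.GradedMonoid 𝒜]

theorem IsLeftBasePreserving.rightOfLeft {lam : A →ₗ[k] H ⊗[k] A}
    (h : IsLeftBasePreserving 𝒜 lam) (hφ : φ.IsCoAnti) :
    IsRightBasePreserving 𝒜 (lam.rightOfLeft φ) := by
  obtain ⟨ψ, hψ, hrange, hcom⟩ := h
  refine ⟨φ.toAlgHom.comp ψ, φ.injective.comp hψ, ?_, fun a => ?_⟩
  · rw [← hφ.map_targetCounitalSub, ← hrange, ← LinearMap.range_comp]
    rfl
  · obtain ⟨y, hy, hy'⟩ := hcom a
    refine ⟨φ.toLinearMap.lTensor _ (TensorProduct.comm k H _ y), ?_, ?_⟩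
    · rw [LinearMap.rightOfLeft, LinearMap.comp_apply, LinearMap.comp_apply, ← hy]
      clear hy hy'
      induction y with
      | zero => simp
      | add x y hx hy => simp only [map_add, hx, hy]
      | tmul a b => simp
    · refine Eq.trans ?_ (hφ.comul_apply (ψ a)).symm
      rw [← hy']
      clear hy hy'
      induction y with
      | zero => simp
      | add x y hx hy => simp only [map_add, hx, hy]
      | tmul a b => simp

theorem IsRightBasePreserving.leftOfRight {rho : A →ₗ[k] A ⊗[k] H}
    (h : IsRightBasePreserving 𝒜 rho) (hφ : φ.IsCoAnti) :
    IsLeftBasePreserving 𝒜 (rho.leftOfRight φ) := by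
  obtain ⟨ψ, hψ, hrange, hcom⟩ := h
  refine ⟨φ.toAlgHom.comp ψ, φ.injective.comp hψ, ?_, fun a => ?_⟩
  · rw [← hφ.map_sourceCounitalSub, ← hrange, ← LinearMap.range_comp]
    rfl
  · obtain ⟨y, hy, hy'⟩ := hcom a
    refine ⟨φ.toLinearMap.rTensor _ (TensorProduct.comm k _ H y), ?_, ?_⟩
    · rw [LinearMap.leftOfRight, LinearMap.comp_apply, LinearMap.comp_apply, ← hy]
      clear hy hy'
      induction y with
      | zero => simp
      | add x y hx hy => simp only [map_add, hx, hy]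
      | tmul a b => simp
    · refine Eq.trans ?_ (hφ.comul_apply (ψ a)).symm
      rw [← hy']
      clear hy hy'
      induction y with
      | zero => simp
      | add x y hx hy => simp only [map_add, hx, hy]
      | tmul a b => simp

end Flip

/-! ### Universal quantum linear semigroupoids of quadratic algebras -/

theorem BialgHom.isMultiplicative {k A B : Type*} [Field k] [Ring A] [Algebra k A] [Coalgebra k A]
    [Ring B] [Algebra k B] [Coalgebra k B] (π : A →ₐc[k] B) : (π : A →ₗ[k] B).IsMultiplicative :=
  map_mul π

theorem PathRep.Compatible.of_cop {k : Type u} [Field k] {Q : Type v} [Quiver.{w} Q] [Fintype Q]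
    [∀ i j : Q, Finite (i ⟶ j)] {H : Type*} [Ring H] [Algebra k H]
    {D : PathRep (SquareVertex Q) H} {X : VertexSubmodule k Q}
    (h : (D.cop (k := k)).Compatible X) : D.Compatible X.perp :=
  (h.map (CoOpposite.of k H).symm.toLinearMap (.of_algHom (CoOpposite.of k H).symm.toAlgHom)).transpose

theorem LinearMap.rightOfLeft_leftOfRight {k A H K : Type*} [Field k] [Ring A] [Algebra k A]
    [Ring H] [Algebra k H] [Ring K] [Algebra k K] (φ : H ≃ₐ[k] K) (rho : A →ₗ[k] A ⊗[k] H) :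
    (rho.leftOfRight φ).rightOfLeft φ.symm = rho := by
  have h : ∀ y : A ⊗[k] H, φ.symm.toLinearMap.lTensor A (TensorProduct.comm k K A
      (φ.toLinearMap.rTensor A (TensorProduct.comm k A H y))) = y := fun y => by
    induction y with
    | zero => simp
    | add x y hx hy => simp only [map_add, hx, hy]
    | tmul a b => simp
  exact LinearMap.ext fun a => h (rho a)

theorem LinearMap.leftOfRight_lTensor_comp_rightOfLeft {k A H K H' K' : Type*} [Field k]
    [Ring A] [Algebra k A] [Ring H] [Algebra k H] [Ring K] [Algebra k K] [Ring H'] [Algebra k H']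
    [Ring K'] [Algebra k K'] (φ : H ≃ₐ[k] K) (φ' : K' ≃ₐ[k] H') (f : K →ₗ[k] K')
    (lam : A →ₗ[k] H ⊗[k] A) :
    (f.lTensor A ∘ₗ lam.rightOfLeft φ).leftOfRight φ' =
      (φ'.toLinearMap ∘ₗ f ∘ₗ φ.toLinearMap).rTensor A ∘ₗ lam := by
  have h : ∀ y : H ⊗[k] A, φ'.toLinearMap.rTensor A (TensorProduct.comm k A K' (f.lTensor A
      (φ.toLinearMap.lTensor A (TensorProduct.comm k H A y)))) =
      (φ'.toLinearMap ∘ₗ f ∘ₗ φ.toLinearMap).rTensor A y := fun y => by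
    induction y with
    | zero => simp
    | add x y hx hy => simp only [map_add, hx, hy]
    | tmul a b => simp
  exact LinearMap.ext fun a => h (lam a)

theorem LinearMap.leftOfRight_injective {k A H K : Type*} [Field k] [Ring A] [Algebra k A]
    [Ring H] [Algebra k H] [Ring K] [Algebra k K] (φ : H ≃ₐ[k] K) :
    Function.Injective (LinearMap.leftOfRight (A := A) φ) :=
  Function.LeftInverse.injective (rightOfLeft_leftOfRight φ)

namespace PathAlgebra

variable {k : Type u} [Field k] {Q : Type v} [Quiver.{w} Q] [Fintype Q]
  [∀ i j : Q, Finite (i ⟶ j)] {I : TwoSidedIdeal (PathAlgebra k Q)}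

section

variable {H K : Type*} [Ring H] [Algebra k H] [Ring K] [Algebra k K] (hI : IsQuadratic I)

theorem rTensor_comp_coactMap {D : PathRep (SquareVertex Q) H} (hc : D.Compatible (quadPart I))
    (φ : H →ₗ[k] K) (hφ : φ.IsMultiplicative) : φ.rTensor (Quot I) ∘ₗ coactMap hI D hc =
      coactMap hI (D.map φ hφ) (hc.map φ hφ) := by
  refine quot_ext_of_isMultiplicative ((hφ.map .id).comp (coactMap_isMultiplicative hI D hc))
    (coactMap_isMultiplicative hI _ _) (fun i => ?_) fun p => ?_
  · rw [LinearMap.comp_apply, coactMap_vert, coactMap_vert, map_sum]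
    rfl
  · rw [LinearMap.comp_apply, coactMap_arr, coactMap_arr, map_sum]
    rfl

/-- A quadratic ideal lies in degrees at least 2, so vertices and arrows stay independent in `kQ/I`
and the entries can be read off. -/
theorem coactMap_injective {D E : PathRep (SquareVertex Q) H} {hD : D.Compatible (quadPart I)}
    {hE : E.Compatible (quadPart I)} (h : coactMap hI D hD = coactMap hI E hE) : D = E := by
  classical
  refine PathRep.ext (funext fun x => ?_) (funext fun p => ?_)
  · have h1 := LinearMap.congr_fun h ((quotRep I).vert x.fst)
    rw [coactMap_vert, coactMap_vert] at h1
    exact TensorProduct.eq_of_sum_tmul_eq (vertCoeff_vert hI) h1 x.snd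
  · have h1 := LinearMap.congr_fun h ((quotRep I).arr p.fst)
    rw [coactMap_arr, coactMap_arr] at h1
    exact TensorProduct.eq_of_sum_tmul_eq (arrCoeff_arr hI) h1 p.snd

end

section

variable {H : Type*} [Ring H] [Algebra k H] [WeakBialgebra k H] (hI : IsQuadratic I)
  {S : Set (VertexSubmodule k Q)} (hS : quadPart I ∈ S)

/-- This turns intertwining of coactions into a prescription of `π` on generators, whence existence
and uniqueness. -/
theorem rTensor_comp_coactMap_rep_eq_iff {D : PathRep (SquareVertex Q) H}
    (hc : D.Compatible (quadPart I)) (π : UnivMat S →ₐc[k] H) :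
    (π : UnivMat S →ₗ[k] H).rTensor (Quot I) ∘ₗ
        coactMap hI (UnivMat.rep S) (UnivMat.rep_compatible S hS) = coactMap hI D hc ↔
      (UnivMat.rep S).map (π : UnivMat S →ₗ[k] H) π.isMultiplicative = D := by
  rw [rTensor_comp_coactMap hI _ _ π.isMultiplicative]
  refine ⟨coactMap_injective hI, ?_⟩
  rintro rfl
  rfl

theorem existsUnique_bialgHom {D : PathRep (SquareVertex Q) H}
    (hc : D.Compatible (quadPart I)) (hD : D.IsCorep (k := k)) (hDS : ∀ X ∈ S, D.Compatible X) :
    ∃! π : UnivMat S →ₐc[k] H, (π : UnivMat S →ₗ[k] H).rTensor (Quot I) ∘ₗ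
      coactMap hI (UnivMat.rep S) (UnivMat.rep_compatible S hS) = coactMap hI D hc := by
  refine ⟨UnivMat.hom D hD hDS, ?_, fun π hπ => ?_⟩
  · refine (rTensor_comp_coactMap_rep_eq_iff hI hS hc _).2 ?_
    exact PathRep.ext (funext fun x => UnivMat.hom_vert D hD hDS x)
      (funext fun p => UnivMat.hom_arr D hD hDS p)
  · have h := (rTensor_comp_coactMap_rep_eq_iff hI hS hc π).1 hπ
    refine UnivMat.bialgHom_ext (fun x => ?_) fun p => ?_
    · rw [UnivMat.hom_vert]
      exact congrFun (congrArg PathRep.vert h) x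
    · rw [UnivMat.hom_arr]
      exact congrFun (congrArg PathRep.arr h) p

end

/-- The left universal quantum linear semigroupoid of a quadratic algebra. -/
def univLeft (hI : IsQuadratic I) : OLeft I where
  carrier := UnivMat {quadPart I}
  coact := coactMap hI (UnivMat.rep _) (UnivMat.rep_compatible _ rfl)
  isCoaction := coactMap_isLeftCoaction hI _ _ (UnivMat.rep_isCorep _)
  basePreserving := coactMap_isLeftBasePreserving hI _ _ (UnivMat.rep_isCorep _)
  universal H _ _ _ lam h hb := by
    have := existsUnique_bialgHom hI (S := {quadPart I}) rfl (h.toPathRep_compatible hI hb)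
      (h.toPathRep_isCorep hI hb) (by
        rintro _ rfl
        exact h.toPathRep_compatible hI hb)
    rwa [← h.eq_coactMap hI hb] at this

/-- Homomorphisms `L^cop → H` and `L → H^cop` correspond to each other, with matching intertwining
conditions. So the right universal property of `L^cop` is the left one of `L`. -/
theorem existsUnique_cop {L H : Type*} [Ring L] [Algebra k L] [WeakBialgebra k L] [Ring H]
    [Algebra k H] [WeakBialgebra k H] {A : Type*} [Ring A] [Algebra k A]
    {lam : A →ₗ[k] L ⊗[k] A} {rho : A →ₗ[k] A ⊗[k] H}
    (h : ∃! π : L →ₐc[k] CoOpposite H, (π : L →ₗ[k] CoOpposite H).rTensor A ∘ₗ lam =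
      rho.leftOfRight (CoOpposite.of k H)) :
    ∃! π : CoOpposite L →ₐc[k] H, (π : CoOpposite L →ₗ[k] H).lTensor A ∘ₗ
      lam.rightOfLeft (CoOpposite.of k L) = rho := by
  have key : ∀ π : CoOpposite L →ₐc[k] H, (π : CoOpposite L →ₗ[k] H).lTensor A ∘ₗ
      lam.rightOfLeft (CoOpposite.of k L) = rho ↔
      ((π.cop.comp (CoOpposite.copCop k L : L →ₐc[k] _) : L →ₐc[k] CoOpposite H) :
        L →ₗ[k] CoOpposite H).rTensor A ∘ₗ lam = rho.leftOfRight (CoOpposite.of k H) := fun π => by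
    rw [← (LinearMap.leftOfRight_injective (CoOpposite.of k H)).eq_iff,
      LinearMap.leftOfRight_lTensor_comp_rightOfLeft]
    rfl
  obtain ⟨π, hπ, huniq⟩ := h
  refine ⟨((CoOpposite.copCop k H).symm : _ →ₐc[k] H).comp π.cop, (key _).2 ?_, fun π' hπ' => ?_⟩
  · exact hπ
  · have := huniq _ ((key _).1 hπ')
    rw [← this]
    rfl

/-- The right universal quantum linear semigroupoid of a quadratic algebra. -/
def univRight (hI : IsQuadratic I) : ORight I where
  carrier := CoOpposite (univLeft hI).carrier
  coact := (univLeft hI).coact.rightOfLeft (CoOpposite.of k _)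
  isCoaction := (univLeft hI).isCoaction.rightOfLeft (CoOpposite.of_isCoAnti k _)
  basePreserving := (univLeft hI).basePreserving.rightOfLeft (CoOpposite.of_isCoAnti k _)
  universal H _ _ _ _ h hb := existsUnique_cop ((univLeft hI).universal _ _
    (h.leftOfRight (CoOpposite.of_isCoAnti k H)) (hb.leftOfRight (CoOpposite.of_isCoAnti k H)))

end PathAlgebra

/-! ### Transposed pairs of coactions -/

namespace PathRep

theorem ext_of_mat {Q : Type v} [Quiver.{w} Q] {B : Type*} [Ring B]
    {D E : PathRep (SquareVertex Q) B}
    (h : ∀ n < 2, ∀ a b : QuiverPath.OfLength Q n, D.mat a.1.path b.1.path = E.mat a.1.path b.1.path) :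
    D = E := by
  refine PathRep.ext (funext fun x => ?_) (funext fun p => ?_)
  · have := h 0 Nat.zero_lt_two ⟨QuiverPath.nil x.fst, rfl⟩ ⟨QuiverPath.nil x.snd, rfl⟩
    exact (D.mat_nil_nil _ _).symm.trans (this.trans (E.mat_nil_nil _ _))
  · have := h 1 Nat.one_lt_two ⟨p.fst.toPath, rfl⟩ ⟨p.snd.toPath, rfl⟩
    exact (D.mat_toPath _ _).symm.trans (this.trans (E.mat_toPath _ _))

end PathRep

namespace PathAlgebra

variable {k : Type u} [Field k] {Q : Type v} [Quiver.{w} Q] [Fintype Q]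
  {I : TwoSidedIdeal (PathAlgebra k Q)}

theorem quotPath_eq_eval (I : TwoSidedIdeal (PathAlgebra k Q)) {n : ℕ}
    (a : QuiverPath.OfLength Q n) : quotPath I n a = (quotRep I).eval a.1.path :=
  (eval_quotRep I a.1.path).symm

variable [∀ i j : Q, Finite (i ⟶ j)]

/-- Only lengths below 2 are allowed: classes of longer paths may be linearly dependent, and then
the coefficients `z` are not determined. -/
theorem mat_eq_of_apply_quotPath {H : Type*} [Ring H] [Algebra k H] [WeakBialgebra k H]
    {lam : Quot I →ₗ[k] H ⊗[k] Quot I} (h : IsLeftCoaction (quotGrading I) lam)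
    (hI : IsQuadratic I) (hb : IsLeftBasePreserving (quotGrading I) lam) {n : ℕ} (hn : n < 2)
    {a : QuiverPath.OfLength Q n} {z : QuiverPath.OfLength Q n → H}
    (ha : lam (quotPath I n a) = ∑ b, z b ⊗ₜ[k] quotPath I n b) (b : QuiverPath.OfLength Q n) :
    (h.toPathRep hI hb).mat a.1.path b.1.path = z b := by
  classical
  simp only [quotPath_eq_eval, h.apply_eval hI hb a.1.path a.2] at ha
  refine TensorProduct.eq_of_sum_tmul_eq
    (f := fun b : QuiverPath.OfLength Q n => quotCoeff hI b.1 (b.2.trans_lt hn)) (fun i j => ?_) ha b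
  rw [quotCoeff_eval]
  exact if_congr Subtype.ext_iff.symm rfl rfl

/-- Viewed as a left coaction of `H^cop`, the right coaction has the transposed matrix of `λ`. Its
compatibility with `X` therefore says that the matrix of `λ` is also compatible with `X^⊥`. -/
theorem toPathRep_eq_cop {H : Type*} [Ring H] [Algebra k H] [WeakBialgebra k H]
    {lam : Quot I →ₗ[k] H ⊗[k] Quot I} {rho : Quot I →ₗ[k] Quot I ⊗[k] H}
    (h : IsLeftCoaction (quotGrading I) lam) (hI : IsQuadratic I)
    (hb : IsLeftBasePreserving (quotGrading I) lam)
    (h' : IsLeftCoaction (quotGrading I) (rho.leftOfRight (CoOpposite.of k H)))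
    (hb' : IsLeftBasePreserving (quotGrading I) (rho.leftOfRight (CoOpposite.of k H)))
    (ht : AreTransposed (quotPath I) lam rho) :
    h'.toPathRep hI hb' = (h.toPathRep hI hb).cop (k := k) := by
  refine PathRep.ext_of_mat fun n hn a b => ?_
  obtain ⟨z, hz⟩ := ht n
  rw [PathRep.mat_cop, mat_eq_of_apply_quotPath h hI hb hn (hz b).1]
  refine mat_eq_of_apply_quotPath h' hI hb' hn (z := fun b => CoOpposite.of k H (z b a)) ?_ b
  rw [LinearMap.leftOfRight, LinearMap.comp_apply, LinearMap.comp_apply, (hz a).2]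
  simp

theorem rep_cop_compatible {S : Set (VertexSubmodule k Q)} {X : VertexSubmodule k Q}
    (h : X.perp ∈ S) : ((UnivMat.rep S).cop (k := k)).Compatible X := by
  have := (UnivMat.rep_compatible S h).cop
  rwa [X.perp_perp] at this

section

variable (hI : IsQuadratic I) {S : Set (VertexSubmodule k Q)} (hS : (quadPart I).perp ∈ S)

/-- The right coaction of `UnivMat S` given by transposition. -/
def rightCoactMap : Quot I →ₗ[k] Quot I ⊗[k] UnivMat S :=
  (coactMap hI ((UnivMat.rep S).cop (k := k)) (rep_cop_compatible hS)).rightOfLeft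
    (CoOpposite.of k (UnivMat S)).symm

theorem rightCoactMap_isRightCoaction :
    IsRightCoaction (quotGrading I) (rightCoactMap hI hS) :=
  (coactMap_isLeftCoaction hI _ _ (UnivMat.rep_isCorep S).cop).rightOfLeft
    (CoOpposite.of_isCoAnti k (UnivMat S)).symm

theorem rightCoactMap_isRightBasePreserving :
    IsRightBasePreserving (quotGrading I) (rightCoactMap hI hS) :=
  (coactMap_isLeftBasePreserving hI _ _ (UnivMat.rep_isCorep S).cop).rightOfLeft
    (CoOpposite.of_isCoAnti k (UnivMat S)).symm

theorem rightCoactMap_eval {n : ℕ} (a : QuiverPath.OfLength Q n) :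
    rightCoactMap hI hS ((quotRep I).eval a.1.path) = ∑ b : QuiverPath.OfLength Q n,
      (quotRep I).eval b.1.path ⊗ₜ[k] (UnivMat.rep S).mat b.1.path a.1.path := by
  rw [rightCoactMap, LinearMap.rightOfLeft, LinearMap.comp_apply, LinearMap.comp_apply,
    coactMap_eval_eq_sum hI _ _ a.1.path a.2]
  simp [PathRep.mat_cop]

theorem lTensor_comp_rightCoactMap {H : Type*} [Ring H] [Algebra k H] [WeakBialgebra k H]
    (π : UnivMat S →ₐc[k] H)
    (hc : (((UnivMat.rep S).map (π : UnivMat S →ₗ[k] H) π.isMultiplicative).cop (k := k)).Compatible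
      (quadPart I)) :
    ((π : UnivMat S →ₗ[k] H).lTensor (Quot I) ∘ₗ rightCoactMap hI hS).leftOfRight
      (CoOpposite.of k H) = coactMap hI _ hc := by
  have hm : (CoOpposite.of k (UnivMat S)).symm.toLinearMap.IsMultiplicative :=
    map_mul (CoOpposite.of k (UnivMat S)).symm
  rw [rightCoactMap, LinearMap.leftOfRight_lTensor_comp_rightOfLeft,
    rTensor_comp_coactMap hI _ _ (CoOpposite.of_isMultiplicative.comp (π.isMultiplicative.comp hm))]
  rfl

end

/-- The transposed universal quantum linear semigroupoid of a quadratic algebra. -/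
def univTrans (hI : IsQuadratic I) : OTrans I where
  carrier := UnivMat {quadPart I, (quadPart I).perp}
  leftCoact := coactMap hI (UnivMat.rep _) (UnivMat.rep_compatible _ (Set.mem_insert _ _))
  rightCoact := rightCoactMap hI (Set.mem_insert_of_mem _ rfl)
  isLeftCoaction := coactMap_isLeftCoaction hI _ _ (UnivMat.rep_isCorep _)
  isRightCoaction := rightCoactMap_isRightCoaction hI _
  transposed n := by
    refine ⟨fun a b => (UnivMat.rep _).mat a.1.path b.1.path, fun a => ⟨?_, ?_⟩⟩
    · simp only [quotPath_eq_eval]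
      exact coactMap_eval_eq_sum hI _ _ a.1.path a.2
    · simp only [quotPath_eq_eval]
      exact rightCoactMap_eval hI _ a
  leftBasePreserving := coactMap_isLeftBasePreserving hI _ _ (UnivMat.rep_isCorep _)
  rightBasePreserving := rightCoactMap_isRightBasePreserving hI _
  universal H _ _ _ lam rho h hr ht hb hrb := by
    have h' := hr.leftOfRight (CoOpposite.of_isCoAnti k H)
    have hb' := hrb.leftOfRight (CoOpposite.of_isCoAnti k H)
    have e := toPathRep_eq_cop h hI hb h' hb' ht
    have hc := h.toPathRep_compatible hI hb
    have hc' := h'.toPathRep_compatible hI hb'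
    rw [e] at hc'
    have hu := existsUnique_bialgHom hI (S := {quadPart I, (quadPart I).perp})
      (Set.mem_insert _ _) hc (h.toPathRep_isCorep hI hb) (by
        rintro _ (rfl | rfl)
        · exact hc
        · exact hc'.of_cop)
    rw [← h.eq_coactMap hI hb] at hu
    refine (existsUnique_congr fun π => ?_).1 hu
    -- The condition on `ρ` follows from that on `λ`, since both coactions are built from one matrix
    -- and its transpose.
    refine (and_iff_left_of_imp fun hπ => ?_).symm
    rw [h.eq_coactMap hI hb, rTensor_comp_coactMap_rep_eq_iff hI (Set.mem_insert _ _)] at hπ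
    rw [← hπ] at e hc'
    refine LinearMap.leftOfRight_injective (CoOpposite.of k H) ?_
    rw [lTensor_comp_rightCoactMap hI _ π hc', h'.eq_coactMap hI hb']
    congr 1
    exact e.symm

end PathAlgebra

/-! ### Uniqueness of universal quantum linear semigroupoids -/

section Uniqueness

variable {k : Type u} {A : Type v} [Field k] [Ring A] [Algebra k A]
  {𝒜 : ℕ → Submodule k A} [SetLike.GradedMonoid 𝒜]

theorem BialgHom.coe_id_linearMap {B : Type*} [Ring B] [Algebra k B] [Coalgebra k B] :
    ((BialgHom.id k B : B →ₐc[k] B) : B →ₗ[k] B) = LinearMap.id := rfl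

theorem BialgHom.coe_comp_linearMap {B C D : Type*} [Ring B] [Algebra k B] [Coalgebra k B]
    [Ring C] [Algebra k C] [Coalgebra k C] [Ring D] [Algebra k D] [Coalgebra k D]
    (g : C →ₐc[k] D) (f : B →ₐc[k] C) :
    (g.comp f : B →ₗ[k] D) = (g : C →ₗ[k] D) ∘ₗ (f : B →ₗ[k] C) := rfl

theorem BialgHom.nonempty_equiv {B C : Type*} [Ring B] [Algebra k B] [Coalgebra k B]
    [Ring C] [Algebra k C] [Coalgebra k C] {f : B →ₐc[k] C} {g : C →ₐc[k] B}
    (h : g.comp f = .id k B) (h' : f.comp g = .id k C) : Nonempty (B ≃ₐc[k] C) :=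
  ⟨f.equivOfInverse g (fun x => DFunLike.congr_fun h x) fun x => DFunLike.congr_fun h' x⟩

/-- Left universal quantum linear semigroupoids are unique. -/
theorem LeftUQSGd.nonempty_equiv (L L' : LeftUQSGd.{u, v, x} 𝒜) :
    Nonempty (L.carrier ≃ₐc[k] L'.carrier) := by
  have key : ∀ L L' : LeftUQSGd.{u, v, x} 𝒜, ∀ (f : L.carrier →ₐc[k] L'.carrier)
      (g : L'.carrier →ₐc[k] L.carrier),
      (f : L.carrier →ₗ[k] L'.carrier).rTensor A ∘ₗ L.coact = L'.coact →
      (g : L'.carrier →ₗ[k] L.carrier).rTensor A ∘ₗ L'.coact = L.coact →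
      g.comp f = .id k L.carrier := fun L L' f g hf hg =>
    -- The composite and the identity both solve the universal problem of `L` for its own coaction.
    (L.universal L.carrier L.coact L.isCoaction L.basePreserving).unique
      (by rw [BialgHom.coe_comp_linearMap, LinearMap.rTensor_comp, LinearMap.comp_assoc, hf, hg])
      (by rw [BialgHom.coe_id_linearMap, LinearMap.rTensor_id, LinearMap.id_comp])
  obtain ⟨f, hf, -⟩ := L.universal _ L'.coact L'.isCoaction L'.basePreserving
  obtain ⟨g, hg, -⟩ := L'.universal _ L.coact L.isCoaction L.basePreserving
  exact BialgHom.nonempty_equiv (key L L' f g hf hg) (key L' L g f hg hf)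

/-- Right universal quantum linear semigroupoids are unique. -/
theorem RightUQSGd.nonempty_equiv (L L' : RightUQSGd.{u, v, x} 𝒜) :
    Nonempty (L.carrier ≃ₐc[k] L'.carrier) := by
  have key : ∀ L L' : RightUQSGd.{u, v, x} 𝒜, ∀ (f : L.carrier →ₐc[k] L'.carrier)
      (g : L'.carrier →ₐc[k] L.carrier),
      (f : L.carrier →ₗ[k] L'.carrier).lTensor A ∘ₗ L.coact = L'.coact →
      (g : L'.carrier →ₗ[k] L.carrier).lTensor A ∘ₗ L'.coact = L.coact →
      g.comp f = .id k L.carrier := fun L L' f g hf hg =>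
    (L.universal L.carrier L.coact L.isCoaction L.basePreserving).unique
      (by rw [BialgHom.coe_comp_linearMap, LinearMap.lTensor_comp, LinearMap.comp_assoc, hf, hg])
      (by rw [BialgHom.coe_id_linearMap, LinearMap.lTensor_id, LinearMap.id_comp])
  obtain ⟨f, hf, -⟩ := L.universal _ L'.coact L'.isCoaction L'.basePreserving
  obtain ⟨g, hg, -⟩ := L'.universal _ L.coact L.isCoaction L.basePreserving
  exact BialgHom.nonempty_equiv (key L L' f g hf hg) (key L' L g f hg hf)

/-- Transposed universal quantum linear semigroupoids are unique. -/
theorem TransUQSGd.nonempty_equiv {ι : ℕ → Type w} [∀ n, Fintype (ι n)] {vec : ∀ n, ι n → A}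
    (T T' : TransUQSGd.{u, v, w, x} 𝒜 vec) : Nonempty (T.carrier ≃ₐc[k] T'.carrier) := by
  have key : ∀ L L' : TransUQSGd.{u, v, w, x} 𝒜 vec, ∀ (f : L.carrier →ₐc[k] L'.carrier)
      (g : L'.carrier →ₐc[k] L.carrier),
      ((f : L.carrier →ₗ[k] L'.carrier).rTensor A ∘ₗ L.leftCoact = L'.leftCoact ∧
        (f : L.carrier →ₗ[k] L'.carrier).lTensor A ∘ₗ L.rightCoact = L'.rightCoact) →
      ((g : L'.carrier →ₗ[k] L.carrier).rTensor A ∘ₗ L'.leftCoact = L.leftCoact ∧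
        (g : L'.carrier →ₗ[k] L.carrier).lTensor A ∘ₗ L'.rightCoact = L.rightCoact) →
      g.comp f = .id k L.carrier := fun L L' f g hf hg =>
    (L.universal L.carrier L.leftCoact L.rightCoact L.isLeftCoaction L.isRightCoaction
      L.transposed L.leftBasePreserving L.rightBasePreserving).unique
      ⟨by rw [BialgHom.coe_comp_linearMap, LinearMap.rTensor_comp, LinearMap.comp_assoc, hf.1,
        hg.1], by rw [BialgHom.coe_comp_linearMap, LinearMap.lTensor_comp, LinearMap.comp_assoc,
        hf.2, hg.2]⟩
      ⟨by rw [BialgHom.coe_id_linearMap, LinearMap.rTensor_id, LinearMap.id_comp],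
        by rw [BialgHom.coe_id_linearMap, LinearMap.lTensor_id, LinearMap.id_comp]⟩
  obtain ⟨f, hf, -⟩ := T.universal _ T'.leftCoact T'.rightCoact T'.isLeftCoaction
    T'.isRightCoaction T'.transposed T'.leftBasePreserving T'.rightBasePreserving
  obtain ⟨g, hg, -⟩ := T'.universal _ T.leftCoact T.rightCoact T.isLeftCoaction
    T.isRightCoaction T.transposed T.leftBasePreserving T.rightBasePreserving
  exact BialgHom.nonempty_equiv (key T T' f g hf hg) (key T' T g f hg hf)

end Uniqueness

/-! ### Identification with the universal matrix algebras -/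

namespace PathAlgebra

variable {k : Type u} [Field k] {Q : Type v} [Quiver.{w} Q] [Fintype Q]
  [∀ i j : Q, Finite (i ⟶ j)] {I : TwoSidedIdeal (PathAlgebra k Q)}

theorem nonempty_equiv_of_left (hI : IsQuadratic I) (L : OLeft I) :
    Nonempty (L.carrier ≃ₐc[k] UnivMat {quadPart I}) :=
  L.nonempty_equiv (univLeft hI)

theorem nonempty_equiv_of_right (hI : IsQuadratic I) (R : ORight I) :
    Nonempty (R.carrier ≃ₐc[k] CoOpposite (UnivMat {quadPart I})) :=
  R.nonempty_equiv (univRight hI)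

theorem nonempty_equiv_of_trans (hI : IsQuadratic I) (T : OTrans I) :
    Nonempty (T.carrier ≃ₐc[k] UnivMat {quadPart I, (quadPart I).perp}) :=
  T.nonempty_equiv (univTrans hI)

end PathAlgebra
end

theorem theorem1p3 (k : Type u) [Field k] (Q : Type v) [Quiver.{w} Q] [Fintype Q]
    [∀ i j : Q, Finite (i ⟶ j)] (I : TwoSidedIdeal (PathAlgebra k Q))
    (hI : PathAlgebra.IsQuadratic I) :
    -- the universal quantum linear semigroupoids of `kQ/I` and of its quadratic dual exist
    (Nonempty (PathAlgebra.OLeft I) ∧ Nonempty (PathAlgebra.ORight I) ∧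
      Nonempty (PathAlgebra.OTrans I) ∧ Nonempty (PathAlgebra.OLeft (PathAlgebra.dualIdeal I)) ∧
      Nonempty (PathAlgebra.ORight (PathAlgebra.dualIdeal I)) ∧
      Nonempty (PathAlgebra.OTrans (PathAlgebra.dualIdeal I))) ∧
    -- (a)
    (∀ (L : PathAlgebra.OLeft I) (R : PathAlgebra.ORight (PathAlgebra.dualIdeal I)),
      Nonempty (L.carrier ≃ₐc[k] R.carrierᵐᵒᵖ)) ∧
    -- (b)
    (∀ (R : PathAlgebra.ORight I) (L : PathAlgebra.OLeft (PathAlgebra.dualIdeal I)),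
      Nonempty (R.carrier ≃ₐc[k] L.carrierᵐᵒᵖ)) ∧
    -- (c)
    (∀ (L : PathAlgebra.OLeft I) (R : PathAlgebra.ORight I),
      Nonempty (L.carrier ≃ₐc[k] CoOpposite R.carrier)) ∧
    -- (d)
    (∀ (T : PathAlgebra.OTrans I) (T' : PathAlgebra.OTrans (PathAlgebra.dualIdeal I)),
      Nonempty (T.carrier ≃ₐc[k] T'.carrierᵐᵒᵖ)) := by
  have hJ := PathAlgebra.isQuadratic_dualIdeal I
  have hX := PathAlgebra.quadPart_dualIdeal I
  refine ⟨⟨⟨PathAlgebra.univLeft hI⟩, ⟨PathAlgebra.univRight hI⟩, ⟨PathAlgebra.univTrans hI⟩,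
    ⟨PathAlgebra.univLeft hJ⟩, ⟨PathAlgebra.univRight hJ⟩, ⟨PathAlgebra.univTrans hJ⟩⟩,
    fun L R => ?_, fun R L => ?_, fun L R => ?_, fun T T' => ?_⟩
  -- With `X = quadPart I`, the chain is `L ≅ UnivMat {X} ≅ UnivMat {X*}^op ≅ (UnivMat
  -- {(X*)^⊥}^cop)^op ≅ R^op`.
  · obtain ⟨e⟩ := PathAlgebra.nonempty_equiv_of_left hI L
    obtain ⟨f⟩ := PathAlgebra.nonempty_equiv_of_right hJ R
    rw [hX] at f
    have g := UnivMat.copEquiv {(PathAlgebra.quadPart I).star} {(PathAlgebra.quadPart I).star.perp}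
      (by rintro _ rfl; rfl) (by rintro _ rfl; exact VertexSubmodule.perp_perp _)
    have m := UnivMat.mopEquiv {PathAlgebra.quadPart I} {(PathAlgebra.quadPart I).star}
      (by rintro _ rfl; rfl) (by rintro _ rfl; exact ⟨_, rfl, rfl⟩)
    exact ⟨e.trans (m.trans (g.trans f.symm).mop)⟩
  -- Here `R ≅ UnivMat {X}^cop ≅ UnivMat {X^⊥} ≅ UnivMat {(X^⊥)*}^op ≅ L^op`, and `(X^⊥)* = (X*)^⊥`.
  · obtain ⟨e⟩ := PathAlgebra.nonempty_equiv_of_right hI R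
    obtain ⟨f⟩ := PathAlgebra.nonempty_equiv_of_left hJ L
    rw [hX, ← VertexSubmodule.star_perp] at f
    have g := UnivMat.copEquiv {(PathAlgebra.quadPart I).perp} {PathAlgebra.quadPart I}
      (by rintro _ rfl; exact VertexSubmodule.perp_perp _) (by rintro _ rfl; rfl)
    have m := UnivMat.mopEquiv {(PathAlgebra.quadPart I).perp} {(PathAlgebra.quadPart I).perp.star}
      (by rintro _ rfl; rfl) (by rintro _ rfl; exact ⟨_, rfl, rfl⟩)
    exact ⟨e.trans (g.symm.trans (m.trans f.symm.mop))⟩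
  · obtain ⟨e⟩ := PathAlgebra.nonempty_equiv_of_left hI L
    obtain ⟨f⟩ := PathAlgebra.nonempty_equiv_of_right hI R
    exact ⟨e.trans ((CoOpposite.copCop k _).trans f.symm.cop)⟩
  -- The set `{X, X^⊥}` is stable under complements, so the dual ideal yields the reversed set
  -- `{(X^⊥)*, X*}` and reversal alone suffices.
  · obtain ⟨e⟩ := PathAlgebra.nonempty_equiv_of_trans hI T
    obtain ⟨f⟩ := PathAlgebra.nonempty_equiv_of_trans hJ T'
    rw [hX, VertexSubmodule.perp_perp, ← VertexSubmodule.star_perp] at f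
    have m := UnivMat.mopEquiv {PathAlgebra.quadPart I, (PathAlgebra.quadPart I).perp}
      {(PathAlgebra.quadPart I).perp.star, (PathAlgebra.quadPart I).star}
      (by rintro _ (rfl | rfl); exacts [Or.inr rfl, Or.inl rfl])
      (by
        rintro _ (rfl | rfl)
        exacts [⟨_, Or.inr rfl, rfl⟩, ⟨_, Or.inl rfl, rfl⟩])
    exact ⟨e.trans (m.trans f.symm.mop)⟩
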